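/- Let $d\ge 1$, $K\ge 1$ and $F=\{f_1,\dots,f_K\}\subset L^2(\mathbb R^d)$. For a set $G\subset L^2(\mathbb R^d)$ let $V(G)=\overline{\operatorname{span}}\{g(\cdot-n): g\in G,\ n\in\mathbb Z^d\}$, the closure being taken in $L^2(\mathbb R^d)$, and let $J$ be the smallest cardinality of a set $G\subset L^2(\mathbb R^d)$ with $V(G)=V(F)$. Suppose that $V(F)$ has non-trivial extra invariance: there is $\gamma\in\mathbb R^d\setminus\mathbb Z^d$ such that $h(\cdot-\gamma)\in V(F)$ for every $h\in V(F)$, and $J\gamma\notin\mathbb Z^d$. Let $1/2<s\le 1$ and suppose that the Fourier transforms satisfy $\widehat f_k\in W^{s,2}(\mathbb R^d)$ for $k=1,\dots,K$. Here $\widehat f(\xi)=\int_{\mathbb R^d} f(x)e^{-2\pi i\langle x,\xi\rangle}\,dx$, extended to $L^2(\mathbb R^d)$ as a unitary operator, and $W^{s,2}(\mathbb R^d)$ is the Sobolev–Slobodeckij space: for $0<s<1$ the space of all $g\in L^2(\mathbb R^d)$ with $\int_{\mathbb R^d}\int_{\mathbb R^d}\frac{|g(x)-g(y)|^2}{|x-y|^{d+2s}}\,dy\,dx<\infty$,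 and for $s=1$ the space of all $g\in L^2(\mathbb R^d)$ whose first-order weak partial derivatives all belong to $L^2(\mathbb R^d)$. Let $\widehat F=(\widehat f_1,\dots,\widehat f_K)^T$ and let $P(\widehat F)(x)=\sum_{n\in\mathbb Z^d}\widehat F(x+n)\widehat F(x+n)^*$ be the Gramian of $F$, a $\mathbb Z^d$-periodic, positive-semidefinite $K\times K$ matrix-valued function, with eigenvalues $\zeta_1(x)\ge\cdots\ge\zeta_K(x)\ge 0$ listed with multiplicity. Then $1\le J\le K$ and $$\mathcal H^{d-1}(\Sigma(\zeta_J))>0,$$ where $\mathcal H^{d-1}$ is the $(d-1)$-dimensional Hausdorff measure (the counting measure if $d=1$) and, for a $\mathbb Z^d$-periodic, locally integrable function $w$ on $\mathbb R^d$, with the torus $\mathbb R^d/\mathbb Z^d$ identified with $[-1/2,1/2)^d$, $$\Sigma(w)=\Big\{x\in[-1/2,1/2)^d:\ \limsup_{\tau\to0^+}\frac1{|I_\tau(x)|}\int_{I_\tau(x)}|w(y)|\,dy=0\Big\},\qquad I_\tau(x)=x+[-\tau,\tau]^d.$$ -/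

import Mathlib

open MeasureTheory Filter Topology
open scoped FourierTransform ENNReal ContDiff

noncomputable section

/-- Euclidean space `ℝ^d`. -/
abbrev Rd (d : ℕ) : Type := EuclideanSpace ℝ (Fin d)

/-- The Hilbert space `L²(ℝ^d)` of complex-valued functions (Lebesgue measure). -/
abbrev L2 (d : ℕ) : Type := Lp ℂ 2 (volume : Measure (Rd d))

/-- A point of `ℤ^d`, viewed in `ℝ^d`. -/
def latticePoint {d : ℕ} (n : Fin d → ℤ) : Rd d := WithLp.toLp 2 (fun i => (n i : ℝ))

/-- The integer lattice `ℤ^d ⊆ ℝ^d`. -/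
def integerLattice (d : ℕ) : Set (Rd d) := Set.range latticePoint

/-! ### Shift-invariant spaces -/

/-- The translate `x ↦ f (x - a)` of `f ∈ L²(ℝ^d)`. -/
def translateL2 {d : ℕ} (a : Rd d) (f : L2 d) : L2 d :=
  Lp.compMeasurePreserving (fun x : Rd d => x - a) (measurePreserving_sub_right volume a) f

/-- The shift-invariant space `V(G)` generated by a set `G ⊆ L²(ℝ^d)`: the closed linear span
of the integer translates of the elements of `G`. -/
def shiftInvariantSpace {d : ℕ} (G : Set (L2 d)) : Submodule ℂ (L2 d) :=
  (Submodule.span ℂ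
    {h : L2 d | ∃ g ∈ G, ∃ n : Fin d → ℤ, h = translateL2 (latticePoint n) g}).topologicalClosure

/-- The smallest cardinality of a finite set `G ⊆ L²(ℝ^d)` with `V(G) = V`. -/
def minGenerators {d : ℕ} (V : Submodule ℂ (L2 d)) : ℕ :=
  sInf {n : ℕ | ∃ G : Finset (L2 d), G.card = n ∧ shiftInvariantSpace (G : Set (L2 d)) = V}

/-- `V` has non-trivial extra invariance: it is invariant under the translation by some
`γ ∈ ℝ^d \ ℤ^d` such that `J γ ∉ ℤ^d`, where `J` is the minimal number of generators of `V`. -/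
def HasNontrivialExtraInvariance {d : ℕ} (V : Submodule ℂ (L2 d)) : Prop :=
  ∃ γ : Rd d, γ ∉ integerLattice d ∧ (∀ h ∈ V, translateL2 γ h ∈ V) ∧
    minGenerators V • γ ∉ integerLattice d

/-! ### Sobolev–Slobodeckij spaces `W^{s,2}(ℝ^d)` -/

/-- `h` is the weak (distributional) partial derivative `D_i g`; used for `g, h ∈ L²(ℝ^d)`. -/
def IsWeakPartialDeriv {d : ℕ} (i : Fin d) (g h : Rd d → ℂ) : Prop :=
  ∀ φ : Rd d → ℝ, ContDiff ℝ ∞ φ → HasCompactSupport φ →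
    ∫ x, (fderiv ℝ φ x (EuclideanSpace.single i 1)) • g x = - ∫ x, φ x • h x

/-- The square of the Slobodeckij semi-norm:
`∫ ∫ |g x - g y|² / |x - y|^(d + 2θ) dy dx`, for `0 < θ < 1`. -/
def slobodeckijSeminormSq {d : ℕ} (θ : ℝ) (g : Rd d → ℂ) : ℝ≥0∞ :=
  ∫⁻ x : Rd d, ∫⁻ y : Rd d, ‖g x - g y‖ₑ ^ 2 / ‖x - y‖ₑ ^ ((d : ℝ) + 2 * θ)

/-- Membership in `W^{n+θ,2}(ℝ^d)` for `n ∈ ℕ`, `0 ≤ θ < 1`: all weak derivatives of order at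
most `n` are in `L²`, and those of order `n` have finite Slobodeckij semi-norm of order `θ`
if `θ > 0`. -/
def MemSlobodeckijAux {d : ℕ} (θ : ℝ) : ℕ → (Rd d → ℂ) → Prop
  | 0, g => MemLp g 2 volume ∧ (0 < θ → slobodeckijSeminormSq θ g < ⊤)
  | n + 1, g => MemLp g 2 volume ∧
      ∀ i : Fin d, ∃ h : Rd d → ℂ, IsWeakPartialDeriv i g h ∧ MemSlobodeckijAux θ n h

/-- Membership in the Sobolev–Slobodeckij space `W^{s,2}(ℝ^d)`, for `s > 0`. -/
def MemSlobodeckij {d : ℕ} (s : ℝ) (g : Rd d → ℂ) : Prop :=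
  MemSlobodeckijAux (s - ⌊s⌋₊) ⌊s⌋₊ g

/-! ### The Gramian and its eigenvalues -/

/-- The Gramian `P(H)(x) = ∑_{n ∈ ℤ^d} H(x+n) H(x+n)^*` of `H = (h_1, …, h_K)^T`. -/
def gramian {d K : ℕ} (H : Fin K → Rd d → ℂ) (x : Rd d) : Matrix (Fin K) (Fin K) ℂ :=
  ∑' n : Fin d → ℤ,
    Matrix.vecMulVec (fun k => H k (x + latticePoint n))
      (star (fun k => H k (x + latticePoint n)))

theorem gramian_isHermitian {d K : ℕ} (H : Fin K → Rd d → ℂ) (x : Rd d) :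
    (gramian H x).IsHermitian := by
  unfold Matrix.IsHermitian gramian
  rw [Matrix.conjTranspose_tsum]
  refine tsum_congr fun n => ?_
  rw [Matrix.conjTranspose_vecMulVec, star_star]

/-- The eigenvalues `ζ_1(x) ≥ ⋯ ≥ ζ_K(x)` of the Gramian `P(H)(x)`, listed in decreasing order
with multiplicity; the index `j : Fin K` starts at `0`, so that `j` stands for `ζ_{j+1}`. -/
def gramianEigenvalue {d K : ℕ} (H : Fin K → Rd d → ℂ) (j : Fin K) (x : Rd d) : ℝ :=
  (gramian_isHermitian H x).eigenvalues₀ (Fin.cast (Fintype.card_fin K).symm j)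

/-! ### The generalized zero set -/

/-- The cube `x + [-τ, τ]^d`. -/
def cube {d : ℕ} (x : Rd d) (τ : ℝ) : Set (Rd d) := {y | ∀ i, |y i - x i| ≤ τ}

/-- The fundamental domain `[-1/2, 1/2)^d`, identified with the torus `ℝ^d / ℤ^d`. -/
def torusDomain (d : ℕ) : Set (Rd d) := {x | ∀ i, x i ∈ Set.Ico (-(1 / 2) : ℝ) (1 / 2)}

/-- The generalized zero set `Σ(w)` of a `ℤ^d`-periodic function `w` on `ℝ^d`: the set of all
points of the torus, at which the averages of `|w|` over cubes of width `2τ` have upper limit `0`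
as `τ → 0`. -/
def zeroSet {d : ℕ} (w : Rd d → ℝ) : Set (Rd d) :=
  {x | x ∈ torusDomain d ∧
    limsup (fun τ : ℝ => (∫⁻ y in cube x τ, ‖w y‖ₑ) / volume (cube x τ)) (𝓝[>] (0 : ℝ)) = 0}

end

/-! ### Families of vectors and spectral multiplicities -/

noncomputable section

open scoped InnerProductSpace

section LA
variable {E : Type*} [NormedAddCommGroup E] [InnerProductSpace ℂ E]

section
variable {ι : Type*} {φ ψ : ι → E} {Q : E →ₗ[ℂ] E}

/-! Write c(n) = exp(-2πi⟨γ,n⟩) and consider the fiber φ_n = F̂(x+n) ∈ ℂ^K, n ∈ ℤ^d. The Gramian at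
x is the frame operator v ↦ ∑ ⟨φ_n,v⟩ φ_n, and for almost every x its rank is at most J, because J
generators already produce all fibers. Invariance under γ yields, for almost every x, a linear map B
on ℂ^K with B φ_n = c(n) φ_n. So the vectors φ_n, colored by c(n), have independent spans, one for
each color a, of dimensions r_a(x) adding up to the rank.

Passing from x to x+e_i shifts the index, so r_a(x+e_i) = r_{al}(x) with l = c(e_i). If no dimension
changed between x and x+e_i, multiplication by l would permute the colors and preserve dimensions,
and comparing the products ∏ a^{r_a} would give l^rank = 1
(`pow_finrank_eq_one_of_finrank_classSpan_eq`). Where the rank is J this is impossible in a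
direction i with Jγ_i ∉ ℤ: some dimension must jump.

A jump is expensive: r_a(y) < r_a(x) implies ζ_J(x) ≤ ∑ |φ_n(x) - φ_n(y)|²
(`eigenvalues_le_of_finrank_classSpan_lt`). Also √ζ_J is 1-Lipschitz for the fiber distance
(`sqrt_eigenvalues_le`). The Sobolev hypothesis with s > 1/2 makes the energy ∫∫ dist²/|t-t'|^p
finite on almost every line parallel to e_i, for some 2 < p < 1+2s. Finite energy with p > 2 forces
Hölder continuity off a null set, so an integer-valued function of finite energy is constant. If ζ_J
were bounded below on a segment longer than one period, all r_a would be constant there, a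
contradiction. Hence √ζ_J, being Hölder, degenerates at some point of almost every line.

The Hölder constants are integrable over the lines, so Lebesgue differentiation turns these
one-dimensional zeros into zeros of the averages over full cubes. Thus Σ(ζ_J) meets almost every
line over a ball in ℝ^{d-1}, and projecting along e_i cannot increase the Hausdorff measure. -/

theorem hasSum_norm_inner_sq (hQ : ∀ v, HasSum (fun n => ⟪φ n, v⟫_ℂ • φ n) (Q v)) (v : E) :
    HasSum (fun n => ‖⟪φ n, v⟫_ℂ‖ ^ 2) (⟪v, Q v⟫_ℂ).re := by
  have h := ((hQ v).mapL (innerSL ℂ v)).mapL Complex.reCLM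
  simp only [innerSL_apply_apply, inner_smul_right, Complex.reCLM_apply] at h
  convert h using 2 with n
  rw [← inner_conj_symm v (φ n), Complex.mul_conj, Complex.normSq_eq_norm_sq, Complex.ofReal_re]

theorem tsum_norm_inner_sq_le {D : ℝ} (hD : HasSum (fun n => ‖φ n - ψ n‖ ^ 2) D) {v : E}
    (hv : ‖v‖ = 1) : Summable (fun n => ‖⟪φ n - ψ n, v⟫_ℂ‖ ^ 2) ∧
      ∑' n, ‖⟪φ n - ψ n, v⟫_ℂ‖ ^ 2 ≤ D := by
  have h : ∀ n, ‖⟪φ n - ψ n, v⟫_ℂ‖ ^ 2 ≤ ‖φ n - ψ n‖ ^ 2 := fun n => by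
    have := norm_inner_le_norm (𝕜 := ℂ) (φ n - ψ n) v
    rw [hv, mul_one] at this
    gcongr
  have hs : Summable (fun n => ‖⟪φ n - ψ n, v⟫_ℂ‖ ^ 2) :=
    Summable.of_nonneg_of_le (fun n => sq_nonneg _) h hD.summable
  exact ⟨hs, (hs.tsum_le_tsum h hD.summable).trans_eq hD.tsum_eq⟩

/-- Minkowski's inequality in ℓ². Summability of a is not required: it follows from that of b and a
- b. -/
theorem sqrt_tsum_sq_norm_le {a b : ι → ℂ} (hb : Summable fun n => ‖b n‖ ^ 2)
    (hab : Summable fun n => ‖a n - b n‖ ^ 2) :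
    √(∑' n, ‖a n‖ ^ 2) ≤ √(∑' n, ‖b n‖ ^ 2) + √(∑' n, ‖a n - b n‖ ^ 2) := by
  have mem : ∀ {f : ι → ℂ}, (Summable fun n => ‖f n‖ ^ 2) → Memℓp f 2 := fun hf =>
    memℓp_gen (by simpa using hf)
  have nrm : ∀ f : lp (fun _ : ι => ℂ) 2, ‖f‖ = √(∑' n, ‖f n‖ ^ 2) := fun f => by
    rw [lp.norm_eq_tsum_rpow (by simp), Real.sqrt_eq_rpow]; simp
  let B : lp (fun _ : ι => ℂ) 2 := ⟨b, mem hb⟩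
  let C : lp (fun _ : ι => ℂ) 2 := ⟨fun n => a n - b n, mem hab⟩
  have := norm_add_le B C
  rw [nrm, nrm, nrm] at this
  have hBC : ∀ n, (B + C) n = a n := fun n => by
    change b n + (a n - b n) = a n
    ring
  simpa only [hBC, B, C] using this

/-- The span of the vectors `φ n` of color `c n = a`. -/
def classSpan (c : ι → ℂ) (φ : ι → E) (a : ℂ) : Submodule ℂ E :=
  Submodule.span ℂ (φ '' {n | c n = a})

theorem iSup_classSpan (c : ι → ℂ) (φ : ι → E) :
    ⨆ a, classSpan c φ a = Submodule.span ℂ (Set.range φ) := by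
  simp only [classSpan]
  rw [← Submodule.span_iUnion, ← Set.image_iUnion]
  congr 1
  ext x; simp

/-- Each class span lies in an eigenspace of B, and eigenspaces for different eigenvalues are
independent. -/
theorem iSupIndep_classSpan {c : ι → ℂ} {B : E →ₗ[ℂ] E} (hB : ∀ n, B (φ n) = c n • φ n) :
    iSupIndep (classSpan c φ) := by
  refine (Module.End.eigenspaces_iSupIndep B).mono fun a => ?_
  rw [classSpan, Submodule.span_le]
  rintro _ ⟨n, rfl, rfl⟩
  exact Module.End.mem_eigenspace_iff.2 (hB n)

/-- Used for the translation x ↦ x + n₀, which shifts the index of the fiber and thereby multiplies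
all colors by l. -/
theorem classSpan_shift {G : Type*} [AddGroup G] {c : G → ℂ} {φ : G → E} {m : G} {l : ℂ}
    (hl : l ≠ 0) (hc : ∀ n, c (n + m) = c n * l) (a : ℂ) :
    classSpan c (fun n => φ (n + m)) a = classSpan c φ (a * l) := by
  rw [classSpan, classSpan]
  congr 1
  ext x
  constructor
  · rintro ⟨n, rfl, rfl⟩
    exact ⟨n + m, hc n, rfl⟩
  · rintro ⟨n, hn, rfl⟩
    refine ⟨n - m, mul_right_cancel₀ hl ?_, by simp⟩
    rw [← hc, sub_add_cancel]
    exact hn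

end

/-! ### Eigenvalues of symmetric operators -/

variable [FiniteDimensional ℂ E]

theorem LinearMap.IsSymmetric.re_inner_apply_self {n : ℕ} {S : E →ₗ[ℂ] E} (hS : S.IsSymmetric)
    (hn : Module.finrank ℂ E = n) (v : E) :
    (⟪v, S v⟫_ℂ).re = ∑ i, hS.eigenvalues hn i * ‖(hS.eigenvectorBasis hn).repr v i‖ ^ 2 := by
  rw [← (hS.eigenvectorBasis hn).repr.inner_map_map, PiLp.inner_apply, Complex.re_sum]
  refine Finset.sum_congr rfl fun i _ => ?_
  rw [hS.eigenvectorBasis_apply_self_apply hn]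
  simp only [RCLike.inner_apply]
  rw [mul_assoc]
  erw [Complex.re_ofReal_mul]
  rw [ Complex.mul_conj, Complex.ofReal_re,
    Complex.normSq_eq_norm_sq]
  rfl

/-- Half of the Courant–Fischer principle: a vector on which the first form is at least its `j`-th
eigenvalue and the second form is at most its `j`-th eigenvalue. -/
theorem LinearMap.IsSymmetric.exists_eigenvalues_le {n : ℕ} {S T : E →ₗ[ℂ] E}
    (hS : S.IsSymmetric) (hT : T.IsSymmetric) (hn : Module.finrank ℂ E = n) (j : Fin n) :
    ∃ v : E, ‖v‖ = 1 ∧ hS.eigenvalues hn j ≤ (⟪v, S v⟫_ℂ).re ∧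
      (⟪v, T v⟫_ℂ).re ≤ hT.eigenvalues hn j := by
  set b := hS.eigenvectorBasis hn
  set c := hT.eigenvectorBasis hn
  -- The n - 1 conditions, one for each i ≠ j: for i > j the S-coordinate of v vanishes, for i < j
  -- the T-coordinate does. A nonzero solution exists by dimension.
  let L : E →ₗ[ℂ] ({i : Fin n // i ≠ j} → ℂ) := LinearMap.pi fun i =>
    if j < i.1 then (LinearMap.proj i.1) ∘ₗ b.toBasis.equivFun.toLinearMap
    else (LinearMap.proj i.1) ∘ₗ c.toBasis.equivFun.toLinearMap
  have hL : LinearMap.ker L ≠ ⊥ := by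
    apply LinearMap.ker_ne_bot_of_finrank_lt
    rw [hn, Module.finrank_fintype_fun_eq_card]
    have := Fintype.card_subtype_lt (p := fun i : Fin n => i ≠ j) (x := j) (by simp)
    simpa using this
  obtain ⟨v, hv, hv0⟩ := (Submodule.ne_bot_iff _).1 hL
  have hLv : ∀ i (hi : i ≠ j), (if j < i then b.repr v i else c.repr v i) = 0 := by
    intro i hi
    have := congrFun (LinearMap.mem_ker.1 hv) ⟨i, hi⟩
    simp only [L, LinearMap.pi_apply] at this
    split_ifs with h
    · simpa [h] using this
    · simpa [h] using this
  have key : ∀ (a : ℂ), ∀ u : E, u = a • v →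
      (∀ i, j < i → b.repr u i = 0) ∧ (∀ i, i < j → c.repr u i = 0) := by
    rintro a u rfl
    refine ⟨fun i hi => ?_, fun i hi => ?_⟩
    · have := hLv i hi.ne'
      simp [hi] at this
      simp [this]
    · have := hLv i hi.ne
      simp [hi.not_gt] at this
      simp [this]
  set u : E := ((‖v‖⁻¹ : ℝ) : ℂ) • v with hu
  have hu1 : ‖u‖ = 1 := by
    rw [hu, norm_smul]; simp [hv0]
  obtain ⟨h1, h2⟩ := key _ u hu
  refine ⟨u, hu1, ?_, ?_⟩
  · rw [hS.re_inner_apply_self hn]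
    calc hS.eigenvalues hn j = ∑ i, hS.eigenvalues hn j * ‖b.repr u i‖ ^ 2 := by
          rw [← Finset.mul_sum, ← EuclideanSpace.norm_sq_eq, b.repr.norm_map, hu1]; simp
      _ ≤ _ := by
          refine Finset.sum_le_sum fun i _ => ?_
          rcases lt_or_ge j i with h | h
          · simp [h1 i h, b]
          · exact mul_le_mul_of_nonneg_right (hS.eigenvalues_antitone hn h) (sq_nonneg _)
  · rw [hT.re_inner_apply_self hn]
    calc _ ≤ ∑ i, hT.eigenvalues hn j * ‖c.repr u i‖ ^ 2 := by
          refine Finset.sum_le_sum fun i _ => ?_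
          rcases lt_or_ge i j with h | h
          · have := h2 i h
            simp [c] at this
            simp [this, c]
          · exact mul_le_mul_of_nonneg_right (hT.eigenvalues_antitone hn h) (sq_nonneg _)
      _ = _ := by
          rw [← Finset.mul_sum, ← EuclideanSpace.norm_sq_eq, c.repr.norm_map, hu1]; simp

theorem LinearMap.IsSymmetric.eigenvectorBasis_mem_of_eigenvalues_pos {n : ℕ} {S : E →ₗ[ℂ] E}
    (hS : S.IsSymmetric) (hn : Module.finrank ℂ E = n) {R : Submodule ℂ E} (hR : ∀ v, S v ∈ R)
    {j : Fin n} (hj : 0 < hS.eigenvalues hn j) {i : Fin n} (hi : i ≤ j) :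
    hS.eigenvectorBasis hn i ∈ R := by
  have hi0 : (hS.eigenvalues hn i : ℂ) ≠ 0 := by
    exact_mod_cast (hj.trans_le (hS.eigenvalues_antitone hn hi)).ne'
  have := R.smul_mem (hS.eigenvalues hn i : ℂ)⁻¹ (hR (hS.eigenvectorBasis hn i))
  rw [hS.apply_eigenvectorBasis hn, smul_smul] at this
  erw [inv_mul_cancel₀ hi0, one_smul] at this
  exact this

theorem LinearMap.IsSymmetric.finrank_span_eigenvectorBasis {n : ℕ} {S : E →ₗ[ℂ] E}
    (hS : S.IsSymmetric) (hn : Module.finrank ℂ E = n) (j : Fin n) :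
    Module.finrank ℂ (Submodule.span ℂ
      (Set.range fun i : Set.Iic j => hS.eigenvectorBasis hn i)) = j + 1 := by
  have hli : LinearIndependent ℂ fun i : Set.Iic j => hS.eigenvectorBasis hn i :=
    (hS.eigenvectorBasis hn).orthonormal.linearIndependent.comp
      (fun i : Set.Iic j => (i : Fin n)) Subtype.val_injective
  rw [finrank_span_eq_card hli]
  simp

/-- Eigenvectors with nonzero eigenvalue lie in the range of S, and the first j + 1 of them are
independent. -/
theorem LinearMap.IsSymmetric.lt_finrank_of_eigenvalues_pos {n : ℕ} {S : E →ₗ[ℂ] E}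
    (hS : S.IsSymmetric) (hn : Module.finrank ℂ E = n) {R : Submodule ℂ E} (hR : ∀ v, S v ∈ R)
    {j : Fin n} (hj : 0 < hS.eigenvalues hn j) : (j : ℕ) + 1 ≤ Module.finrank ℂ R := by
  rw [← hS.finrank_span_eigenvectorBasis hn j]
  refine Submodule.finrank_mono ?_
  rw [Submodule.span_le]
  rintro _ ⟨i, rfl⟩
  exact hS.eigenvectorBasis_mem_of_eigenvalues_pos hn hR hj i.2

/-- If the j-th eigenvalue is positive, the first j + 1 eigenvectors fill up R by dimension, so
vectors of R only see eigenvalues at least as large as the j-th. If it is zero, positivity of the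
form suffices. -/
theorem LinearMap.IsSymmetric.eigenvalues_mul_le_of_mem_of_finrank_le {n : ℕ} {S : E →ₗ[ℂ] E}
    (hS : S.IsSymmetric) (hn : Module.finrank ℂ E = n) (hpos : ∀ v, 0 ≤ (⟪v, S v⟫_ℂ).re)
    {R : Submodule ℂ E} (hR : ∀ v, S v ∈ R) (j : Fin n) (hj : Module.finrank ℂ R ≤ j + 1)
    {v : E} (hv : v ∈ R) : hS.eigenvalues hn j * ‖v‖ ^ 2 ≤ (⟪v, S v⟫_ℂ).re := by
  set b := hS.eigenvectorBasis hn
  have h0 : 0 ≤ hS.eigenvalues hn j := by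
    have := hpos (b j)
    rw [hS.apply_eigenvectorBasis hn, inner_smul_right, inner_self_eq_norm_sq_to_K] at this
    simpa using this
  rcases h0.eq_or_lt with h0 | h0
  · rw [← h0, zero_mul]; exact hpos v
  have hspan : Submodule.span ℂ (Set.range fun i : Set.Iic j => b i) = R := by
    apply Submodule.eq_of_le_of_finrank_le
    · rw [Submodule.span_le]
      rintro _ ⟨i, rfl⟩
      exact hS.eigenvectorBasis_mem_of_eigenvalues_pos hn hR h0 i.2
    · rwa [hS.finrank_span_eigenvectorBasis hn j]
  have hrepr : ∀ i, j < i → b.repr v i = 0 := by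
    intro i hi
    rw [b.repr_apply_apply]
    rw [← hspan] at hv
    refine Submodule.span_induction ?_ ?_ ?_ ?_ hv
    · rintro _ ⟨k, rfl⟩
      exact b.orthonormal.2 (ne_of_gt (lt_of_le_of_lt k.2 hi))
    · simp
    · intro x y _ _ hx hy; rw [inner_add_right, hx, hy, add_zero]
    · intro a x _ hx; rw [inner_smul_right, hx, mul_zero]
  rw [hS.re_inner_apply_self hn, ← b.repr.norm_map v, EuclideanSpace.norm_sq_eq, Finset.mul_sum]
  refine Finset.sum_le_sum fun i _ => ?_
  rcases lt_or_ge j i with h | h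
  · simp [hrepr i h, b]
  · exact mul_le_mul_of_nonneg_right (hS.eigenvalues_antitone hn h) (sq_nonneg _)

/-! ### Perturbation of the frame operator of a family of vectors -/

variable {ι : Type*} {φ ψ : ι → E} {Q P : E →ₗ[ℂ] E}

theorem mem_span_range_of_hasSum (hQ : ∀ v, HasSum (fun n => ⟪φ n, v⟫_ℂ • φ n) (Q v)) (v : E) :
    Q v ∈ Submodule.span ℂ (Set.range φ) := by
  refine (Submodule.closed_of_finiteDimensional _).mem_of_tendsto (hQ v) (Eventually.of_forall ?_)
  intro s
  exact Submodule.sum_mem _ fun n _ => Submodule.smul_mem _ _ (Submodule.subset_span ⟨n, rfl⟩)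

/-- On the Courant–Fischer vector v, the square roots of the two forms are ℓ²-norms of the
coefficients ⟪φ n, v⟫ and ⟪ψ n, v⟫, and these sequences differ by at most √D in ℓ². -/
theorem sqrt_eigenvalues_le {n : ℕ} (hn : Module.finrank ℂ E = n)
    (hQ : ∀ v, HasSum (fun n => ⟪φ n, v⟫_ℂ • φ n) (Q v))
    (hP : ∀ v, HasSum (fun n => ⟪ψ n, v⟫_ℂ • ψ n) (P v)) (hQs : Q.IsSymmetric)
    (hPs : P.IsSymmetric) {D : ℝ} (hD : HasSum (fun n => ‖φ n - ψ n‖ ^ 2) D) (j : Fin n) :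
    √(hQs.eigenvalues hn j) ≤ √(hPs.eigenvalues hn j) + √D := by
  obtain ⟨v, hv, h1, h2⟩ := hQs.exists_eigenvalues_le hPs hn j
  obtain ⟨hs, hle⟩ := tsum_norm_inner_sq_le hD hv
  have hq := hasSum_norm_inner_sq hQ v
  have hp := hasSum_norm_inner_sq hP v
  have := sqrt_tsum_sq_norm_le (a := fun n => ⟪φ n, v⟫_ℂ) hp.summable
    (by simpa only [inner_sub_left] using hs)
  simp only [← inner_sub_left] at this
  rw [hq.tsum_eq, hp.tsum_eq] at this
  calc _ ≤ _ := Real.sqrt_le_sqrt h1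
    _ ≤ _ := this
    _ ≤ _ := by gcongr

/-- The whole span is the direct sum of the class span of a and the span O of the other colors, so
the orthogonal complement of O inside it has the dimension of the class span. -/
theorem finrank_classSpan_inf {c : ι → ℂ} {B : E →ₗ[ℂ] E} (hB : ∀ n, B (φ n) = c n • φ n) (a : ℂ) :
    Module.finrank ℂ ((Submodule.span ℂ (φ '' {n | c n ≠ a}))ᗮ ⊓
      Submodule.span ℂ (Set.range φ) : Submodule ℂ E) = Module.finrank ℂ (classSpan c φ a) := by
  set O := Submodule.span ℂ (φ '' {n | c n ≠ a}) with hO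
  have hle : O ≤ Submodule.span ℂ (Set.range φ) := Submodule.span_mono (Set.image_subset_range _ _)
  have hsup : classSpan c φ a ⊔ O = Submodule.span ℂ (Set.range φ) := by
    rw [classSpan, hO, ← Submodule.span_union, ← Set.image_union, ← Set.image_univ]
    congr 2
    ext x; simp [em]
  have hdis : Disjoint (classSpan c φ a) O := by
    refine (iSupIndep_classSpan hB a).mono_right ?_
    rw [hO, Submodule.span_le]
    rintro _ ⟨n, hn, rfl⟩
    exact Submodule.mem_iSup_of_mem (c n) (Submodule.mem_iSup_of_mem hn
      (Submodule.subset_span ⟨n, rfl, rfl⟩))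
  have h1 := Submodule.finrank_add_inf_finrank_orthogonal hle
  have h2 := Submodule.finrank_sup_add_finrank_inf_eq (classSpan c φ a) O
  rw [hsup, hdis.eq_bot, finrank_bot] at h2
  omega

/-- A drop of dimension gives a unit vector v in the span of φ that is orthogonal to every φ n of
color ≠ a and to every ψ n of color a. For this v each coefficient ⟪φ n, v⟫ is either zero or equal
to ⟪φ n - ψ n, v⟫, so the form is at most D. It is at least the j-th eigenvalue, since the span has
dimension at most j + 1. -/
theorem eigenvalues_le_of_finrank_classSpan_lt {n : ℕ} (hn : Module.finrank ℂ E = n)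
    (hQ : ∀ v, HasSum (fun n => ⟪φ n, v⟫_ℂ • φ n) (Q v)) (hQs : Q.IsSymmetric)
    {c : ι → ℂ} {B : E →ₗ[ℂ] E} (hB : ∀ n, B (φ n) = c n • φ n)
    {D : ℝ} (hD : HasSum (fun n => ‖φ n - ψ n‖ ^ 2) D) (j : Fin n)
    (hj : Module.finrank ℂ (Submodule.span ℂ (Set.range φ)) ≤ j + 1) {a : ℂ}
    (ha : Module.finrank ℂ (classSpan c ψ a) < Module.finrank ℂ (classSpan c φ a)) :
    hQs.eigenvalues hn j ≤ D := by
  set U : Submodule ℂ E := (Submodule.span ℂ (φ '' {n | c n ≠ a}))ᗮ ⊓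
      Submodule.span ℂ (Set.range φ) with hU
  have hne : U ⊓ (classSpan c ψ a)ᗮ ≠ ⊥ := by
    intro h
    have h1 := Submodule.finrank_add_finrank_le_of_disjoint (disjoint_iff.2 h)
    have h2 := Submodule.finrank_add_finrank_orthogonal (classSpan c ψ a)
    have h3 := finrank_classSpan_inf hB a
    rw [← hU] at h3
    omega
  obtain ⟨w, ⟨⟨hwO, hwR⟩, hwc⟩, hw0⟩ := (Submodule.ne_bot_iff _).1 hne
  set v : E := ((‖w‖⁻¹ : ℝ) : ℂ) • w with hv
  have hv1 : ‖v‖ = 1 := by rw [hv, norm_smul]; simp [hw0]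
  have hvO := Submodule.smul_mem _ ((‖w‖⁻¹ : ℝ) : ℂ) hwO
  have hvR := Submodule.smul_mem _ ((‖w‖⁻¹ : ℝ) : ℂ) hwR
  have hvc := Submodule.smul_mem _ ((‖w‖⁻¹ : ℝ) : ℂ) hwc
  rw [← hv] at hvO hvR hvc
  have hq := hasSum_norm_inner_sq hQ
  obtain ⟨hs, hle⟩ := tsum_norm_inner_sq_le hD hv1
  have := hQs.eigenvalues_mul_le_of_mem_of_finrank_le hn
    (fun u => (hq u).nonneg fun n => sq_nonneg _) (mem_span_range_of_hasSum hQ) j hj hvR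
  rw [hv1, one_pow, mul_one] at this
  refine this.trans (le_trans ?_ hle)
  rw [← (hq v).tsum_eq]
  refine (hq v).summable.tsum_le_tsum (fun n => ?_) hs
  by_cases hn : c n = a
  · have : ⟪ψ n, v⟫_ℂ = 0 := hvc _ (Submodule.subset_span ⟨n, hn, rfl⟩)
    rw [inner_sub_left, this, sub_zero]
  · have : ⟪φ n, v⟫_ℂ = 0 := hvO _ (Submodule.subset_span ⟨n, hn, rfl⟩)
    rw [this]; simp

/-- Multiplication by l permutes the finitely many colors a with r a ≠ 0 and preserves r. Hence ∏
a^{r a} is unchanged by a ↦ a l, yet it picks up the factor l^{∑ r a}; the exponent is the dimension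
of the whole span because the class spans are independent. -/
theorem pow_finrank_eq_one_of_finrank_classSpan_eq {c : ι → ℂ} {B : E →ₗ[ℂ] E}
    (hB : ∀ n, B (φ n) = c n • φ n) (hc : ∀ n, c n ≠ 0) {l : ℂ} (hl : l ≠ 0)
    (h : ∀ a, Module.finrank ℂ (classSpan c φ (a * l)) = Module.finrank ℂ (classSpan c φ a)) :
    l ^ Module.finrank ℂ (Submodule.span ℂ (Set.range φ)) = 1 := by
  have hind := iSupIndep_classSpan hB
  have hfin : {a | classSpan c φ a ≠ ⊥}.Finite := WellFoundedGT.finite_ne_bot_of_iSupIndep hind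
  set S := hfin.toFinset with hS
  set r : ℂ → ℕ := fun a => Module.finrank ℂ (classSpan c φ a) with hr
  have hmem : ∀ a, a ∈ S ↔ r a ≠ 0 := fun a => by
    rw [hS, Set.Finite.mem_toFinset, Set.mem_ofPred_eq]
    simp only [hr, ne_eq, Submodule.finrank_eq_zero]
  have hsum : Module.finrank ℂ (Submodule.span ℂ (Set.range φ)) = ∑ a ∈ S, r a := by
    have : ∀ s : Finset ℂ, Module.finrank ℂ (s.sup (classSpan c φ) : Submodule ℂ E) =
        ∑ a ∈ s, r a := by
      intro s
      induction s using Finset.induction_on with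
      | empty => simp
      | insert a s ha ih =>
        have hd : Disjoint (classSpan c φ a) (s.sup (classSpan c φ)) :=
          (hind.supIndep' (insert a s)) (Finset.subset_insert a s) (Finset.mem_insert_self a s) ha
        have h2 := Submodule.finrank_sup_add_finrank_inf_eq (classSpan c φ a)
          (s.sup (classSpan c φ))
        rw [hd.eq_bot, finrank_bot, add_zero] at h2
        rw [Finset.sup_insert, h2, ih, Finset.sum_insert ha]
    have heq : (⨆ a, classSpan c φ a) = S.sup (classSpan c φ) := by
      refine le_antisymm (iSup_le fun a => ?_) (Finset.sup_le fun a _ => le_iSup _ a)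
      by_cases ha : a ∈ S
      · exact Finset.le_sup ha
      · rw [hmem, not_not, hr, Submodule.finrank_eq_zero] at ha
        rw [ha]; exact bot_le
    rw [← this, ← iSup_classSpan c φ, heq]
  -- The product must be cancelled, so no color in S may be zero.
  have h0 : ∀ a ∈ S, a ≠ 0 := by
    rintro a ha rfl
    rw [hmem] at ha
    apply ha
    have : {n | c n = 0} = ∅ := by ext n; simp [hc]
    have hbot : classSpan c φ 0 = ⊥ := by rw [classSpan, this]; simp
    simp only [hr]
    rw [hbot, finrank_bot]
  have hr' : ∀ a, r (a * l) = r a := h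
  have hprod : ∏ a ∈ S, a ^ r a = ∏ a ∈ S, (a * l) ^ r (a * l) := by
    symm
    refine Finset.prod_nbij' (fun a => a * l) (fun a => a / l) ?_ ?_ ?_ ?_ ?_
    · intro a ha; rw [hmem] at ha ⊢; rwa [hr']
    · intro a ha
      rw [hmem] at ha ⊢
      have := hr' (a / l)
      rw [div_mul_cancel₀ _ hl] at this
      rwa [← this]
    · intro a _; field_simp
    · intro a _; field_simp
    · intro a _; rfl
  simp_rw [hr', mul_pow, Finset.prod_mul_distrib, Finset.prod_pow_eq_pow_sum] at hprod
  rw [hsum]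
  have hne : ∏ a ∈ S, a ^ r a ≠ 0 := Finset.prod_ne_zero_iff.2 fun a ha => pow_ne_zero _ (h0 a ha)
  exact (mul_right_eq_self₀.1 hprod.symm).resolve_right hne
end LA

end

/-! ### Fibers and the Gramian -/

noncomputable section

open scoped InnerProductSpace

/-- The vector `(H_1(x+n), …, H_K(x+n))`. -/
def fiber {d K : ℕ} (H : Fin K → Rd d → ℂ) (x : Rd d) (n : Fin d → ℤ) :
    EuclideanSpace ℂ (Fin K) :=
  WithLp.toLp 2 fun k => H k (x + latticePoint n)

/-- The squared `ℓ²`-norm of the fiber of `H` at `x`. -/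
def fiberNormSq {d K : ℕ} (H : Fin K → Rd d → ℂ) (x : Rd d) : ℝ≥0∞ :=
  ∑' n, ‖fiber H x n‖ₑ ^ 2

/-- The squared `ℓ²`-distance of the fibers of `H` at `x` and `y`. -/
def fiberDistSq {d K : ℕ} (H : Fin K → Rd d → ℂ) (x y : Rd d) : ℝ≥0∞ :=
  ∑' n, ‖fiber H x n - fiber H y n‖ₑ ^ 2

theorem hasSum_norm_sq_of_tsum_enorm_sq_ne_top {ι E : Type*} [NormedAddCommGroup E] {f : ι → E}
    (h : ∑' n, ‖f n‖ₑ ^ 2 ≠ ⊤) :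
    HasSum (fun n => ‖f n‖ ^ 2) (∑' n, ‖f n‖ₑ ^ 2).toReal := by
  have he : ∀ n, ‖f n‖ₑ ^ 2 = ENNReal.ofReal (‖f n‖ ^ 2) := fun n => by
    rw [ENNReal.ofReal_pow (norm_nonneg _), ofReal_norm]
  have hs : Summable fun n => ‖f n‖ ^ 2 :=
    (ENNReal.summable_toReal h).congr fun n => by rw [ENNReal.toReal_pow, toReal_enorm]
  have heq : (∑' n, ‖f n‖ₑ ^ 2).toReal = ∑' n, ‖f n‖ ^ 2 := by
    simp_rw [he]
    rw [← ENNReal.ofReal_tsum_of_nonneg (fun n => sq_nonneg _) hs,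
      ENNReal.toReal_ofReal (tsum_nonneg fun n => sq_nonneg _)]
  rw [heq]
  exact hs.hasSum

variable {d K : ℕ} {H : Fin K → Rd d → ℂ} {x y : Rd d}

theorem summable_gramian_entry (hx : fiberNormSq H x ≠ ⊤) (i j : Fin K) :
    Summable fun n : Fin d → ℤ => H i (x + latticePoint n) * star (H j (x + latticePoint n)) := by
  refine (hasSum_norm_sq_of_tsum_enorm_sq_ne_top hx).summable.of_norm_bounded fun n => ?_
  have h : ∀ k, ‖H k (x + latticePoint n)‖ ≤ ‖fiber H x n‖ := fun k =>
    PiLp.norm_apply_le (fiber H x n) k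
  rw [norm_mul, norm_star, sq]
  exact mul_le_mul (h i) (h j) (norm_nonneg _) (norm_nonneg _)

theorem hasSum_gramian (hx : fiberNormSq H x ≠ ⊤) :
    HasSum (fun n : Fin d → ℤ => Matrix.vecMulVec (fun k => H k (x + latticePoint n))
      (star (fun k => H k (x + latticePoint n)))) (gramian H x) := by
  apply Summable.hasSum
  refine Pi.summable.2 fun i => Pi.summable.2 fun j => ?_
  exact summable_gramian_entry hx i j

theorem gramian_apply (hx : fiberNormSq H x ≠ ⊤) (i j : Fin K) :
    gramian H x i j = ∑' n, H i (x + latticePoint n) * star (H j (x + latticePoint n)) :=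
  (Pi.hasSum.1 (Pi.hasSum.1 (hasSum_gramian hx) i) j).tsum_eq.symm

/-- Identifies the Gramian with the frame operator of the fiber, so the abstract perturbation bounds
apply with E = ℂ^K. -/
theorem hasSum_inner_smul_fiber (hx : fiberNormSq H x ≠ ⊤) (v : EuclideanSpace ℂ (Fin K)) :
    HasSum (fun n => ⟪fiber H x n, v⟫_ℂ • fiber H x n)
      (Matrix.toEuclideanLin (gramian H x) v) := by
  let L : Matrix (Fin K) (Fin K) ℂ →ₗ[ℂ] EuclideanSpace ℂ (Fin K) :=
    (LinearMap.applyₗ v) ∘ₗ (Matrix.toEuclideanLin (𝕜 := ℂ)).toLinearMap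
  have hL : Continuous L := LinearMap.continuous_of_finiteDimensional L
  change HasSum _ (L (gramian H x))
  convert (hasSum_gramian hx).map L hL using 1
  ext n k
  simp only [fiber, PiLp.smul_apply, smul_eq_mul, Function.comp_apply, L, LinearMap.comp_apply,
    LinearMap.applyₗ_apply_apply, LinearEquiv.coe_coe, Matrix.toLpLin_apply,
    Matrix.vecMulVec_mulVec, PiLp.inner_apply, RCLike.inner_apply]
  simp [dotProduct, Finset.mul_sum, mul_comm, mul_left_comm]

theorem isSymmetric_gramian (H : Fin K → Rd d → ℂ) (x : Rd d) :
    (Matrix.toEuclideanLin (gramian H x)).IsSymmetric :=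
  Matrix.isSymmetric_toEuclideanLin_iff.mpr (gramian_isHermitian H x)

theorem gramianEigenvalue_eq (H : Fin K → Rd d → ℂ) (j : Fin K) (x : Rd d) :
    gramianEigenvalue H j x = (isSymmetric_gramian H x).eigenvalues finrank_euclideanSpace
      (Fin.cast (Fintype.card_fin K).symm j) := rfl

theorem gramianEigenvalue_nonneg (hx : fiberNormSq H x ≠ ⊤) (j : Fin K) :
    0 ≤ gramianEigenvalue H j x := by
  rw [gramianEigenvalue_eq]
  obtain ⟨v, hv, h1, h2⟩ := (isSymmetric_gramian H x).exists_eigenvalues_le (isSymmetric_gramian H x)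
    finrank_euclideanSpace (Fin.cast (Fintype.card_fin K).symm j)
  exact ((hasSum_norm_inner_sq (hasSum_inner_smul_fiber hx) v).nonneg fun n => sq_nonneg _).trans h2

theorem ofReal_gramianEigenvalue_le_fiberNormSq (hx : fiberNormSq H x ≠ ⊤) (j : Fin K) :
    ENNReal.ofReal (gramianEigenvalue H j x) ≤ fiberNormSq H x := by
  rw [gramianEigenvalue_eq]
  obtain ⟨v, hv, h1, -⟩ := (isSymmetric_gramian H x).exists_eigenvalues_le (isSymmetric_gramian H x)
    finrank_euclideanSpace (Fin.cast (Fintype.card_fin K).symm j)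
  refine ENNReal.ofReal_le_of_le_toReal (h1.trans ?_)
  refine hasSum_le (fun n => ?_) (hasSum_norm_inner_sq (hasSum_inner_smul_fiber hx) v)
    (hasSum_norm_sq_of_tsum_enorm_sq_ne_top hx)
  have := norm_inner_le_norm (𝕜 := ℂ) (fiber H x n) v
  rw [hv, mul_one] at this
  gcongr

theorem fiberDistSq_comm (H : Fin K → Rd d → ℂ) (x y : Rd d) :
    fiberDistSq H x y = fiberDistSq H y x := by
  simp only [fiberDistSq]
  exact tsum_congr fun n => by rw [← enorm_neg, neg_sub]

theorem sqrt_gramianEigenvalue_le (hx : fiberNormSq H x ≠ ⊤) (hy : fiberNormSq H y ≠ ⊤)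
    (hD : fiberDistSq H x y ≠ ⊤) (j : Fin K) :
    √(gramianEigenvalue H j x) ≤ √(gramianEigenvalue H j y) + √(fiberDistSq H x y).toReal := by
  have hD' : HasSum (fun n => ‖fiber H x n - fiber H y n‖ ^ 2) (fiberDistSq H x y).toReal :=
    hasSum_norm_sq_of_tsum_enorm_sq_ne_top hD
  rw [gramianEigenvalue_eq, gramianEigenvalue_eq]
  exact sqrt_eigenvalues_le finrank_euclideanSpace (hasSum_inner_smul_fiber hx)
    (hasSum_inner_smul_fiber hy) (isSymmetric_gramian H x) (isSymmetric_gramian H y) hD' _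

theorem ofReal_sq_sqrt_gramianEigenvalue_sub_le (hx : fiberNormSq H x ≠ ⊤)
    (hy : fiberNormSq H y ≠ ⊤) (j : Fin K) :
    ENNReal.ofReal ((√(gramianEigenvalue H j x) - √(gramianEigenvalue H j y)) ^ 2) ≤
      fiberDistSq H x y := by
  by_cases hD : fiberDistSq H x y = ⊤
  · rw [hD]; exact le_top
  have h1 := sqrt_gramianEigenvalue_le hx hy hD j
  rw [fiberDistSq_comm] at hD
  have h2 := sqrt_gramianEigenvalue_le hy hx hD j
  rw [fiberDistSq_comm H y x] at h2
  refine ENNReal.ofReal_le_of_le_toReal ?_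
  rw [← Real.sq_sqrt (ENNReal.toReal_nonneg (a := fiberDistSq H x y))]
  exact sq_le_sq' (by linarith) (by linarith)

theorem ofReal_gramianEigenvalue_le_fiberDistSq (hx : fiberNormSq H x ≠ ⊤)
    {c : (Fin d → ℤ) → ℂ} {B : EuclideanSpace ℂ (Fin K) →ₗ[ℂ] EuclideanSpace ℂ (Fin K)}
    (hB : ∀ n, B (fiber H x n) = c n • fiber H x n) (j : Fin K)
    (hj : Module.finrank ℂ (Submodule.span ℂ (Set.range (fiber H x))) ≤ j + 1) {a : ℂ}
    (ha : Module.finrank ℂ (classSpan c (fiber H y) a) <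
      Module.finrank ℂ (classSpan c (fiber H x) a)) :
    ENNReal.ofReal (gramianEigenvalue H j x) ≤ fiberDistSq H x y := by
  by_cases hD : fiberDistSq H x y = ⊤
  · rw [hD]; exact le_top
  exact ENNReal.ofReal_le_of_le_toReal (eigenvalues_le_of_finrank_classSpan_lt
    finrank_euclideanSpace (hasSum_inner_smul_fiber hx) (isSymmetric_gramian H x) hB
    (hasSum_norm_sq_of_tsum_enorm_sq_ne_top hD) (Fin.cast (Fintype.card_fin K).symm j) hj ha)

/-- Below full rank the last eigenvalue vanishes. -/
theorem gramianEigenvalue_eq_zero_of_finrank_lt (hx : fiberNormSq H x ≠ ⊤) (j : Fin K)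
    (hj : Module.finrank ℂ (Submodule.span ℂ (Set.range (fiber H x))) < j + 1) :
    gramianEigenvalue H j x = 0 := by
  by_contra hne
  have hpos : 0 < gramianEigenvalue H j x := lt_of_le_of_ne (gramianEigenvalue_nonneg hx j) (Ne.symm hne)
  have := (isSymmetric_gramian H x).lt_finrank_of_eigenvalues_pos finrank_euclideanSpace
    (mem_span_range_of_hasSum (hasSum_inner_smul_fiber hx))
    (j := Fin.cast (Fintype.card_fin K).symm j) hpos
  simp only [Fin.val_cast] at this
  omega

/-! ### Measurability -/

/-- Weyl's perturbation inequality, read off from the Courant–Fischer vector. -/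
theorem Matrix.IsHermitian.eigenvalues₀_le_add {n : Type*} [Fintype n] [DecidableEq n]
    {A B : Matrix n n ℂ} (hA : A.IsHermitian) (hB : B.IsHermitian) (j : Fin (Fintype.card n)) :
    hA.eigenvalues₀ j ≤ hB.eigenvalues₀ j + ‖Matrix.toEuclideanCLM (𝕜 := ℂ) (A - B)‖ := by
  obtain ⟨v, hv, h1, h2⟩ := (Matrix.isSymmetric_toEuclideanLin_iff.mpr hA).exists_eigenvalues_le
    (Matrix.isSymmetric_toEuclideanLin_iff.mpr hB) finrank_euclideanSpace j
  have h3 : (⟪v, Matrix.toEuclideanCLM (𝕜 := ℂ) (A - B) v⟫_ℂ).re ≤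
      ‖Matrix.toEuclideanCLM (𝕜 := ℂ) (A - B)‖ := by
    refine (Complex.re_le_norm _).trans ((norm_inner_le_norm _ _).trans ?_)
    have := (Matrix.toEuclideanCLM (𝕜 := ℂ) (A - B)).le_opNorm v
    rw [hv, mul_one] at this
    rwa [hv, one_mul]
  have h4 : Matrix.toEuclideanCLM (𝕜 := ℂ) (A - B) v =
      Matrix.toEuclideanLin A v - Matrix.toEuclideanLin B v := by
    rw [← LinearMap.sub_apply, ← map_sub]; rfl
  rw [h4, inner_sub_right, Complex.sub_re] at h3
  change hA.eigenvalues₀ j ≤ _ at h1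
  change _ ≤ hB.eigenvalues₀ j at h2
  linarith

/-- Going through A + A^* makes the eigenvalue a function on the whole matrix space, where Weyl's
inequality gives continuity. -/
theorem continuous_eigenvalues₀_add_conjTranspose {n : Type*} [Fintype n] [DecidableEq n]
    (j : Fin (Fintype.card n)) : Continuous fun A : Matrix n n ℂ =>
      (Matrix.isHermitian_add_transpose_self A).eigenvalues₀ j := by
  let L : Matrix n n ℂ →ₗ[ℂ] (EuclideanSpace ℂ n →L[ℂ] EuclideanSpace ℂ n) :=
    (Matrix.toEuclideanCLM (n := n) (𝕜 := ℂ)).toAlgEquiv.toLinearEquiv.toLinearMap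
  have hL : Continuous L := LinearMap.continuous_of_finiteDimensional L
  refine continuous_iff_continuousAt.2 fun A => ?_
  have h0 : Tendsto (fun B => ‖L ((B + B.conjTranspose) - (A + A.conjTranspose))‖) (𝓝 A)
      (𝓝 0) := by
    have hc : Continuous fun B : Matrix n n ℂ =>
        ‖L ((B + B.conjTranspose) - (A + A.conjTranspose))‖ := by fun_prop
    have := hc.tendsto A
    simpa using this
  rw [ContinuousAt, tendsto_iff_norm_sub_tendsto_zero]
  refine squeeze_zero (fun _ => norm_nonneg _) (fun B => ?_) h0
  have h1 := (Matrix.isHermitian_add_transpose_self B).eigenvalues₀_le_add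
    (Matrix.isHermitian_add_transpose_self A) j
  have h2 := (Matrix.isHermitian_add_transpose_self A).eigenvalues₀_le_add
    (Matrix.isHermitian_add_transpose_self B) j
  rw [← neg_sub, map_neg, norm_neg] at h2
  rw [Real.norm_eq_abs, abs_le]
  exact ⟨by linarith! , by linarith!⟩

theorem measurable_fiber (hH : ∀ k, Measurable (H k)) (n : Fin d → ℤ) :
    Measurable fun x => fiber H x n := by
  refine (WithLp.measurable_toLp 2 _).comp (measurable_pi_lambda _ fun k => ?_)
  exact (hH k).comp (measurable_id.add_const _)

theorem measurable_fiberNormSq (hH : ∀ k, Measurable (H k)) : Measurable (fiberNormSq H) :=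
  Measurable.tsum fun n => (measurable_fiber hH n).enorm.pow_const 2

theorem measurable_fiberDistSq (hH : ∀ k, Measurable (H k)) :
    Measurable fun p : Rd d × Rd d => fiberDistSq H p.1 p.2 :=
  Measurable.tsum fun n => (((measurable_fiber hH n).comp measurable_fst).sub
    ((measurable_fiber hH n).comp measurable_snd)).enorm.pow_const 2

/-- The rank is at least r exactly when some r vectors of color a are independent: a countable union
of conditions, each of them open in the chosen vectors. -/
theorem measurableSet_le_finrank_classSpan (hH : ∀ k, Measurable (H k)) (c : (Fin d → ℤ) → ℂ)
    (a : ℂ) (r : ℕ) :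
    MeasurableSet {x | r ≤ Module.finrank ℂ (classSpan c (fiber H x) a)} := by
  have : {x | r ≤ Module.finrank ℂ (classSpan c (fiber H x) a)} =
      ⋃ m : Fin r → {n // c n = a}, {x | LinearIndependent ℂ fun i => fiber H x (m i)} := by
    ext x
    simp only [Set.mem_ofPred_eq, Set.mem_iUnion]
    constructor
    · intro h
      obtain ⟨f, hf, -, hli⟩ := Submodule.exists_fun_fin_finrank_span_eq ℂ
        (fiber H x '' {n | c n = a})
      choose g hg hgf using hf
      refine ⟨fun i => ⟨g (Fin.castLE h i), hg _⟩, ?_⟩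
      have := hli.comp (Fin.castLE h) (Fin.castLE_injective h)
      have he : (fun i => fiber H x (g (Fin.castLE h i))) = f ∘ Fin.castLE h :=
        funext fun i => hgf _
      rw [he]
      exact this
    · rintro ⟨m, hm⟩
      have := finrank_span_eq_card hm
      rw [Fintype.card_fin] at this
      rw [← this]
      refine Submodule.finrank_mono (Submodule.span_mono ?_)
      rintro _ ⟨i, rfl⟩
      exact ⟨m i, (m i).2, rfl⟩
  rw [this]
  refine MeasurableSet.iUnion fun m => ?_
  have ho : IsOpen {f : Fin r → EuclideanSpace ℂ (Fin K) | LinearIndependent ℂ f} :=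
    isOpen_setOfPred_linearIndependent
  exact (measurable_pi_lambda (fun x i => fiber H x (m i)) fun i => measurable_fiber hH _)
    ho.measurableSet

theorem measurable_finrank_classSpan (hH : ∀ k, Measurable (H k)) (c : (Fin d → ℤ) → ℂ) (a : ℂ) :
    Measurable fun x => Module.finrank ℂ (classSpan c (fiber H x) a) :=
  measurable_of_Ici fun r => measurableSet_le_finrank_classSpan hH c a r

theorem aemeasurable_gramianEigenvalue (hH : ∀ k, Measurable (H k))
    (hfin : ∀ᵐ x, fiberNormSq H x ≠ ⊤) (j : Fin K) :
    AEMeasurable (gramianEigenvalue H j) := by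
  let f : (Fin K → Fin K → ℂ) → ℝ := fun A =>
    (Matrix.isHermitian_add_transpose_self (Matrix.of A)).eigenvalues₀
      (Fin.cast (Fintype.card_fin K).symm j)
  have hf : Continuous f := continuous_eigenvalues₀_add_conjTranspose _
  -- Half of the Gramian, computed entrywise: adding the conjugate transpose gives the Gramian back
  -- wherever the fiber is square summable.
  let g : Rd d → Fin K → Fin K → ℂ := fun x i k => (1 / 2 : ℂ) *
    ∑' n, H i (x + latticePoint n) * star (H k (x + latticePoint n))
  have hg : Measurable g := by
    refine measurable_pi_lambda _ fun i => measurable_pi_lambda _ fun k => ?_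
    refine Measurable.const_mul (Measurable.tsum fun n => ?_) _
    have h : ∀ i, Measurable fun x => H i (x + latticePoint n) := fun i =>
      (hH i).comp (measurable_id.add_const _)
    exact (h i).mul (continuous_star.measurable.comp (h k))
  refine ⟨fun x => f (g x), hf.measurable.comp hg, ?_⟩
  filter_upwards [hfin] with x hx
  have hgx : Matrix.of (g x) = (1 / 2 : ℂ) • gramian H x := by
    ext i k
    rw [Matrix.of_apply, Matrix.smul_apply, gramian_apply hx, smul_eq_mul]
  have : Matrix.of (g x) + (Matrix.of (g x)).conjTranspose = gramian H x := by
    rw [hgx, Matrix.conjTranspose_smul, (gramian_isHermitian H x).eq, ← add_smul]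
    norm_num
  simp only [gramianEigenvalue, f]
  congr 1
  exact this.symm

end

/-! ### Functions of finite energy on an interval -/

noncomputable section

open scoped InnerProductSpace

theorem sq_lintegral_le_lintegral_sq {α : Type*} [MeasurableSpace α] {μ : Measure α}
    [IsProbabilityMeasure μ] {g : α → ℝ≥0∞} (hg : AEMeasurable g μ) :
    (∫⁻ x, g x ∂μ) ^ 2 ≤ ∫⁻ x, g x ^ 2 ∂μ := by
  have h := ENNReal.lintegral_mul_le_Lp_mul_Lq μ Real.HolderConjugate.two_two hg
    (aemeasurable_const (b := (1 : ℝ≥0∞)))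
  simp only [Pi.mul_apply, mul_one, ENNReal.one_rpow, lintegral_const, measure_univ] at h
  have h2 := pow_le_pow_left' h 2
  rw [← ENNReal.rpow_natCast, ← ENNReal.rpow_natCast, ← ENNReal.rpow_mul] at h2
  norm_num at h2
  exact h2

/-- The difference of means is a double mean of f x - f y; apply Jensen in each variable. -/
theorem sq_enorm_integral_sub_integral_le {P Q : Measure ℝ} [IsProbabilityMeasure P]
    [IsProbabilityMeasure Q] {f : ℝ → ℝ} (hf : Measurable f) (hP : Integrable f P)
    (hQ : Integrable f Q) :
    ‖∫ x, f x ∂P - ∫ y, f y ∂Q‖ₑ ^ 2 ≤ ∫⁻ x, ∫⁻ y, ‖f x - f y‖ₑ ^ 2 ∂Q ∂P := by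
  have h1 : ∫ x, f x ∂P - ∫ y, f y ∂Q = ∫ x, ∫ y, (f x - f y) ∂Q ∂P := by
    have : ∀ x, ∫ y, (f x - f y) ∂Q = f x - ∫ y, f y ∂Q := fun x => by
      rw [integral_sub (integrable_const _) hQ]; simp
    simp_rw [this]
    rw [integral_sub hP (integrable_const _)]; simp
  have hm : Measurable fun p : ℝ × ℝ => ‖f p.1 - f p.2‖ₑ :=
    ((hf.comp measurable_fst).sub (hf.comp measurable_snd)).enorm
  calc ‖∫ x, f x ∂P - ∫ y, f y ∂Q‖ₑ ^ 2 ≤ (∫⁻ x, ∫⁻ y, ‖f x - f y‖ₑ ∂Q ∂P) ^ 2 := by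
        rw [h1]
        gcongr
        refine (enorm_integral_le_lintegral_enorm _).trans (lintegral_mono fun x => ?_)
        exact enorm_integral_le_lintegral_enorm _
    _ ≤ ∫⁻ x, (∫⁻ y, ‖f x - f y‖ₑ ∂Q) ^ 2 ∂P :=
        sq_lintegral_le_lintegral_sq hm.lintegral_prod_right'.aemeasurable
    _ ≤ _ := lintegral_mono fun x => sq_lintegral_le_lintegral_sq
        (measurable_const.sub hf).enorm.aemeasurable

/-- The energy `∫_I ∫_I |f x - f y|² / |x - y|^p` of a function on the line. -/
noncomputable def energyOn (I : Set ℝ) (p : ℝ) (f : ℝ → ℝ) : ℝ≥0∞ :=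
  ∫⁻ x in I, ∫⁻ y in I, ‖f x - f y‖ₑ ^ 2 / ‖x - y‖ₑ ^ p

/-- On A × B the weight satisfies |x - y|^p ≤ r^p, so inserting it costs only the factor r^p. -/
theorem sq_enorm_average_sub_average_le {f : ℝ → ℝ} (hf : Measurable f) {I A B : Set ℝ}
    (hfI : IntegrableOn f I) (hAI : A ⊆ I) (hBI : B ⊆ I) (hA : volume A ≠ 0) (hB : volume B ≠ 0)
    (hA' : volume A ≠ ⊤) (hB' : volume B ≠ ⊤)
    (hAm : MeasurableSet A) (hBm : MeasurableSet B) {r p : ℝ} (hp : 0 < p)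
    (hr : ∀ x ∈ A, ∀ y ∈ B, |x - y| ≤ r) :
    ‖(⨍ x in A, f x) - ⨍ y in B, f y‖ₑ ^ 2 ≤
      (volume A)⁻¹ * (volume B)⁻¹ * (ENNReal.ofReal r ^ p * energyOn I p f) := by
  have key : ∀ s : Set ℝ, volume s ≠ 0 → volume s ≠ ⊤ →
      IsProbabilityMeasure ((volume s)⁻¹ • volume.restrict s) := fun s h0 h1 =>
    ⟨by simp [ENNReal.inv_mul_cancel h0 h1]⟩
  have := key A hA hA'
  have := key B hB hB'
  have hav : ∀ s : Set ℝ, ⨍ x in s, f x = ∫ x, f x ∂((volume s)⁻¹ • volume.restrict s) :=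
    fun s => by rw [average, Measure.restrict_apply_univ]
  rw [hav, hav]
  refine (sq_enorm_integral_sub_integral_le hf
    ((hfI.mono_set hAI).smul_measure (ENNReal.inv_ne_top.2 hA))
    ((hfI.mono_set hBI).smul_measure (ENNReal.inv_ne_top.2 hB))).trans ?_
  simp only [lintegral_smul_measure, smul_eq_mul]
  rw [lintegral_const_mul', ← mul_assoc]
  swap; · exact ENNReal.inv_ne_top.2 hB
  gcongr
  have hpt : ∀ x ∈ A, ∀ y ∈ B, ‖f x - f y‖ₑ ^ 2 ≤
      ENNReal.ofReal r ^ p * (‖f x - f y‖ₑ ^ 2 / ‖x - y‖ₑ ^ p) := by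
    intro x hx y hy
    rcases eq_or_ne x y with rfl | hxy
    · simp
    have hne : ‖x - y‖ₑ ≠ 0 := by simpa [sub_eq_zero] using hxy
    have hle : ‖x - y‖ₑ ^ p ≤ ENNReal.ofReal r ^ p := by
      rw [← ofReal_norm]
      gcongr
      exact hr x hx y hy
    rw [← mul_div_assoc, ENNReal.le_div_iff_mul_le, mul_comm]
    · gcongr
    · left; simp [hne]
    · left; exact ENNReal.rpow_ne_top_of_nonneg hp.le (by simp)
  rw [energyOn, ← lintegral_const_mul']
  swap; · exact ENNReal.rpow_ne_top_of_nonneg hp.le (by simp)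
  calc _ ≤ ∫⁻ x in A, ENNReal.ofReal r ^ p * ∫⁻ y in I, ‖f x - f y‖ₑ ^ 2 / ‖x - y‖ₑ ^ p := by
        refine setLIntegral_mono' hAm fun x hx => ?_
        rw [← lintegral_const_mul']
        swap; · exact ENNReal.rpow_ne_top_of_nonneg hp.le (by simp)
        exact (setLIntegral_mono' hBm fun y hy => hpt x hx y hy).trans
          (lintegral_mono_set hBI)
    _ ≤ _ := lintegral_mono_set hAI

/-- The constant of `ae_sq_sub_le_of_energyOn_ne_top`. -/
noncomputable def holderConst (p : ℝ) : ℝ := (2 * (√2 / (1 - (1 / 2) ^ ((p - 2) / 2)))) ^ 2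

/-- Campanato's argument: telescope the averages over the dyadically shrinking segments from t to t
+ h 2^{-k}. Consecutive ones differ by at most √(2 S r^{p-2}) with r = |h| 2^{-k}, which is a
geometric series since p > 2. -/
theorem abs_average_sub_le {f : ℝ → ℝ} (hf : Measurable f) {a b : ℝ}
    (hfI : IntegrableOn f (Set.Icc a b)) {p : ℝ} (hp : 2 < p)
    (hE : energyOn (Set.Icc a b) p f ≠ ⊤) {t h : ℝ} (hh : h ≠ 0) (ht : t ∈ Set.Icc a b)
    (hth : t + h ∈ Set.Icc a b)
    (hd : HasDerivAt (fun x => ∫ u in t..x, f u) (f t) t) :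
    |(⨍ u in Set.uIoc t (t + h), f u) - f t| ≤
      √2 * √(energyOn (Set.Icc a b) p f).toReal * |h| ^ ((p - 2) / 2) /
        (1 - (1 / 2) ^ ((p - 2) / 2)) := by
  set S := (energyOn (Set.Icc a b) p f).toReal with hS
  set β := (p - 2) / 2 with hβ
  have hβ0 : 0 < β := by rw [hβ]; linarith
  set m : ℕ → ℝ := fun k => ⨍ u in Set.uIoc t (t + h * (1 / 2) ^ k), f u with hm
  have hk : ∀ k : ℕ, h * (1 / 2 : ℝ) ^ k ≠ 0 := fun k => mul_ne_zero hh (by positivity)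
  have hvol : ∀ k : ℕ, volume (Set.uIoc t (t + h * (1 / 2) ^ k)) =
      ENNReal.ofReal (|h| * (1 / 2) ^ k) := fun k => by
    rw [Set.uIoc, Real.volume_Ioc, max_sub_min_eq_abs']
    congr 1
    rw [sub_add_cancel_left, abs_neg, abs_mul, abs_of_pos (by positivity : (0 : ℝ) < (1 / 2) ^ k)]
  have hmem : ∀ k : ℕ, t + h * (1 / 2) ^ k ∈ Set.Icc a b := by
    intro k
    have h1 : (1 / 2 : ℝ) ^ k ≤ 1 := pow_le_one₀ (by norm_num) (by norm_num)
    have h2 : (0 : ℝ) < (1 / 2) ^ k := by positivity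
    have := (convex_Icc a b).add_smul_mem ht hth ⟨h2.le, h1⟩
    rwa [smul_eq_mul, mul_comm] at this
  have hsub : ∀ k : ℕ, Set.uIoc t (t + h * (1 / 2) ^ k) ⊆ Set.Icc a b := fun k =>
    Set.uIoc_subset_uIcc.trans ((Set.uIcc_subset_Icc ht (hmem k)))
  have hpos : ∀ k : ℕ, 0 < |h| * (1 / 2 : ℝ) ^ k := fun k => by positivity
  -- The averages are difference quotients of the primitive, which is differentiable at t.
  have hlim : Tendsto m atTop (𝓝 (f t)) := by
    have h0 : Tendsto (fun k : ℕ => h * (1 / 2 : ℝ) ^ k) atTop (𝓝[≠] 0) := by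
      refine tendsto_nhdsWithin_iff.2 ⟨?_, Eventually.of_forall hk⟩
      simpa using (tendsto_pow_atTop_nhds_zero_of_lt_one (r := (1 / 2 : ℝ)) (by norm_num)
        (by norm_num)).const_mul h
    have := hd.tendsto_slope_zero.comp h0
    refine this.congr fun k => ?_
    simp only [Function.comp_apply, hm]
    rw [interval_average_eq, add_sub_cancel_left, intervalIntegral.integral_same, sub_zero]
  have hstep : ∀ k, dist (m k) (m (k + 1)) ≤ √2 * √S * |h| ^ β * ((1 / 2) ^ β) ^ k := by
    intro k
    have h1 := sq_enorm_average_sub_average_le hf hfI (hsub k) (hsub (k + 1))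
      (by rw [hvol]; simpa using hpos k) (by rw [hvol]; simpa using hpos (k + 1))
      (by rw [hvol]; exact ENNReal.ofReal_ne_top) (by rw [hvol]; exact ENNReal.ofReal_ne_top)
      measurableSet_uIoc measurableSet_uIoc
      (r := |h| * (1 / 2) ^ k) (p := p) (by linarith) ?_
    · set r := |h| * (1 / 2 : ℝ) ^ k with hr
      have hr0 : 0 < r := hpos k
      rw [hvol, hvol, ← hr, show |h| * (1 / 2 : ℝ) ^ (k + 1) = r / 2 by rw [hr]; ring,
        ← ENNReal.ofReal_toReal hE, ← hS, ENNReal.ofReal_rpow_of_pos hr0,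
        ← ENNReal.ofReal_inv_of_pos hr0, ← ENNReal.ofReal_inv_of_pos (half_pos hr0),
        ← ENNReal.ofReal_mul (by positivity), ← ENNReal.ofReal_mul (by positivity),
        ← ENNReal.ofReal_mul (by positivity), ← ofReal_norm, ← ENNReal.ofReal_pow (norm_nonneg _),
        ENNReal.ofReal_le_ofReal_iff (by positivity), ← dist_eq_norm] at h1
      refine (sq_le_sq₀ dist_nonneg (by positivity)).1 (h1.trans_eq ?_)
      have e1 : (√2 * √S * |h| ^ β * ((1 / 2) ^ β) ^ k) = √2 * √S * r ^ β := by
        rw [hr, Real.mul_rpow (abs_nonneg _) (by positivity), ← Real.rpow_natCast,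
          ← Real.rpow_natCast, ← Real.rpow_mul (by norm_num), ← Real.rpow_mul (by norm_num),
          mul_comm β, mul_assoc]
      have e2 : r ^ p = r ^ 2 * (r ^ β) ^ 2 := by
        rw [← Real.rpow_natCast (r ^ β), ← Real.rpow_mul hr0.le, ← Real.rpow_natCast r,
          ← Real.rpow_add hr0]
        congr 1
        push_cast
        rw [hβ]; ring
      rw [e1, e2, mul_pow (√2 * √S), mul_pow √2, Real.sq_sqrt (by norm_num),
        Real.sq_sqrt (hS ▸ ENNReal.toReal_nonneg)]
      field_simp
    · intro x hx y hy
      have hmid : t + h * (1 / 2) ^ (k + 1) ∈ Set.uIcc t (t + h * (1 / 2) ^ k) := by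
        have := (convex_uIcc t (t + h * (1 / 2) ^ k)).add_smul_mem Set.left_mem_uIcc
          (y := h * (1 / 2) ^ k) Set.right_mem_uIcc (t := (1 / 2 : ℝ)) ⟨by norm_num, by norm_num⟩
        convert this using 2
        rw [smul_eq_mul, pow_succ]; ring
      have hy' : y ∈ Set.uIcc t (t + h * (1 / 2) ^ k) :=
        Set.uIcc_subset_uIcc Set.left_mem_uIcc hmid (Set.uIoc_subset_uIcc hy)
      have h1 := Set.abs_sub_le_of_uIcc_subset_uIcc (Set.uIcc_subset_uIcc
        hy' (Set.uIoc_subset_uIcc hx))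
      refine h1.trans_eq ?_
      rw [add_sub_cancel_left, abs_mul, abs_of_pos (by positivity : (0 : ℝ) < (1 / 2) ^ k)]
  have := dist_le_of_le_geometric_of_tendsto₀ _ _
    (Real.rpow_lt_one (by norm_num) (by norm_num) hβ0) hstep hlim
  simpa [hm, Real.dist_eq] using this

theorem ae_sq_sub_le_of_energyOn_ne_top {f : ℝ → ℝ} (hf : Measurable f) {a b : ℝ}
    (hfI : IntegrableOn f (Set.Icc a b)) {p : ℝ} (hp : 2 < p)
    (hE : energyOn (Set.Icc a b) p f ≠ ⊤) :
    ∃ A : Set ℝ, (∀ᵐ t, t ∈ Set.Icc a b → t ∈ A) ∧ A ⊆ Set.Icc a b ∧ ∀ s ∈ A, ∀ t ∈ A,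
      (f s - f t) ^ 2 ≤ holderConst p * (energyOn (Set.Icc a b) p f).toReal * |s - t| ^ (p - 2) := by
  rcases le_or_gt a b with hab | hab
  swap
  · refine ⟨∅, ?_, Set.empty_subset _, by simp⟩
    rw [Set.Icc_eq_empty hab.not_ge]
    simp
  have hint : IntervalIntegrable f volume a b :=
    (intervalIntegrable_iff_integrableOn_Icc_of_le hab).2 hfI
  -- A consists of the points where the primitive has derivative f t, which is almost all of the
  -- interval. Two values are compared through the average over the segment between them.
  set A := {t | t ∈ Set.Icc a b ∧ HasDerivAt (fun x => ∫ u in t..x, f u) (f t) t} with hA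
  refine ⟨A, ?_, fun t ht => ht.1, ?_⟩
  · filter_upwards [hint.ae_hasDerivAt_integral] with t ht hmem
    rw [Set.uIcc_of_le hab] at ht
    exact ⟨hmem, ht hmem t hmem⟩
  · rintro s ⟨hs, hds⟩ t ⟨ht, hdt⟩
    rcases eq_or_ne s t with rfl | hst
    · have : (0 : ℝ) < p - 2 := by linarith
      simp [Real.zero_rpow this.ne']
    have h1 := abs_average_sub_le hf hfI hp hE (sub_ne_zero.2 hst.symm) hs
      (by rwa [add_sub_cancel]) hds
    have h2 := abs_average_sub_le hf hfI hp hE (sub_ne_zero.2 hst) ht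
      (by rwa [add_sub_cancel]) hdt
    rw [add_sub_cancel, abs_sub_comm] at h1
    rw [abs_sub_comm t s] at h1
    rw [add_sub_cancel, Set.uIoc_comm] at h2
    have h3 : |f s - f t| ≤ 2 * (√2 * √(energyOn (Set.Icc a b) p f).toReal *
        |s - t| ^ ((p - 2) / 2) / (1 - (1 / 2) ^ ((p - 2) / 2))) := by
      refine (abs_sub_le _ (⨍ u in Set.uIoc s t, f u) _).trans ?_
      linarith
    have h4 := sq_le_sq' (by linarith [abs_nonneg (f s - f t)]) h3
    rw [sq_abs] at h4
    refine h4.trans_eq ?_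
    have e : |s - t| ^ (p - 2) = (|s - t| ^ ((p - 2) / 2)) ^ 2 := by
      rw [← Real.rpow_natCast, ← Real.rpow_mul (abs_nonneg _)]
      congr 1; push_cast; ring
    rw [e, holderConst]
    nth_rewrite 2 [← Real.sq_sqrt (ENNReal.toReal_nonneg (a := energyOn (Set.Icc a b) p f))]
    ring

/-- By the Hölder bound, values at nearby points of A differ by less than 1, hence agree. Points of
A are then joined by short steps inside A. -/
theorem exists_ae_eq_const_of_energyOn_ne_top {r : ℝ → ℕ} (hr : Measurable r) {a b : ℝ}
    (hfI : IntegrableOn (fun t => (r t : ℝ)) (Set.Icc a b)) {p : ℝ} (hp : 2 < p)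
    (hE : energyOn (Set.Icc a b) p (fun t => (r t : ℝ)) ≠ ⊤) :
    ∃ k, ∀ᵐ t, t ∈ Set.Icc a b → r t = k := by
  obtain ⟨A, hA, hAI, hb⟩ :=
    ae_sq_sub_le_of_energyOn_ne_top (measurable_from_top.comp hr) hfI hp hE
  set L := holderConst p * (energyOn (Set.Icc a b) p (fun t => (r t : ℝ))).toReal
  obtain ⟨ρ, hρ, hρL⟩ : ∃ ρ > 0, ∀ s, |s| < ρ → L * |s| ^ (p - 2) < 1 := by
    have hc : Continuous fun s : ℝ => L * |s| ^ (p - 2) :=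
      (continuous_abs.rpow_const fun x => Or.inr (by linarith)).const_mul L
    have h0 : L * |(0 : ℝ)| ^ (p - 2) < 1 := by
      rw [abs_zero, Real.zero_rpow (by linarith)]; simp
    obtain ⟨ρ, hρ, h⟩ := Metric.eventually_nhds_iff.1 (hc.continuousAt.eventually_lt
      (continuousAt_const (x := (0 : ℝ)) (y := (1 : ℝ))) h0)
    exact ⟨ρ, hρ, fun s hs => h (by simpa using hs)⟩
  have hloc : ∀ s ∈ A, ∀ t ∈ A, |s - t| < ρ → r s = r t := by
    intro s hs t ht hst
    have h1 := (hb s hs t ht).trans_lt (hρL _ hst)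
    have h2 : ((r s : ℤ) - r t) ^ 2 < 1 := by
      have : (((r s : ℤ) - r t) ^ 2 : ℝ) < 1 := h1
      exact_mod_cast this
    have h3 : ((r s : ℤ) - r t) = 0 := by
      by_contra hne
      have := sq_pos_of_ne_zero hne
      omega
    omega
  -- Each step lands in A between s + ρ/2 and s + ρ: short enough for `hloc`, long enough to make
  -- progress ρ/2.
  have hchain : ∀ n : ℕ, ∀ s ∈ A, ∀ t ∈ A, s ≤ t → t - s < n * (ρ / 2) → r s = r t := by
    intro n
    induction n with
    | zero => intro s _ t _ hst h; simp at h; linarith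
    | succ n ih =>
      intro s hs t ht hst h
      rcases lt_or_ge (t - s) ρ with hlt | hge
      · exact hloc s hs t ht (by rwa [abs_sub_comm, abs_of_nonneg (sub_nonneg.2 hst)])
      have hsub : Set.Ioo (s + ρ / 2) (s + ρ) ⊆ Set.Icc a b := fun u hu =>
        ⟨by linarith [(hAI hs).1, hu.1], by linarith [(hAI ht).2, hu.2]⟩
      obtain ⟨u, hu, huA⟩ : ∃ u ∈ Set.Ioo (s + ρ / 2) (s + ρ), u ∈ A := by
        by_contra! hne
        have h0 : volume (Set.Ioo (s + ρ / 2) (s + ρ)) = 0 := by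
          refine measure_mono_null ?_ (ae_iff.1 hA)
          intro u hu hu'
          exact hne u hu (hu' (hsub hu))
        rw [Real.volume_Ioo, ENNReal.ofReal_eq_zero] at h0
        linarith
      rw [hloc s hs u huA (by rw [abs_sub_comm, abs_of_nonneg] <;> linarith [hu.1, hu.2])]
      refine ih u huA t ht (by linarith [hu.2]) ?_
      push_cast at h
      linarith [hu.1]
  have hall : ∀ s ∈ A, ∀ t ∈ A, r s = r t := by
    intro s hs t ht
    obtain ⟨n, hn⟩ := exists_nat_gt (|t - s| / (ρ / 2))
    rw [div_lt_iff₀ (by positivity)] at hn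
    rcases le_total s t with h | h
    · exact hchain n s hs t ht h (by rwa [abs_of_nonneg (sub_nonneg.2 h)] at hn)
    · exact (hchain n t ht s hs h (by
        rwa [abs_sub_comm, abs_of_nonneg (sub_nonneg.2 h)] at hn)).symm
  rcases A.eq_empty_or_nonempty with hAe | ⟨s, hs⟩
  · exact ⟨0, hA.mono fun t ht hmem => by simpa [hAe] using ht hmem⟩
  · exact ⟨r s, hA.mono fun t ht hmem => hall t (ht hmem) s hs⟩

/-- A limit point t₀ of near-zeros of w. It need not lie in A, so the vanishing at t₀ is expressed
by the Hölder bound on A rather than by the value w t₀. -/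
theorem exists_forall_sq_le_of_frequently_lt {w : ℝ → ℝ} {a b L q : ℝ} (hq : 0 < q) {A : Set ℝ}
    (hw : ∀ s ∈ A, ∀ t ∈ A, (w s - w t) ^ 2 ≤ L * |s - t| ^ q)
    (h0 : ∀ n : ℕ, ∃ s ∈ A, s ∈ Set.Icc a b ∧ |w s| < 1 / (n + 1)) :
    ∃ t₀ ∈ Set.Icc a b, ∀ t ∈ A, w t ^ 2 ≤ L * |t - t₀| ^ q := by
  choose s hsA hsI hsw using h0
  obtain ⟨t₀, ht₀, φ, hφ, hlim⟩ := isCompact_Icc.tendsto_subseq hsI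
  refine ⟨t₀, ht₀, fun t ht => ?_⟩
  have hw0 : Tendsto (fun n => w (s n)) atTop (𝓝 0) :=
    squeeze_zero_norm (fun n => (hsw n).le) tendsto_one_div_add_atTop_nhds_zero_nat
  have h1 : Tendsto (fun n => (w t - w (s (φ n))) ^ 2) atTop (𝓝 ((w t - 0) ^ 2)) :=
    ((hw0.comp hφ.tendsto_atTop).const_sub (w t)).pow 2
  have h2 : Tendsto (fun n => L * |t - s (φ n)| ^ q) atTop (𝓝 (L * |t - t₀| ^ q)) := by
    have hc : Continuous fun u : ℝ => L * |t - u| ^ q :=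
      ((continuous_const.sub continuous_id).abs.rpow_const fun x => Or.inr hq.le).const_mul L
    exact (hc.tendsto t₀).comp hlim
  rw [sub_zero] at h1
  exact le_of_tendsto_of_tendsto' h1 h2 fun n => hw t ht _ (hsA _)

end

/-! ### Moduli of continuity of Sobolev functions -/

noncomputable section

open scoped InnerProductSpace

/-- The squared `L²`-modulus of continuity `‖g(· + h) - g‖²`. -/
def shiftDistSq {d : ℕ} (g : Rd d → ℂ) (h : Rd d) : ℝ≥0∞ := ∫⁻ x, ‖g (x + h) - g x‖ₑ ^ 2

variable {d : ℕ} {g : Rd d → ℂ}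

theorem enorm_sub_sq_le {E : Type*} [NormedAddCommGroup E] (a b c : E) :
    ‖a - c‖ₑ ^ 2 ≤ 2 * ‖a - b‖ₑ ^ 2 + 2 * ‖b - c‖ₑ ^ 2 := by
  have h1 : ‖a - c‖ₑ ≤ ‖a - b‖ₑ + ‖b - c‖ₑ := by
    rw [← sub_add_sub_cancel a b c]; exact enorm_add_le _ _
  have h2 := ENNReal.rpow_add_le_mul_rpow_add_rpow ‖a - b‖ₑ ‖b - c‖ₑ (p := 2) (by norm_num)
  have h3 : ((2 : ℝ≥0∞)) ^ ((2 : ℝ) - 1) = 2 := by norm_num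
  rw [h3] at h2
  simp only [ENNReal.rpow_two, mul_add] at h2
  exact (pow_le_pow_left' h1 2).trans h2

theorem measurable_shift_integrand (hg : Measurable g) :
    Measurable fun p : Rd d × Rd d => ‖g (p.1 + p.2) - g p.1‖ₑ ^ 2 :=
  ((hg.comp (measurable_fst.add measurable_snd)).sub (hg.comp measurable_fst)).enorm.pow_const 2

theorem measurable_shiftDistSq (hg : Measurable g) : Measurable (shiftDistSq g) :=
  (measurable_shift_integrand hg).lintegral_prod_left'

theorem shiftDistSq_le (hg : Measurable g) (h y : Rd d) :
    shiftDistSq g h ≤ 2 * shiftDistSq g (h - y) + 2 * shiftDistSq g y := by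
  have h1 : shiftDistSq g (h - y) = ∫⁻ x, ‖g (x + h) - g (x + y)‖ₑ ^ 2 := by
    rw [shiftDistSq, ← lintegral_add_right_eq_self _ y]
    refine lintegral_congr fun x => ?_
    rw [show x + y + (h - y) = x + h by abel]
  have hm : Measurable fun x => 2 * ‖g (x + h) - g (x + y)‖ₑ ^ 2 :=
    (((hg.comp (measurable_id.add_const h)).sub
      (hg.comp (measurable_id.add_const y))).enorm.pow_const 2).const_mul 2
  rw [h1, shiftDistSq, shiftDistSq, ← lintegral_const_mul' _ _ (by simp),
    ← lintegral_const_mul' _ _ (by simp), ← lintegral_add_left hm]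
  exact lintegral_mono fun x => enorm_sub_sq_le _ _ _

theorem slobodeckijSeminormSq_eq (hg : Measurable g) (s : ℝ) :
    slobodeckijSeminormSq s g = ∫⁻ y, shiftDistSq g y / ‖y‖ₑ ^ ((d : ℝ) + 2 * s) := by
  have hm : Measurable fun p : Rd d × Rd d =>
      ‖g (p.1 + p.2) - g p.1‖ₑ ^ 2 / ‖p.2‖ₑ ^ ((d : ℝ) + 2 * s) :=
    (measurable_shift_integrand hg).div (measurable_snd.enorm.pow_const _)
  calc slobodeckijSeminormSq s g
      = ∫⁻ x, ∫⁻ y, ‖g (x + y) - g x‖ₑ ^ 2 / ‖y‖ₑ ^ ((d : ℝ) + 2 * s) := by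
        refine lintegral_congr fun x => ?_
        rw [← lintegral_add_left_eq_self _ x]
        refine lintegral_congr fun y => ?_
        rw [← enorm_neg, neg_sub, sub_add_cancel_left, enorm_neg]
    _ = ∫⁻ y, ∫⁻ x, ‖g (x + y) - g x‖ₑ ^ 2 / ‖y‖ₑ ^ ((d : ℝ) + 2 * s) :=
        lintegral_lintegral_swap hm.aemeasurable
    _ = _ := by
        refine lintegral_congr fun y => ?_
        simp only [div_eq_mul_inv]
        have hmy : Measurable fun x => ‖g (x + y) - g x‖ₑ ^ 2 :=
          ((hg.comp (measurable_id.add_const y)).sub hg).enorm.pow_const 2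
        rw [shiftDistSq, lintegral_mul_const _ hmy]

/-- Average the triangle inequality ω(h) ≤ 2ω(h-y) + 2ω(y) over |y| < |h|. Both h - y and y lie in
the ball of radius 2|h|, where ω(y) ≤ (2|h|)^p ω(y)/|y|^p; division by the volume of the ball of
radius |h| leaves |h|^{2s}. -/
theorem exists_shiftDistSq_le_of_slobodeckij (hg : Measurable g) {s : ℝ} (hs : 0 < s)
    (hS : slobodeckijSeminormSq s g ≠ ⊤) :
    ∃ C : ℝ≥0∞, C ≠ ⊤ ∧ ∀ h : Rd d, shiftDistSq g h ≤ C * ‖h‖ₑ ^ (2 * s) := by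
  set p : ℝ := (d : ℝ) + 2 * s with hp
  have hp0 : 0 < p := by positivity
  set v := volume (Metric.ball (0 : Rd d) 1) with hv
  have hv0 : v ≠ 0 := (Metric.measure_ball_pos _ _ one_pos).ne'
  have hvt : v ≠ ⊤ := measure_ball_lt_top.ne
  refine ⟨4 * 2 ^ p * slobodeckijSeminormSq s g / v, ?_, fun h => ?_⟩
  · refine ENNReal.div_ne_top (ENNReal.mul_ne_top (ENNReal.mul_ne_top (by simp) ?_) hS) hv0
    exact ENNReal.rpow_ne_top_of_nonneg hp0.le (by simp)
  rcases eq_or_ne h 0 with rfl | hh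
  · simp [shiftDistSq]
  have hr : 0 < ‖h‖ := norm_pos_iff.2 hh
  have hω := measurable_shiftDistSq hg
  set B := Metric.ball (0 : Rd d) ‖h‖
  set B2 := Metric.ball (0 : Rd d) (2 * ‖h‖) with hB2
  have h1 : ∫⁻ y in B, shiftDistSq g (h - y) ≤ ∫⁻ y in B2, shiftDistSq g y := by
    rw [← lintegral_indicator measurableSet_ball, ← lintegral_indicator measurableSet_ball,
      ← lintegral_sub_left_eq_self (B2.indicator _) h]
    refine lintegral_mono fun y => ?_
    change B.indicator (fun y => shiftDistSq g (h - y)) y ≤ _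
    by_cases hy : y ∈ B
    · have hy2 : h - y ∈ B2 := by
        rw [hB2, mem_ball_zero_iff]
        rw [mem_ball_zero_iff] at hy
        linarith [norm_sub_le h y]
      simp [hy, hy2]
    · simp [hy]
  have h2 : ∫⁻ y in B, shiftDistSq g y ≤ ∫⁻ y in B2, shiftDistSq g y :=
    lintegral_mono_set (Metric.ball_subset_ball (by linarith))
  have h3 : ∫⁻ y in B2, shiftDistSq g y ≤ (2 * ‖h‖ₑ) ^ p * slobodeckijSeminormSq s g := by
    rw [slobodeckijSeminormSq_eq hg, ← lintegral_const_mul'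
      _ _ (ENNReal.rpow_ne_top_of_nonneg hp0.le (ENNReal.mul_ne_top (by simp) (by simp)))]
    refine (setLIntegral_mono' measurableSet_ball fun y hy => ?_).trans (setLIntegral_le_lintegral _ _)
    rcases eq_or_ne y 0 with rfl | hy0
    · simp [shiftDistSq]
    rw [← mul_div_assoc, ENNReal.le_div_iff_mul_le, mul_comm]
    · gcongr
      rw [mem_ball_zero_iff] at hy
      have : ENNReal.ofReal ‖y‖ ≤ ENNReal.ofReal (2 * ‖h‖) := ENNReal.ofReal_le_ofReal hy.le
      rwa [ENNReal.ofReal_mul (by norm_num), ofReal_norm, ofReal_norm, ENNReal.ofReal_ofNat] at this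
    · left; simp [hy0]
    · left; exact ENNReal.rpow_ne_top_of_nonneg hp0.le (by simp)
  have h4 : shiftDistSq g h * volume B ≤ 4 * ((2 * ‖h‖ₑ) ^ p * slobodeckijSeminormSq s g) := by
    calc shiftDistSq g h * volume B = ∫⁻ y in B, shiftDistSq g h := by simp
      _ ≤ ∫⁻ y in B, (2 * shiftDistSq g (h - y) + 2 * shiftDistSq g y) :=
          lintegral_mono fun y => shiftDistSq_le hg h y
      _ = 2 * (∫⁻ y in B, shiftDistSq g (h - y)) + 2 * ∫⁻ y in B, shiftDistSq g y := by
          rw [lintegral_add_right _ (hω.const_mul 2), lintegral_const_mul' _ _ (by simp),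
            lintegral_const_mul' _ _ (by simp)]
      _ ≤ 2 * ((2 * ‖h‖ₑ) ^ p * slobodeckijSeminormSq s g) +
          2 * ((2 * ‖h‖ₑ) ^ p * slobodeckijSeminormSq s g) := by
          gcongr
          · exact h1.trans h3
          · exact h2.trans h3
      _ = _ := by ring
  have hvol : volume B = ‖h‖ₑ ^ d * v := by
    rw [Measure.addHaar_ball_of_pos _ _ hr, finrank_euclideanSpace_fin,
      ENNReal.ofReal_pow hr.le, ofReal_norm]
  have hn0 : ‖h‖ₑ ≠ 0 := by simpa using hh
  have hnt : ‖h‖ₑ ≠ ⊤ := by simp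
  rw [hvol, ENNReal.mul_rpow_of_nonneg _ _ hp0.le, hp, ENNReal.rpow_add _ _ hn0 hnt, ← hp,
    ENNReal.rpow_natCast] at h4
  have hd0 : ‖h‖ₑ ^ d * v ≠ 0 := mul_ne_zero (pow_ne_zero _ hn0) hv0
  have hdt : ‖h‖ₑ ^ d * v ≠ ⊤ := ENNReal.mul_ne_top (ENNReal.pow_ne_top hnt) hvt
  rw [← ENNReal.le_div_iff_mul_le (Or.inl hd0) (Or.inl hdt)] at h4
  refine h4.trans_eq ?_
  have hc : ‖h‖ₑ ^ d * (‖h‖ₑ ^ d)⁻¹ = 1 :=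
    ENNReal.mul_inv_cancel (pow_ne_zero _ hn0) (ENNReal.pow_ne_top hnt)
  rw [div_eq_mul_inv, div_eq_mul_inv, ENNReal.mul_inv (Or.inr hvt) (Or.inr hv0)]
  calc _ = 4 * 2 ^ p * slobodeckijSeminormSq s g * v⁻¹ * ‖h‖ₑ ^ (2 * s) *
        (‖h‖ₑ ^ d * (‖h‖ₑ ^ d)⁻¹) := by ring
    _ = _ := by rw [hc, mul_one]

/-! ### One weak derivative -/

theorem hasDerivAt_integral_shift_smul {D : Rd d → ℂ} {i : Fin d} (hg : LocallyIntegrable g)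
    (hD : IsWeakPartialDeriv i g D) {φ : Rd d → ℝ} (hφ : ContDiff ℝ ∞ φ)
    (hc : HasCompactSupport φ) (t : ℝ) :
    HasDerivAt (fun t : ℝ => ∫ x, φ (x - t • EuclideanSpace.single i 1) • g x)
      (∫ x, φ (x - t • EuclideanSpace.single i 1) • D x) t := by
  set e : Rd d := EuclideanSpace.single i 1
  -- The reflection turns the pairing with shifted φ into the convolution of ψ and g at t • e, which
  -- can be differentiated under the integral.
  set ψ : Rd d → ℝ := fun y => φ (-y) with hψ
  have hψs : ContDiff ℝ ∞ ψ := hφ.comp contDiff_neg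
  have hψc : HasCompactSupport ψ := hc.comp_homeomorph (Homeomorph.neg _)
  have h1 := hψc.hasFDerivAt_convolution_left (ContinuousLinearMap.lsmul ℝ ℝ) (μ := volume)
    (hψs.of_le (by simp)) hg (t • e)
  have h2 : HasDerivAt (fun t : ℝ => t • e) e t := by
    simpa using (hasDerivAt_id t).smul_const e
  have h3 := h1.comp_hasDerivAt t h2
  have hex := (hψc.fderiv ℝ).convolutionExists_left
    ((ContinuousLinearMap.lsmul ℝ ℝ (E := ℂ)).precompL (Rd d)) (μ := volume)
    (hψs.continuous_fderiv (by simp)) hg (t • e)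
  have h4 : (∫ x, φ (x - t • e) • D x) = (convolution (fderiv ℝ ψ) g
      ((ContinuousLinearMap.lsmul ℝ ℝ).precompL (Rd d)) volume (t • e)) e := by
    have hw := hD (fun x => φ (x - t • e)) (hφ.comp (contDiff_id.sub contDiff_const))
      (hc.comp_homeomorph (Homeomorph.subRight _))
    rw [← neg_eq_iff_eq_neg] at hw
    rw [← hw, convolution_eq_swap, ContinuousLinearMap.integral_apply]
    · rw [← integral_neg]
      refine integral_congr_ae (Eventually.of_forall fun x => ?_)
      have e1 : fderiv ℝ ψ (t • e - x) e = - fderiv ℝ φ (x - t • e) e := by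
        have hd := (hφ.differentiable (by simp)) (-(t • e - x))
        have h5 := hd.hasFDerivAt.comp (t • e - x) (hasFDerivAt_id (𝕜 := ℝ) (t • e - x)).neg
        have h6 : fderiv ℝ ψ (t • e - x) = _ := h5.fderiv
        rw [h6]
        simp
      have e2 : fderiv ℝ (fun x => φ (x - t • e)) x = fderiv ℝ φ (x - t • e) :=
        fderiv_comp_sub _
      simp only [ContinuousLinearMap.precompL_apply, ContinuousLinearMap.lsmul_apply]
      rw [e1, e2, neg_smul]
    · exact hex.integrable_swap
  rw [h4]
  refine h3.congr_of_eventuallyEq (Eventually.of_forall fun t => ?_)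
  simp only [Function.comp_apply, convolution_eq_swap, hψ, neg_sub]
  rfl

theorem norm_integral_smul_le {φ : Rd d → ℝ} {D : Rd d → ℂ} (hφ : MemLp φ 2 volume)
    (hD : MemLp D 2 volume) :
    ‖∫ x, φ x • D x‖ ≤ (eLpNorm φ 2 volume).toReal * (eLpNorm D 2 volume).toReal := by
  have h1 : eLpNorm (φ • D) 1 volume ≤ eLpNorm φ 2 volume * eLpNorm D 2 volume :=
    eLpNorm_smul_le_mul_eLpNorm hD.1 hφ.1
  rw [eLpNorm_one_eq_lintegral_enorm] at h1
  have h2 : ‖∫ x, φ x • D x‖ₑ ≤ eLpNorm φ 2 volume * eLpNorm D 2 volume :=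
    (enorm_integral_le_lintegral_enorm _).trans h1
  have h3 := ENNReal.toReal_mono (ENNReal.mul_ne_top hφ.eLpNorm_ne_top hD.eLpNorm_ne_top) h2
  rwa [toReal_enorm, ENNReal.toReal_mul] at h3

/-- Move the shift onto φ and apply the mean value inequality in t: the derivative pairs a shifted φ
with D and is bounded by Cauchy–Schwarz. -/
theorem norm_integral_smul_shift_sub_le {D : Rd d → ℂ} {i : Fin d} (hg : MemLp g 2 volume)
    (hDL : MemLp D 2 volume) (hD : IsWeakPartialDeriv i g D) {φ : Rd d → ℝ}
    (hφ : ContDiff ℝ ∞ φ) (hc : HasCompactSupport φ) (t : ℝ) :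
    ‖∫ x, φ x • (g (x + t • EuclideanSpace.single i 1) - g x)‖ ≤
      |t| * (eLpNorm D 2 volume).toReal * (eLpNorm φ 2 volume).toReal := by
  set e : Rd d := EuclideanSpace.single i 1
  have hφL : MemLp φ 2 volume := hφ.continuous.memLp_of_hasCompactSupport hc
  have hsub : ∀ a : Rd d, MeasurePreserving (fun x : Rd d => x - a) volume volume := fun a =>
    measurePreserving_sub_right volume a
  have hadd : ∀ a : Rd d, MeasurePreserving (fun x : Rd d => x + a) volume volume := fun a =>
    measurePreserving_add_right volume a
  have hbound : ∀ s : ℝ, ‖∫ x, φ (x - s • e) • D x‖ ≤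
      (eLpNorm D 2 volume).toReal * (eLpNorm φ 2 volume).toReal := by
    intro s
    have h := norm_integral_smul_le (hφL.comp_measurePreserving (hsub (s • e))) hDL
    rw [eLpNorm_comp_measurePreserving hφL.1 (hsub (s • e)), mul_comm] at h
    exact h
  have hmv := Convex.norm_image_sub_le_of_norm_hasDerivWithin_le
    (f := fun t : ℝ => ∫ x, φ (x - t • e) • g x)
    (fun s _ => (hasDerivAt_integral_shift_smul (hg.locallyIntegrable (by norm_num)) hD hφ hc
      s).hasDerivWithinAt)
    (fun s _ => hbound s) convex_univ (Set.mem_univ 0) (Set.mem_univ t)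
  have hint : ∀ u : Rd d → ℂ, MemLp u 2 volume → Integrable (fun x => φ x • u x) := fun u hu =>
    memLp_one_iff_integrable.1 (hu.smul hφL)
  have heq : ∫ x, φ x • (g (x + t • e) - g x) =
      (∫ x, φ (x - t • e) • g x) - ∫ x, φ (x - (0 : ℝ) • e) • g x := by
    simp_rw [smul_sub]
    have hi : Integrable (fun x => φ x • g (x + t • e)) :=
      hint _ (hg.comp_measurePreserving (hadd (t • e)))
    rw [integral_sub hi (hint _ hg)]
    congr 1
    · rw [← integral_add_right_eq_self (μ := volume) (fun x => φ (x - t • e) • g x) (t • e)]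
      simp
    · simp
  rw [heq]
  refine hmv.trans_eq ?_
  rw [sub_zero, Real.norm_eq_abs]
  ring

/-- The bound extends from test functions to all of L² by density; then test u against itself. -/
theorem eLpNorm_le_of_forall_abs_integral_mul_le {u : Rd d → ℝ} (hu : MemLp u 2 volume) {M : ℝ}
    (h : ∀ φ : Rd d → ℝ, ContDiff ℝ ∞ φ → HasCompactSupport φ →
      |∫ x, φ x * u x| ≤ M * (eLpNorm φ 2 volume).toReal) :
    eLpNorm u 2 volume ≤ ENNReal.ofReal M := by
  set U : Lp ℝ 2 (volume : Measure (Rd d)) := hu.toLp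
  have hclosed : IsClosed {f : Lp ℝ 2 (volume : Measure (Rd d)) | |⟪f, U⟫_ℝ| ≤ M * ‖f‖} :=
    isClosed_le (by fun_prop) (by fun_prop)
  have hsub : {f : Lp ℝ 2 (volume : Measure (Rd d)) | ∃ g : Rd d → ℝ, f =ᵐ[volume] g ∧
      HasCompactSupport g ∧ ContDiff ℝ ∞ g} ⊆ {f | |⟪f, U⟫_ℝ| ≤ M * ‖f‖} := by
    rintro f ⟨φ, hf, hc, hφ⟩
    have h1 := h φ hφ hc
    have h2 : ⟪f, U⟫_ℝ = ∫ x, φ x * u x := by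
      rw [L2.inner_def]
      refine integral_congr_ae ?_
      filter_upwards [hf, hu.coeFn_toLp] with x hx hx'
      rw [hx, hx']
      simp [mul_comm]
    rw [Set.mem_ofPred_eq, h2, Lp.norm_def, eLpNorm_congr_ae hf]
    exact h1
  have hU : |⟪U, U⟫_ℝ| ≤ M * ‖U‖ := by
    have := hclosed.closure_subset_iff.2 hsub
      (Lp.dense_hasCompactSupport_contDiff (F := ℝ) (by norm_num) U)
    exact this
  rw [real_inner_self_eq_norm_sq, abs_of_nonneg (sq_nonneg _), sq] at hU
  have hUM : ‖U‖ ≤ M ∨ ‖U‖ = 0 := by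
    rcases (norm_nonneg U).eq_or_lt with h0 | h0
    · exact Or.inr h0.symm
    · exact Or.inl (le_of_mul_le_mul_right hU h0)
  have hUn : ENNReal.ofReal ‖U‖ = eLpNorm u 2 volume := by
    rw [Lp.norm_def, ENNReal.ofReal_toReal (Lp.eLpNorm_ne_top _), eLpNorm_congr_ae hu.coeFn_toLp]
  rw [← hUn]
  rcases hUM with h0 | h0
  · exact ENNReal.ofReal_le_ofReal h0
  · rw [h0]; simp

theorem eLpNorm_two_sq {E : Type*} [NormedAddCommGroup E] (f : Rd d → E) :
    eLpNorm f 2 volume ^ 2 = ∫⁻ x, ‖f x‖ₑ ^ 2 := by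
  rw [eLpNorm_eq_lintegral_rpow_enorm_toReal (by norm_num) (by norm_num), ← ENNReal.rpow_natCast,
    ← ENNReal.rpow_mul]
  norm_num

theorem exists_shiftDistSq_le_of_isWeakPartialDeriv {D : Rd d → ℂ} {i : Fin d}
    (hg : MemLp g 2 volume) (hDL : MemLp D 2 volume) (hD : IsWeakPartialDeriv i g D) :
    ∃ C : ℝ≥0∞, C ≠ ⊤ ∧ ∀ t : ℝ, shiftDistSq g (t • EuclideanSpace.single i 1) ≤ C * ‖t‖ₑ ^ 2 := by
  set M := (eLpNorm D 2 volume).toReal with hM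
  -- Test functions are real, so real and imaginary parts of the increment are bounded separately by
  -- |t| M, whence the 2.
  refine ⟨(2 * ENNReal.ofReal M) ^ 2, by finiteness, fun t => ?_⟩
  set δ : Rd d → ℂ := fun x => g (x + t • EuclideanSpace.single i 1) - g x with hδ
  have hδL : MemLp δ 2 volume :=
    (hg.comp_measurePreserving (measurePreserving_add_right volume _)).sub hg
  have htest : ∀ φ : Rd d → ℝ, ContDiff ℝ ∞ φ → HasCompactSupport φ →
      ‖∫ x, φ x • δ x‖ ≤ |t| * M * (eLpNorm φ 2 volume).toReal := fun φ hφ hc =>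
    norm_integral_smul_shift_sub_le hg hDL hD hφ hc t
  have hint : ∀ φ : Rd d → ℝ, ContDiff ℝ ∞ φ → HasCompactSupport φ →
      Integrable (fun x => φ x • δ x) := fun φ hφ hc =>
    memLp_one_iff_integrable.1 (hδL.smul (p := 2)
      (hφ.continuous.memLp_of_hasCompactSupport hc))
  have hreL : MemLp (fun x => (δ x).re) 2 volume := hδL.re
  have himL : MemLp (fun x => (δ x).im) 2 volume := hδL.im
  have hre : eLpNorm (fun x => (δ x).re) 2 volume ≤ ENNReal.ofReal (|t| * M) := by
    refine eLpNorm_le_of_forall_abs_integral_mul_le hreL fun φ hφ hc => ?_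
    have h1 : ∫ x, φ x * (δ x).re = (∫ x, φ x • δ x).re := by
      rw [← RCLike.re_eq_complex_re, ← integral_re (hint φ hφ hc)]
      simp
    rw [h1]
    exact (Complex.abs_re_le_norm _).trans (htest φ hφ hc)
  have him : eLpNorm (fun x => (δ x).im) 2 volume ≤ ENNReal.ofReal (|t| * M) := by
    refine eLpNorm_le_of_forall_abs_integral_mul_le himL fun φ hφ hc => ?_
    have h1 : ∫ x, φ x * (δ x).im = (∫ x, φ x • δ x).im := by
      rw [← RCLike.im_eq_complex_im, ← integral_im (hint φ hφ hc)]
      simp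
    rw [h1]
    exact (Complex.abs_im_le_norm _).trans (htest φ hφ hc)
  have hle : eLpNorm δ 2 volume ≤ 2 * ENNReal.ofReal (|t| * M) := by
    calc eLpNorm δ 2 volume ≤ eLpNorm (fun x => |(δ x).re| + |(δ x).im|) 2 volume :=
          eLpNorm_mono_real fun x => Complex.norm_le_abs_re_add_abs_im _
      _ ≤ eLpNorm (fun x => |(δ x).re|) 2 volume + eLpNorm (fun x => |(δ x).im|) 2 volume :=
          eLpNorm_add_le hreL.1.norm himL.1.norm (by norm_num)
      _ = eLpNorm (fun x => (δ x).re) 2 volume + eLpNorm (fun x => (δ x).im) 2 volume := by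
          congr 1
          · exact eLpNorm_norm (fun x => (δ x).re)
          · exact eLpNorm_norm (fun x => (δ x).im)
      _ ≤ _ := by rw [two_mul]; gcongr
  rw [shiftDistSq, ← eLpNorm_two_sq]
  refine (pow_le_pow_left' hle 2).trans_eq ?_
  rw [ENNReal.ofReal_mul (abs_nonneg t), ← Real.norm_eq_abs, ofReal_norm]
  ring

theorem MemSlobodeckij.exists_shiftDistSq_le {s : ℝ} (hs : 1 / 2 < s) (hs' : s ≤ 1)
    (hm : Measurable g) (hg : MemSlobodeckij s g) (i : Fin d) :
    ∃ C : ℝ≥0∞, C ≠ ⊤ ∧ ∀ t : ℝ,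
      shiftDistSq g (t • EuclideanSpace.single i 1) ≤ C * ‖t‖ₑ ^ (2 * s) := by
  rcases hs'.eq_or_lt with rfl | hlt
  · simp only [MemSlobodeckij, Nat.floor_one, MemSlobodeckijAux] at hg
    obtain ⟨hgL, h⟩ := hg
    obtain ⟨D, hD, hDL, -⟩ := h i
    simpa using exists_shiftDistSq_le_of_isWeakPartialDeriv hgL hDL hD
  · have hf : ⌊s⌋₊ = 0 := Nat.floor_eq_zero.2 hlt
    rw [MemSlobodeckij, hf, MemSlobodeckijAux, Nat.cast_zero, sub_zero] at hg
    obtain ⟨C, hC, h⟩ := exists_shiftDistSq_le_of_slobodeckij hm (by linarith)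
      (hg.2 (by linarith)).ne
    refine ⟨C, hC, fun t => (h _).trans_eq ?_⟩
    have he : ‖(EuclideanSpace.single i 1 : Rd d)‖ₑ = 1 := by rw [← ofReal_norm]; simp
    rw [enorm_smul, he, mul_one]

end

/-! ### Translations and the Fourier transform -/

noncomputable section

open scoped InnerProductSpace

variable {d K : ℕ}

theorem exists_seq_tendsto_ae_of_tendsto_L2 {u : ℕ → L2 d} {f : L2 d}
    (h : Tendsto u atTop (𝓝 f)) : ∃ ns : ℕ → ℕ, StrictMono ns ∧
      ∀ᵐ x, Tendsto (fun i => (u (ns i) : Rd d → ℂ) x) atTop (𝓝 ((f : Rd d → ℂ) x)) :=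
  (tendstoInMeasure_of_tendsto_Lp h).exists_seq_tendsto_ae

theorem translateL2_coeFn (a : Rd d) (f : L2 d) :
    (translateL2 a f : Rd d → ℂ) =ᵐ[volume] fun x => (f : Rd d → ℂ) (x - a) :=
  Lp.coeFn_compMeasurePreserving f (measurePreserving_sub_right volume a)

theorem continuous_translateL2 (a : Rd d) : Continuous (translateL2 a) :=
  (Lp.isometry_compMeasurePreserving (measurePreserving_sub_right volume a)).continuous

theorem fourier_translate_schwartz (a : Rd d) (f : SchwartzMap (Rd d) ℂ) (ξ : Rd d) :
    (𝓕 (f.compSubConstCLM ℂ a)) ξ = (Real.fourierChar (-⟪a, ξ⟫_ℝ) : ℂ) * (𝓕 f) ξ := by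
  rw [SchwartzMap.fourier_coe, SchwartzMap.fourier_coe, Real.fourier_eq, Real.fourier_eq,
    ← integral_const_mul, ← integral_add_right_eq_self (μ := volume) _ a]
  refine integral_congr_ae (Eventually.of_forall fun v => ?_)
  simp only [SchwartzMap.compSubConstCLM_apply, add_sub_cancel_right, Circle.smul_def, smul_eq_mul]
  rw [inner_add_left, neg_add, AddChar.map_add_eq_mul, Circle.coe_mul]
  ring

theorem translateL2_toLp (a : Rd d) (f : SchwartzMap (Rd d) ℂ) :
    translateL2 a (f.toLp 2 : L2 d) = (f.compSubConstCLM ℂ a).toLp 2 := by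
  have h0 : ∀ᵐ x : Rd d, ((f.toLp 2 : L2 d) : Rd d → ℂ) x = f x := f.coeFn_toLp 2 volume
  have h : ∀ᵐ x : Rd d, ((f.toLp 2 : L2 d) : Rd d → ℂ) (x - a) = f (x - a) :=
    (measurePreserving_sub_right volume a).quasiMeasurePreserving.ae h0
  have h3 : ∀ᵐ x : Rd d, (((f.compSubConstCLM ℂ a).toLp 2 : L2 d) : Rd d → ℂ) x =
    f.compSubConstCLM ℂ a x := (f.compSubConstCLM ℂ a).coeFn_toLp 2 volume
  refine Lp.ext ?_
  filter_upwards [translateL2_coeFn a (f.toLp 2 : L2 d), h, h3] with x hx1 hx2 hx3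
  rw [hx1, hx3, hx2, SchwartzMap.compSubConstCLM_apply]

theorem fourier_translateL2 (a : Rd d) (f : L2 d) :
    ((𝓕 (translateL2 a f) : L2 d) : Rd d → ℂ) =ᵐ[volume]
      fun ξ => (Real.fourierChar (-⟪a, ξ⟫_ℝ) : ℂ) * ((𝓕 f : L2 d) : Rd d → ℂ) ξ := by
  have hF : Continuous fun f : L2 d => (𝓕 f : L2 d) :=
    (Lp.fourierTransformₗᵢ (Rd d) ℂ).continuous
  refine DenseRange.induction_on (p := fun f : L2 d => ((𝓕 (translateL2 a f) : L2 d) : Rd d → ℂ)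
    =ᵐ[volume] fun ξ => (Real.fourierChar (-⟪a, ξ⟫_ℝ) : ℂ) * ((𝓕 f : L2 d) : Rd d → ℂ) ξ)
    (SchwartzMap.denseRange_toLpCLM (E := Rd d) (F := ℂ) (p := 2) ENNReal.ofNat_ne_top) f ?_ ?_
  -- L²-limits are made pointwise by extracting one subsequence for the transforms and a further one
  -- for the transforms of the translates.
  · refine IsSeqClosed.isClosed fun u f hu hlim => ?_
    obtain ⟨ns, hns, h1⟩ := exists_seq_tendsto_ae_of_tendsto_L2 ((hF.tendsto f).comp hlim)
    obtain ⟨ms, hms, h2⟩ := exists_seq_tendsto_ae_of_tendsto_L2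
      (((hF.comp (continuous_translateL2 a)).tendsto f).comp (hlim.comp hns.tendsto_atTop))
    filter_upwards [h1, h2, ae_all_iff.2 hu] with x hx1 hx2 hx
    refine tendsto_nhds_unique hx2 ?_
    refine ((hx1.comp hms.tendsto_atTop).const_mul _).congr fun i => ?_
    exact (hx _).symm
  · intro f
    change ((𝓕 (translateL2 a (f.toLp 2)) : L2 d) : Rd d → ℂ) =ᵐ[volume]
      fun ξ => (Real.fourierChar (-⟪a, ξ⟫_ℝ) : ℂ) * ((𝓕 (f.toLp 2) : L2 d) : Rd d → ℂ) ξ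
    rw [translateL2_toLp, SchwartzMap.toLp_fourier_eq, SchwartzMap.toLp_fourier_eq]
    filter_upwards [(𝓕 (f.compSubConstCLM ℂ a)).coeFn_toLp 2 volume,
      (𝓕 f).coeFn_toLp 2 volume] with ξ h2 h3
    rw [h2, h3, fourier_translate_schwartz]

/-! ### Fibers of shift-invariant spaces -/

theorem latticePoint_add (m n : Fin d → ℤ) :
    (latticePoint (m + n) : Rd d) = latticePoint m + latticePoint n := by
  ext i; simp [latticePoint]

theorem latticePoint_zero : (latticePoint (0 : Fin d → ℤ) : Rd d) = 0 := by
  ext i; simp [latticePoint]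

theorem fourierChar_inner_latticePoint (m n : Fin d → ℤ) :
    Real.fourierChar (-⟪(latticePoint m : Rd d), latticePoint n⟫_ℝ) = 1 := by
  have : -⟪(latticePoint m : Rd d), latticePoint n⟫_ℝ = ((-∑ i, n i * m i : ℤ) : ℝ) := by
    simp [latticePoint, PiLp.inner_apply]
  rw [this]
  ext
  rw [Real.fourierChar_apply, Circle.coe_one, Complex.exp_eq_one_iff]
  exact ⟨-∑ i, n i * m i, by push_cast; ring⟩

theorem ae_forall_latticePoint {P : Rd d → Prop} (h : ∀ᵐ x, P x) :
    ∀ᵐ x, ∀ n : Fin d → ℤ, P (x + latticePoint n) :=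
  ae_all_iff.2 fun n => (measurePreserving_add_right volume
    (latticePoint n : Rd d)).quasiMeasurePreserving.ae h

theorem subset_shiftInvariantSpace (G : Set (L2 d)) : G ⊆ shiftInvariantSpace G := by
  intro g hg
  refine Submodule.le_topologicalClosure _ (Submodule.subset_span ⟨g, hg, 0, ?_⟩)
  refine Lp.ext ?_
  filter_upwards [translateL2_coeFn (latticePoint (0 : Fin d → ℤ)) g] with x hx
  rw [hx, latticePoint_zero, sub_zero]

/-- On fibers, an integer translation acts as a scalar, since ⟨m, n⟩ ∈ ℤ. The passage to the closure
uses almost everywhere convergence along a subsequence and the closedness of finite-dimensional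
subspaces of ℂ^{ℤ^d} for the product topology. -/
theorem ae_mem_span_fiber {κ : Type*} [Finite κ] (g : κ → L2 d) {f : L2 d}
    (hf : f ∈ shiftInvariantSpace (Set.range g)) :
    ∀ᵐ x, (fun n : Fin d → ℤ => ((𝓕 f : L2 d) : Rd d → ℂ) (x + latticePoint n)) ∈
      Submodule.span ℂ (Set.range fun k => fun n : Fin d → ℤ =>
        ((𝓕 (g k) : L2 d) : Rd d → ℂ) (x + latticePoint n)) := by
  have hF : Continuous fun f : L2 d => (𝓕 f : L2 d) :=
    (Lp.fourierTransformₗᵢ (Rd d) ℂ).continuous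
  have hspan : ∀ f ∈ Submodule.span ℂ {h : L2 d | ∃ g' ∈ Set.range g, ∃ n : Fin d → ℤ,
      h = translateL2 (latticePoint n) g'}, ∀ᵐ x,
      (fun n : Fin d → ℤ => ((𝓕 f : L2 d) : Rd d → ℂ) (x + latticePoint n)) ∈
      Submodule.span ℂ (Set.range fun k => fun n : Fin d → ℤ =>
        ((𝓕 (g k) : L2 d) : Rd d → ℂ) (x + latticePoint n)) := by
    intro f hf
    refine Submodule.span_induction ?_ ?_ ?_ ?_ hf
    · rintro _ ⟨_, ⟨k, rfl⟩, m, rfl⟩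
      filter_upwards [ae_forall_latticePoint (fourier_translateL2 (latticePoint m) (g k))] with x hx
      have : (fun n : Fin d → ℤ => ((𝓕 (translateL2 (latticePoint m) (g k)) : L2 d) : Rd d → ℂ)
          (x + latticePoint n)) = (Real.fourierChar (-⟪(latticePoint m : Rd d), x⟫_ℝ) : ℂ) •
          fun n : Fin d → ℤ => ((𝓕 (g k) : L2 d) : Rd d → ℂ) (x + latticePoint n) := by
        funext n
        rw [hx n, inner_add_right, neg_add, AddChar.map_add_eq_mul,
          fourierChar_inner_latticePoint, mul_one]
        rfl
      rw [this]
      exact Submodule.smul_mem _ _ (Submodule.subset_span ⟨k, rfl⟩)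
    · have h0 : (𝓕 (0 : L2 d) : L2 d) = 0 := (Lp.fourierTransformₗᵢ (Rd d) ℂ).map_zero
      filter_upwards [ae_forall_latticePoint (Lp.coeFn_zero ℂ 2 (volume : Measure (Rd d)))] with x hx
      rw [h0]
      simp_rw [hx]
      exact Submodule.zero_mem _
    · intro u v _ _ hu hv
      have h0 : (𝓕 (u + v) : L2 d) = 𝓕 u + 𝓕 v := (Lp.fourierTransformₗᵢ (Rd d) ℂ).map_add u v
      filter_upwards [hu, hv, ae_forall_latticePoint (Lp.coeFn_add (𝓕 u : L2 d) (𝓕 v))]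
        with x hxu hxv hx
      rw [h0]
      simp_rw [hx]
      exact Submodule.add_mem _ hxu hxv
    · intro c u _ hu
      have h0 : (𝓕 (c • u) : L2 d) = c • 𝓕 u := (Lp.fourierTransformₗᵢ (Rd d) ℂ).map_smul c u
      filter_upwards [hu, ae_forall_latticePoint (Lp.coeFn_smul c (𝓕 u : L2 d))] with x hxu hx
      rw [h0]
      simp_rw [hx]
      exact Submodule.smul_mem _ c hxu
  obtain ⟨u, hu, hlim⟩ := mem_closure_iff_seq_limit.1 (show f ∈ closure _ from hf)
  obtain ⟨ns, -, hns⟩ := exists_seq_tendsto_ae_of_tendsto_L2 ((hF.tendsto f).comp hlim)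
  filter_upwards [ae_forall_latticePoint hns, ae_all_iff.2 fun i => hspan (u i) (hu i)]
    with x hx hmem
  have : FiniteDimensional ℂ (Submodule.span ℂ (Set.range fun k => fun n : Fin d → ℤ =>
        ((𝓕 (g k) : L2 d) : Rd d → ℂ) (x + latticePoint n))) :=
    FiniteDimensional.span_of_finite ℂ (Set.finite_range _)
  refine (Submodule.closed_of_finiteDimensional _).mem_of_tendsto (tendsto_pi_nhds.2 hx)
    (Eventually.of_forall fun i => hmem (ns i))

theorem ae_exists_fiber_eq_sum {κ : Type*} [Fintype κ] (g : κ → L2 d) {f : L2 d}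
    (hf : f ∈ shiftInvariantSpace (Set.range g)) :
    ∀ᵐ x, ∃ c : κ → ℂ, ∀ n : Fin d → ℤ, ((𝓕 f : L2 d) : Rd d → ℂ) (x + latticePoint n) =
      ∑ k, c k * ((𝓕 (g k) : L2 d) : Rd d → ℂ) (x + latticePoint n) := by
  filter_upwards [ae_mem_span_fiber g hf] with x hx
  obtain ⟨c, hc⟩ := (Submodule.mem_span_range_iff_exists_fun ℂ).1 hx
  refine ⟨c, fun n => ?_⟩
  have := congrFun hc n
  simp only [Finset.sum_apply, Pi.smul_apply, smul_eq_mul] at this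
  exact this.symm

/-- The Fourier transforms of a finite family in `L²`. -/
abbrev fourierFamily (F : Fin K → L2 d) : Fin K → Rd d → ℂ := fun k => ((𝓕 (F k) : L2 d) : Rd d → ℂ)

/-- Row rank against column rank: if the K sequences are combinations of those of G, all fiber
vectors are combinations of the coefficient vectors `v j`. -/
theorem ae_finrank_span_fiber_le (F : Fin K → L2 d) (G : Finset (L2 d))
    (hG : shiftInvariantSpace (G : Set (L2 d)) = shiftInvariantSpace (Set.range F)) :
    ∀ᵐ x, Module.finrank ℂ (Submodule.span ℂ (Set.range (fiber (fourierFamily F) x))) ≤ G.card := by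
  have hr : Set.range (Subtype.val : G → L2 d) = G := Subtype.range_coe
  have h : ∀ᵐ x, ∀ k, ∃ c : G → ℂ, ∀ n : Fin d → ℤ, ((𝓕 (F k) : L2 d) : Rd d → ℂ)
      (x + latticePoint n) =
      ∑ j, c j * ((𝓕 (j : L2 d) : L2 d) : Rd d → ℂ) (x + latticePoint n) := by
    refine ae_all_iff.2 fun k => ae_exists_fiber_eq_sum (Subtype.val : G → L2 d) ?_
    rw [hr, hG]
    exact subset_shiftInvariantSpace _ ⟨k, rfl⟩
  filter_upwards [h] with x hx
  choose c hc using hx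
  let v : G → EuclideanSpace ℂ (Fin K) := fun j => WithLp.toLp 2 fun k => c k j
  have hle : Submodule.span ℂ (Set.range (fiber (fourierFamily F) x)) ≤
      Submodule.span ℂ (Set.range v) := by
    rw [Submodule.span_le]
    rintro _ ⟨n, rfl⟩
    have : fiber (fourierFamily F) x n =
        ∑ j : G, ((𝓕 (j : L2 d) : L2 d) : Rd d → ℂ) (x + latticePoint n) • v j := by
      ext k
      simp only [fiber, fourierFamily, hc, v, WithLp.ofLp_sum, Finset.sum_apply, WithLp.ofLp_smul,
        Pi.smul_apply, smul_eq_mul]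
      exact Finset.sum_congr rfl fun j _ => mul_comm _ _
    rw [this]
    exact Submodule.sum_mem _ fun j _ => Submodule.smul_mem _ _ (Submodule.subset_span ⟨j, rfl⟩)
  refine (Submodule.finrank_mono hle).trans ((finrank_range_le_card v).trans ?_)
  simp

/-- The character `n ↦ exp (-2πi ⟨γ, n⟩)` of the lattice. -/
def latticeChar (γ : Rd d) (n : Fin d → ℤ) : ℂ :=
  (Real.fourierChar (-⟪γ, (latticePoint n : Rd d)⟫_ℝ) : ℂ)

theorem latticeChar_ne_zero (γ : Rd d) (n : Fin d → ℤ) : latticeChar γ n ≠ 0 :=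
  Circle.coe_ne_zero _

theorem latticeChar_add (γ : Rd d) (n m : Fin d → ℤ) :
    latticeChar γ (n + m) = latticeChar γ n * latticeChar γ m := by
  rw [latticeChar, latticePoint_add, inner_add_right, neg_add, AddChar.map_add_eq_mul,
    Circle.coe_mul]
  rfl

/-- The translates by γ of the generators lie in V, so their fibers are combinations of those of F;
the coefficients form the matrix B. The common phase exp(-2πi⟨γ,x⟩) is divided out. -/
theorem ae_exists_linearMap_fiber_eq (F : Fin K → L2 d) {γ : Rd d}
    (hγ : ∀ h ∈ shiftInvariantSpace (Set.range F), translateL2 γ h ∈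
      shiftInvariantSpace (Set.range F)) :
    ∀ᵐ x, ∃ B : EuclideanSpace ℂ (Fin K) →ₗ[ℂ] EuclideanSpace ℂ (Fin K),
      ∀ n, B (fiber (fourierFamily F) x n) = latticeChar γ n • fiber (fourierFamily F) x n := by
  have h : ∀ᵐ x, ∀ k, ∃ c : Fin K → ℂ, ∀ n : Fin d → ℤ,
      ((𝓕 (translateL2 γ (F k)) : L2 d) : Rd d → ℂ) (x + latticePoint n) =
      ∑ j, c j * ((𝓕 (F j) : L2 d) : Rd d → ℂ) (x + latticePoint n) :=
    ae_all_iff.2 fun k => ae_exists_fiber_eq_sum F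
      (hγ _ (subset_shiftInvariantSpace _ ⟨k, rfl⟩))
  filter_upwards [h, ae_forall_latticePoint (ae_all_iff.2 fun k => fourier_translateL2 γ (F k))]
    with x hx hx'
  choose c hc using hx
  refine ⟨(Real.fourierChar (-⟪γ, x⟫_ℝ) : ℂ)⁻¹ • Matrix.toEuclideanLin (Matrix.of c), fun n => ?_⟩
  have h0 : (Real.fourierChar (-⟪γ, x⟫_ℝ) : ℂ) ≠ 0 := Circle.coe_ne_zero _
  rw [LinearMap.smul_apply, inv_smul_eq_iff₀ h0]
  ext k
  have h1 := hc k n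
  rw [hx' n k, inner_add_right, neg_add, AddChar.map_add_eq_mul, Circle.coe_mul] at h1
  simp only [fiber, fourierFamily, latticeChar, Matrix.toLpLin_apply, Matrix.mulVec, dotProduct,
    Matrix.of_apply, WithLp.ofLp_smul, Pi.smul_apply, smul_eq_mul]
  rw [← h1]
  ring

end

noncomputable section

open scoped InnerProductSpace

/-! ### Periodization -/

theorem tsum_indicator_box_le {d : ℕ} (N : ℕ) (x : Rd d) :
    ∑' n : Fin d → ℤ, (cube (0 : Rd d) N).indicator (1 : Rd d → ℝ≥0∞) (x - latticePoint n) ≤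
      (Fintype.piFinset fun _ : Fin d => Finset.Icc (-(N + 1) : ℤ) (N + 1)).card := by
  set S := Fintype.piFinset fun _ : Fin d => Finset.Icc (-(N + 1) : ℤ) (N + 1)
  -- Recentering at the lattice point nearest to x makes the finite set of relevant n independent of
  -- x.
  rw [← (Equiv.addLeft fun i => round (x i)).tsum_eq]
  rw [tsum_eq_sum (s := S)]
  · refine (Finset.sum_le_sum (g := fun _ => 1) fun n _ => ?_).trans (by simp)
    exact Set.indicator_le_self' (fun _ _ => zero_le_one) _
  · intro n hn
    refine Set.indicator_of_notMem (fun hx => hn ?_) _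
    refine Fintype.mem_piFinset.2 fun i => ?_
    have h1 := hx i
    have h2 := abs_sub_round (x i)
    simp only [latticePoint, Equiv.coe_addLeft, Pi.add_apply, PiLp.sub_apply, PiLp.zero_apply,
      Int.cast_add, sub_zero] at h1
    have h3 := abs_le.1 h1
    have h4 := abs_le.1 h2
    have h5 : ((n i : ℤ) : ℝ) < ((N + 2 : ℤ) : ℝ) := by push_cast; linarith
    have h6 : ((-(N + 2) : ℤ) : ℝ) < ((n i : ℤ) : ℝ) := by push_cast; linarith
    have h7 := Int.cast_lt.1 h5
    have h8 := Int.cast_lt.1 h6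
    rw [Finset.mem_Icc]
    omega

theorem measurableSet_cube {d : ℕ} (x : Rd d) (τ : ℝ) : MeasurableSet (cube x τ) := by
  have : cube x τ = ⋂ i, {y : Rd d | |y i - x i| ≤ τ} := by
    ext y; simp [cube]
  rw [this]
  refine MeasurableSet.iInter fun i => measurableSet_le ?_ measurable_const
  fun_prop

/-- Unfolding: the lattice translates of the box overlap boundedly often. -/
theorem exists_lintegral_box_tsum_le (d N : ℕ) : ∃ C : ℝ≥0∞, C ≠ ⊤ ∧
    ∀ G : Rd d → ℝ≥0∞, Measurable G →
      ∫⁻ x in cube (0 : Rd d) N, ∑' n : Fin d → ℤ, G (x + latticePoint n) ≤ C * ∫⁻ x, G x := by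
  refine ⟨(Fintype.piFinset fun _ : Fin d => Finset.Icc (-(N + 1) : ℤ) (N + 1)).card,
    ENNReal.natCast_ne_top _, fun G hG => ?_⟩
  have hm := measurableSet_cube (0 : Rd d) N
  have h1 : Measurable ((cube (0 : Rd d) N).indicator (1 : Rd d → ℝ≥0∞)) :=
    measurable_one.indicator hm
  calc ∫⁻ x in cube (0 : Rd d) N, ∑' n : Fin d → ℤ, G (x + latticePoint n)
      = ∑' n : Fin d → ℤ, ∫⁻ x in cube (0 : Rd d) N, G (x + latticePoint n) :=
        lintegral_tsum fun n => (hG.comp (measurable_id.add_const _)).aemeasurable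
    _ = ∑' n : Fin d → ℤ, ∫⁻ x, (cube (0 : Rd d) N).indicator (1 : Rd d → ℝ≥0∞)
          (x - latticePoint n) * G x := by
        refine tsum_congr fun n => ?_
        rw [← lintegral_indicator hm, ← lintegral_add_right_eq_self (μ := volume)
          (fun x => (cube (0 : Rd d) N).indicator (1 : Rd d → ℝ≥0∞)
          (x - latticePoint n) * G x) (latticePoint n)]
        refine lintegral_congr fun x => ?_
        by_cases hx : x ∈ cube (0 : Rd d) N
        · simp [hx]
        · simp [hx]
    _ = ∫⁻ x, ∑' n : Fin d → ℤ, (cube (0 : Rd d) N).indicator (1 : Rd d → ℝ≥0∞)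
          (x - latticePoint n) * G x :=
        (lintegral_tsum fun n =>
          ((h1.comp (measurable_id.sub_const _)).mul hG).aemeasurable).symm
    _ ≤ ∫⁻ x, (Fintype.piFinset fun _ : Fin d => Finset.Icc (-(N + 1) : ℤ) (N + 1)).card * G x := by
        refine lintegral_mono fun x => ?_
        rw [ENNReal.tsum_mul_right]
        gcongr
        exact tsum_indicator_box_le N x
    _ = _ := lintegral_const_mul _ hG

variable {d K : ℕ} {H : Fin K → Rd d → ℂ}

theorem enorm_sq_toLp {v : Fin K → ℂ} :
    ‖(WithLp.toLp 2 v : EuclideanSpace ℂ (Fin K))‖ₑ ^ 2 = ∑ k, ‖v k‖ₑ ^ 2 := by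
  rw [← ofReal_norm, ← ENNReal.ofReal_pow (norm_nonneg _), EuclideanSpace.norm_sq_eq,
    ENNReal.ofReal_sum_of_nonneg fun _ _ => sq_nonneg _]
  refine Finset.sum_congr rfl fun k _ => ?_
  rw [ENNReal.ofReal_pow (norm_nonneg _), ofReal_norm]

theorem lintegral_box_fiberNormSq_ne_top (hm : ∀ k, Measurable (H k))
    (hH : ∀ k, ∫⁻ x, ‖H k x‖ₑ ^ 2 ≠ ⊤) (N : ℕ) :
    ∫⁻ x in cube (0 : Rd d) N, fiberNormSq H x ≠ ⊤ := by
  obtain ⟨C, hC, h⟩ := exists_lintegral_box_tsum_le d N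
  have h1 := h (fun x => ∑ k, ‖H k x‖ₑ ^ 2)
    (Finset.measurable_fun_sum _ fun k _ => (hm k).enorm.pow_const 2)
  rw [lintegral_finsetSum _ fun k _ => (hm k).enorm.pow_const 2] at h1
  refine ne_top_of_le_ne_top (ENNReal.mul_ne_top hC (ENNReal.sum_ne_top.2 fun k _ => hH k))
    (le_trans (le_of_eq ?_) h1)
  refine lintegral_congr fun x => tsum_congr fun n => ?_
  rw [fiber, enorm_sq_toLp]

theorem ae_fiberNormSq_ne_top (hm : ∀ k, Measurable (H k))
    (hH : ∀ k, ∫⁻ x, ‖H k x‖ₑ ^ 2 ≠ ⊤) : ∀ᵐ x, fiberNormSq H x ≠ ⊤ := by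
  have h : ∀ᵐ x, ∀ N : ℕ, x ∈ cube (0 : Rd d) N → fiberNormSq H x < ⊤ := ae_all_iff.2 fun N =>
    (ae_restrict_iff' (measurableSet_cube _ _)).1
      (ae_lt_top (measurable_fiberNormSq hm) (lintegral_box_fiberNormSq_ne_top hm hH N))
  filter_upwards [h] with x hx
  obtain ⟨N, hN⟩ := exists_nat_ge ‖x‖
  refine (hx N fun i => ?_).ne
  rw [PiLp.zero_apply, sub_zero, ← Real.norm_eq_abs]
  exact (PiLp.norm_apply_le x i).trans hN

theorem exists_lintegral_box_fiberDistSq_le (hm : ∀ k, Measurable (H k)) {i : Fin d} {q : ℝ}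
    (hH : ∀ k, ∃ C : ℝ≥0∞, C ≠ ⊤ ∧ ∀ t : ℝ,
      shiftDistSq (H k) (t • EuclideanSpace.single i 1) ≤ C * ‖t‖ₑ ^ q) (N : ℕ) :
    ∃ C : ℝ≥0∞, C ≠ ⊤ ∧ ∀ t : ℝ, ∫⁻ x in cube (0 : Rd d) N,
      fiberDistSq H x (x + t • EuclideanSpace.single i 1) ≤ C * ‖t‖ₑ ^ q := by
  obtain ⟨C, hC, h⟩ := exists_lintegral_box_tsum_le d N
  choose A hA hA' using hH
  refine ⟨C * ∑ k, A k, ENNReal.mul_ne_top hC (ENNReal.sum_ne_top.2 fun k _ => hA k), fun t => ?_⟩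
  have hm' : ∀ k, Measurable fun x => ‖H k (x + t • EuclideanSpace.single i 1) - H k x‖ₑ ^ 2 :=
    fun k => (((hm k).comp (measurable_id.add_const _)).sub (hm k)).enorm.pow_const 2
  have h1 := h (fun x => ∑ k, ‖H k (x + t • EuclideanSpace.single i 1) - H k x‖ₑ ^ 2)
    (Finset.measurable_fun_sum _ fun k _ => hm' k)
  rw [lintegral_finsetSum _ fun k _ => hm' k] at h1
  rw [mul_assoc, Finset.sum_mul]
  refine le_trans (le_of_eq ?_) (h1.trans ?_)
  · refine lintegral_congr fun x => tsum_congr fun n => ?_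
    rw [← enorm_neg, neg_sub, fiber, fiber, ← WithLp.toLp_sub, enorm_sq_toLp]
    refine Finset.sum_congr rfl fun k _ => ?_
    rw [Pi.sub_apply, add_right_comm]
  · gcongr with k
    exact hA' k t

/-! ### Lines parallel to a coordinate axis -/

variable {m : ℕ}

/-- The point with `i`-th coordinate `t`, and remaining coordinates `z`. -/
def linePoint (i : Fin (m + 1)) (t : ℝ) (z : Fin m → ℝ) : Rd (m + 1) :=
  WithLp.toLp 2 (i.insertNth t z)

theorem measurePreserving_linePoint (i : Fin (m + 1)) :
    MeasurePreserving fun p : ℝ × (Fin m → ℝ) => linePoint i p.1 p.2 :=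
  (PiLp.volume_preserving_toLp (Fin (m + 1))).comp
    (volume_preserving_piFinSuccAbove (fun _ : Fin (m + 1) => ℝ) i).symm

theorem measurable_linePoint (i : Fin (m + 1)) :
    Measurable fun p : ℝ × (Fin m → ℝ) => linePoint i p.1 p.2 :=
  (measurePreserving_linePoint i).measurable

theorem linePoint_add (i : Fin (m + 1)) (t h : ℝ) (z : Fin m → ℝ) :
    linePoint i (t + h) z = linePoint i t z + h • EuclideanSpace.single i 1 := by
  ext j
  refine Fin.succAboveCases i ?_ (fun k => ?_) j
  · simp [linePoint]
  · simp [linePoint, Fin.succAbove_ne]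

theorem linePoint_mem_cube_iff {i : Fin (m + 1)} {t t' τ : ℝ} {z z' : Fin m → ℝ} :
    linePoint i t z ∈ cube (linePoint i t' z') τ ↔ |t - t'| ≤ τ ∧ ∀ k, |z k - z' k| ≤ τ := by
  simp only [cube, Set.mem_ofPred_eq, Fin.forall_iff_succAbove i, linePoint,
    Fin.insertNth_apply_same, Fin.insertNth_apply_succAbove]

theorem ae_linePoint (i : Fin (m + 1)) {P : Rd (m + 1) → Prop} (h : ∀ᵐ x, P x) :
    ∀ᵐ z : Fin m → ℝ, ∀ᵐ t : ℝ, P (linePoint i t z) := by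
  have h1 : ∀ᵐ p : ℝ × (Fin m → ℝ), P (linePoint i p.1 p.2) :=
    (measurePreserving_linePoint i).quasiMeasurePreserving.ae h
  have h2 : ∀ᵐ p : (Fin m → ℝ) × ℝ, P (linePoint i p.2 p.1) :=
    (Measure.measurePreserving_swap (μ := (volume : Measure (Fin m → ℝ)))
      (ν := (volume : Measure ℝ))).quasiMeasurePreserving.ae h1
  exact Measure.ae_ae_of_ae_prod h2

theorem lintegral_linePoint (i : Fin (m + 1)) {f : Rd (m + 1) → ℝ≥0∞} (hf : Measurable f)
    {τ : ℝ} {t : ℝ} {z : Fin m → ℝ} (hτ : 0 ≤ τ) :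
    ∫⁻ x in cube (linePoint i t z) τ, f x = ∫⁻ z' in Metric.closedBall z τ,
      ∫⁻ t' in Metric.closedBall t τ, f (linePoint i t' z') := by
  have hpre : (fun p : ℝ × (Fin m → ℝ) => linePoint i p.1 p.2) ⁻¹' cube (linePoint i t z) τ =
      Metric.closedBall t τ ×ˢ Metric.closedBall z τ := by
    ext p
    rw [Set.mem_preimage, linePoint_mem_cube_iff, Set.mem_prod, Metric.mem_closedBall,
      Metric.mem_closedBall, Real.dist_eq, dist_pi_le_iff hτ]
    simp only [Real.dist_eq]
  rw [← (measurePreserving_linePoint i).setLIntegral_comp_preimage (measurableSet_cube _ _) hf,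
    hpre, Measure.volume_eq_prod, setLIntegral_prod_symm]
  exact (hf.comp (measurable_linePoint i)).aemeasurable

end

/-! ### Energy along lines -/

noncomputable section

open scoped InnerProductSpace

variable {m : ℕ} {D : Rd (m + 1) → Rd (m + 1) → ℝ≥0∞}

theorem linePoint_zero (i : Fin (m + 1)) : linePoint i 0 (0 : Fin m → ℝ) = 0 := by
  ext j
  refine Fin.succAboveCases i ?_ (fun k => ?_) j <;> simp [linePoint]

/-- The energy of `D` along the line through `z` parallel to the `i`-th axis. -/
def lineEnergy (D : Rd (m + 1) → Rd (m + 1) → ℝ≥0∞) (i : Fin (m + 1)) (p : ℝ) (z : Fin m → ℝ) : ℝ≥0∞ :=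
  ∫⁻ t in Set.Icc (-2 : ℝ) 2, ∫⁻ t' in Set.Icc (-2 : ℝ) 2,
    D (linePoint i t z) (linePoint i t' z) / ‖t - t'‖ₑ ^ p

theorem measurable_comp_linePoint (hD : Measurable fun x : Rd (m + 1) × Rd (m + 1) => D x.1 x.2) (i : Fin (m + 1)) :
    Measurable fun q : ((Fin m → ℝ) × ℝ) × ℝ =>
      D (linePoint i q.1.2 q.1.1) (linePoint i q.2 q.1.1) := by
  have h1 : Measurable fun q : ((Fin m → ℝ) × ℝ) × ℝ => linePoint i q.1.2 q.1.1 :=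
    (measurable_linePoint i).comp ((measurable_snd.comp measurable_fst).prodMk
      (measurable_fst.comp measurable_fst))
  have h2 : Measurable fun q : ((Fin m → ℝ) × ℝ) × ℝ => linePoint i q.2 q.1.1 :=
    (measurable_linePoint i).comp (measurable_snd.prodMk (measurable_fst.comp measurable_fst))
  exact hD.comp (h1.prodMk h2)

theorem measurable_lineEnergy (hD : Measurable fun x : Rd (m + 1) × Rd (m + 1) => D x.1 x.2) (i : Fin (m + 1)) (p : ℝ) :
    Measurable (lineEnergy D i p) := by
  have h : Measurable fun q : ((Fin m → ℝ) × ℝ) × ℝ =>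
      D (linePoint i q.1.2 q.1.1) (linePoint i q.2 q.1.1) / ‖q.1.2 - q.2‖ₑ ^ p :=
    (measurable_comp_linePoint hD i).div
      (((measurable_snd.comp measurable_fst).sub measurable_snd).enorm.pow_const _)
  exact (h.lintegral_prod_right' (ν := volume.restrict (Set.Icc (-2 : ℝ) 2))).lintegral_prod_right'
    (ν := volume.restrict (Set.Icc (-2 : ℝ) 2))

theorem lintegral_Icc_enorm_rpow_ne_top {q : ℝ} (hq : -1 < q) (R : ℝ) :
    ∫⁻ h in Set.Icc (-R) R, ‖h‖ₑ ^ q ≠ ⊤ := by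
  have h0 : IntervalIntegrable (fun x : ℝ => |x| ^ q) volume 0 |R| := by
    refine (intervalIntegral.intervalIntegrable_rpow' hq (a := 0) (b := |R|)).congr ?_
    intro x hx
    rw [Set.uIoc_of_le (abs_nonneg R)] at hx
    simp only
    rw [abs_of_pos hx.1]
  have h1 : IntervalIntegrable (fun x : ℝ => |x| ^ q) volume (-|R|) 0 := by
    rw [IntervalIntegrable.iff_comp_neg]
    simpa using h0.symm
  have h2 := (intervalIntegrable_iff_integrableOn_Icc_of_le
    (by linarith [abs_nonneg R])).1 (h1.trans h0)
  have h3 := (h2.mono_set (Set.Icc_subset_Icc (neg_le_neg (le_abs_self R)) (le_abs_self R))).2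
  refine ne_of_lt (lt_of_le_of_lt (lintegral_mono_ae (ae_restrict_of_ae ?_)) h3)
  have h4 : ∀ᵐ h : ℝ, h ≠ 0 := by simp [ae_iff]
  filter_upwards [h4] with h hh
  refine le_of_eq ?_
  rw [← ofReal_norm h, ENNReal.ofReal_rpow_of_pos (norm_pos_iff.2 hh), Real.norm_eq_abs,
    ← ofReal_norm (|h| ^ q), Real.norm_of_nonneg (Real.rpow_nonneg (abs_nonneg h) q)]

/-- Substitute t' = t + h and exchange integrals: for fixed h the inner integral is at most C
|h|^{q-p}, which is integrable at 0 as q - p > -1. The increments h range over [-4, 4] when t and t'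
range over [-2, 2]. -/
theorem lintegral_lineEnergy_ne_top (hD : Measurable fun x : Rd (m + 1) × Rd (m + 1) => D x.1 x.2) {i : Fin (m + 1)} {q p : ℝ}
    (h : ∃ C : ℝ≥0∞, C ≠ ⊤ ∧ ∀ t : ℝ, ∫⁻ x in cube (0 : Rd (m + 1)) (2 : ℕ),
      D x (x + t • EuclideanSpace.single i 1) ≤ C * ‖t‖ₑ ^ q) (hqp : p < 1 + q) :
    ∫⁻ z in Metric.closedBall (0 : Fin m → ℝ) 2, lineEnergy D i p z ≠ ⊤ := by
  obtain ⟨C, hC, h⟩ := h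
  have hD' := measurable_comp_linePoint hD i
  set Z := Metric.closedBall (0 : Fin m → ℝ) 2
  set I := Set.Icc (-2 : ℝ) 2
  set Φ : ((Fin m → ℝ) × ℝ) × ℝ → ℝ≥0∞ := fun u =>
    D (linePoint i u.1.2 u.1.1) (linePoint i (u.1.2 + u.2) u.1.1) / ‖u.2‖ₑ ^ p with hΦ
  have hΦm : Measurable Φ := by
    refine Measurable.div ?_ (measurable_snd.enorm.pow_const _)
    exact hD'.comp (measurable_fst.prodMk ((measurable_snd.comp measurable_fst).add measurable_snd))
  have h1 : ∀ z t, t ∈ I → ∫⁻ t' in I,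
      D (linePoint i t z) (linePoint i t' z) / ‖t - t'‖ₑ ^ p ≤
      ∫⁻ h in Set.Icc (-4 : ℝ) 4, Φ ((z, t), h) := by
    intro z t ht
    rw [← lintegral_indicator measurableSet_Icc, ← lintegral_indicator measurableSet_Icc,
      ← lintegral_add_left_eq_self _ t]
    refine lintegral_mono fun h => ?_
    by_cases hh : t + h ∈ I
    · have h4 : h ∈ Set.Icc (-4 : ℝ) 4 := ⟨by linarith [ht.2, hh.1], by linarith [ht.1, hh.2]⟩
      rw [Set.indicator_of_mem hh, Set.indicator_of_mem h4, hΦ]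
      simp only
      rw [sub_add_cancel_left, enorm_neg]
    · rw [Set.indicator_of_notMem hh]
      exact zero_le
  have h2 : ∀ z, lineEnergy D i p z ≤ ∫⁻ t in I, ∫⁻ h in Set.Icc (-4 : ℝ) 4, Φ ((z, t), h) :=
    fun z => setLIntegral_mono' measurableSet_Icc fun t ht => h1 z t ht
  have h3 : ∀ h : ℝ, ∫⁻ u in Z ×ˢ I, Φ (u, h) ≤ C * ‖h‖ₑ ^ q / ‖h‖ₑ ^ p := by
    intro h0
    have hmeas : Measurable fun x : Rd (m + 1) =>
        D x (x + h0 • EuclideanSpace.single i 1) :=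
      hD.comp (measurable_id.prodMk (measurable_id.add_const _))
    have h5 := lintegral_linePoint i hmeas (τ := 2) (t := 0) (z := 0) (by norm_num)
    rw [linePoint_zero] at h5
    have h7 := h h0
    rw [show ((2 : ℕ) : ℝ) = 2 by norm_num, h5] at h7
    simp only [hΦ, div_eq_mul_inv]
    have h8 : Measurable fun u : (Fin m → ℝ) × ℝ =>
        D (linePoint i u.2 u.1) (linePoint i (u.2 + h0) u.1) :=
      hD'.comp (measurable_id.prodMk (measurable_snd.add_const _))
    rw [lintegral_mul_const _ h8]
    gcongr
    rw [Measure.volume_eq_prod, setLIntegral_prod _ h8.aemeasurable]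
    refine le_trans (le_of_eq ?_) h7
    rw [Real.closedBall_eq_Icc]
    simp only [linePoint_add, Z, I]
    norm_num
  have h4 : ∫⁻ z in Z, lineEnergy D i p z ≤ ∫⁻ h in Set.Icc (-4 : ℝ) 4, C * ‖h‖ₑ ^ q / ‖h‖ₑ ^ p := by
    calc ∫⁻ z in Z, lineEnergy D i p z
        ≤ ∫⁻ z in Z, ∫⁻ t in I, ∫⁻ h in Set.Icc (-4 : ℝ) 4, Φ ((z, t), h) := lintegral_mono h2
      _ = ∫⁻ u in Z ×ˢ I, ∫⁻ h in Set.Icc (-4 : ℝ) 4, Φ (u, h) := by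
          rw [Measure.volume_eq_prod, setLIntegral_prod]
          exact (hΦm.lintegral_prod_right' (ν := volume.restrict (Set.Icc (-4 : ℝ) 4))).aemeasurable
      _ = ∫⁻ h in Set.Icc (-4 : ℝ) 4, ∫⁻ u in Z ×ˢ I, Φ (u, h) :=
          lintegral_lintegral_swap hΦm.aemeasurable
      _ ≤ _ := lintegral_mono h3
  refine ne_top_of_le_ne_top ?_ h4
  have h5 : ∫⁻ h in Set.Icc (-4 : ℝ) 4, C * ‖h‖ₑ ^ q / ‖h‖ₑ ^ p ≤
      ∫⁻ h in Set.Icc (-4 : ℝ) 4, C * ‖h‖ₑ ^ (q - p) := by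
    refine lintegral_mono_ae (ae_restrict_of_ae ?_)
    have h0 : ∀ᵐ h : ℝ, h ≠ 0 := by simp [ae_iff]
    filter_upwards [h0] with h hh
    rw [ENNReal.rpow_sub _ _ (enorm_ne_zero.2 hh) enorm_ne_top, mul_div_assoc]
  refine ne_top_of_le_ne_top ?_ h5
  rw [lintegral_const_mul' _ _ hC]
  exact ENNReal.mul_ne_top hC (lintegral_Icc_enorm_rpow_ne_top (by linarith) 4)

end

/-! ### The eigenvalue along a line -/

noncomputable section

open scoped InnerProductSpace

variable {d K : ℕ} {H : Fin K → Rd d → ℂ}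

theorem fiber_add_latticePoint (H : Fin K → Rd d → ℂ) (x : Rd d) (n₀ : Fin d → ℤ) :
    fiber H (x + latticePoint n₀) = fun n => fiber H x (n + n₀) := by
  funext n
  simp only [fiber]
  rw [add_assoc, ← latticePoint_add, add_comm n₀]

theorem finrank_classSpan_le {ι : Type*} (c : ι → ℂ) (φ : ι → EuclideanSpace ℂ (Fin K)) (a : ℂ) :
    Module.finrank ℂ (classSpan c φ a) ≤ K :=
  (Submodule.finrank_le _).trans (by simp)

theorem energyOn_le {I : Set ℝ} (hI : MeasurableSet I) {p : ℝ} {f : ℝ → ℝ}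
    {D : ℝ → ℝ → ℝ≥0∞} {C : ℝ≥0∞} (hC : C ≠ ⊤) {P : ℝ → Prop} (hP : ∀ᵐ t, t ∈ I → P t)
    (h : ∀ t t', P t → P t' → ‖f t - f t'‖ₑ ^ 2 ≤ C * D t t') :
    energyOn I p f ≤ C * ∫⁻ t in I, ∫⁻ t' in I, D t t' / ‖t - t'‖ₑ ^ p := by
  rw [← lintegral_const_mul' _ _ hC]
  have hP' := (ae_restrict_iff' hI).2 hP
  refine lintegral_mono_ae ?_
  filter_upwards [hP'] with t ht
  rw [← lintegral_const_mul' _ _ hC]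
  refine lintegral_mono_ae ?_
  filter_upwards [hP'] with t' ht'
  rw [← mul_div_assoc]
  gcongr
  exact h t t' ht ht'

theorem holderConst_nonneg (p : ℝ) : 0 ≤ holderConst p := sq_nonneg _

/-- A change of the integer is at most K and costs at least δ² of D. -/
theorem enorm_sub_natCast_sq_le {r r' K : ℕ} (hr : r ≤ K) (hr' : r' ≤ K) {δ : ℝ} (hδ : 0 < δ)
    {D : ℝ≥0∞} (h : r ≠ r' → ENNReal.ofReal (δ ^ 2) ≤ D) :
    ‖(r : ℝ) - r'‖ₑ ^ 2 ≤ ENNReal.ofReal (K ^ 2 / δ ^ 2) * D := by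
  by_cases hrr : r = r'
  · simp [hrr]
  · have h1 : ‖(r : ℝ) - r'‖ₑ ^ 2 ≤ ENNReal.ofReal ((K : ℝ) ^ 2) := by
      rw [← ofReal_norm, ← ENNReal.ofReal_pow (norm_nonneg _)]
      refine ENNReal.ofReal_le_ofReal (pow_le_pow_left₀ (norm_nonneg _) ?_ 2)
      rw [Real.norm_eq_abs, abs_le]
      have h2 : (r : ℝ) ≤ K := Nat.cast_le.2 hr
      have h3 : (r' : ℝ) ≤ K := Nat.cast_le.2 hr'
      constructor <;> linarith [Nat.cast_nonneg (α := ℝ) r, Nat.cast_nonneg (α := ℝ) r']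
    calc ‖(r : ℝ) - r'‖ₑ ^ 2 ≤ ENNReal.ofReal ((K : ℝ) ^ 2) := h1
      _ = ENNReal.ofReal (K ^ 2 / δ ^ 2) * ENNReal.ofReal (δ ^ 2) := by
        rw [← ENNReal.ofReal_mul (by positivity), div_mul_cancel₀ _ (by positivity)]
      _ ≤ _ := by gcongr; exact h hrr

/-- The fiber of `H` at `x` is square summable, it spans a space of dimension at most `j + 1`, and
multiplication by the character of `γ` is induced by a linear map. -/
def IsRegularPoint (H : Fin K → Rd d → ℂ) (γ : Rd d) (j : Fin K) (x : Rd d) : Prop :=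
  fiberNormSq H x ≠ ⊤ ∧
    Module.finrank ℂ (Submodule.span ℂ (Set.range (fiber H x))) ≤ j + 1 ∧
    ∃ B : EuclideanSpace ℂ (Fin K) →ₗ[ℂ] EuclideanSpace ℂ (Fin K),
      ∀ n, B (fiber H x n) = latticeChar γ n • fiber H x n

theorem IsRegularPoint.ofReal_le_fiberDistSq {γ : Rd d} {j : Fin K} {x y : Rd d}
    (hx : IsRegularPoint H γ j x) (hy : IsRegularPoint H γ j y) {δ : ℝ}
    (hδx : δ ≤ gramianEigenvalue H j x) (hδy : δ ≤ gramianEigenvalue H j y) {a : ℂ}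
    (ha : Module.finrank ℂ (classSpan (latticeChar γ) (fiber H x) a) ≠
      Module.finrank ℂ (classSpan (latticeChar γ) (fiber H y) a)) :
    ENNReal.ofReal δ ≤ fiberDistSq H x y := by
  obtain ⟨hx1, hx2, Bx, hBx⟩ := hx
  obtain ⟨hy1, hy2, By, hBy⟩ := hy
  rcases lt_or_gt_of_ne ha with h | h
  · rw [fiberDistSq_comm]
    exact (ENNReal.ofReal_le_ofReal hδy).trans
      (ofReal_gramianEigenvalue_le_fiberDistSq hy1 hBy j hy2 h)
  · exact (ENNReal.ofReal_le_ofReal hδx).trans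
      (ofReal_gramianEigenvalue_le_fiberDistSq hx1 hBx j hx2 h)

theorem finrank_classSpan_eq_zero {ι : Type*} {c : ι → ℂ} (φ : ι → EuclideanSpace ℂ (Fin K))
    {a : ℂ} (ha : a ∉ Set.range c) : Module.finrank ℂ (classSpan c φ a) = 0 := by
  have : {n | c n = a} = ∅ := Set.eq_empty_of_forall_notMem fun n hn => ha ⟨n, hn⟩
  rw [classSpan, this, Set.image_empty, Submodule.span_empty, finrank_bot]

/-- On a segment of length `> 1`, on which the eigenvalue is bounded away from zero, the dimensions
of the class spans are constant, which forces `e^{-2πi⟨γ, n₀⟩}` to be a root of unity. -/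
theorem latticeChar_pow_eq_one_of_le (hm : ∀ k, Measurable (H k)) {x : ℝ → Rd d}
    (hx : Measurable x) {n₀ : Fin d → ℤ} (hper : ∀ t, x (t + 1) = x t + latticePoint n₀)
    {γ : Rd d} {j : Fin K} (hreg : ∀ᵐ t, IsRegularPoint H γ j (x t)) {δ : ℝ} (hδ : 0 < δ)
    (hle : ∀ᵐ t, t ∈ Set.Icc (-(1 / 2) : ℝ) 1 → δ ^ 2 ≤ gramianEigenvalue H j (x t))
    {p : ℝ} (hp : 2 < p)
    (hE : ∫⁻ t in Set.Icc (-(1 / 2) : ℝ) 1, ∫⁻ t' in Set.Icc (-(1 / 2) : ℝ) 1,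
      fiberDistSq H (x t) (x t') / ‖t - t'‖ₑ ^ p ≠ ⊤) :
    latticeChar γ n₀ ^ ((j : ℕ) + 1) = 1 := by
  -- Both t and t + 1 lie in I for t ∈ [-1/2, 0], a set of positive measure; this is why the length
  -- must exceed one period.
  set I := Set.Icc (-(1 / 2) : ℝ) 1
  set c := latticeChar γ
  have hconst : ∀ a, ∃ k, ∀ᵐ t, t ∈ I → Module.finrank ℂ (classSpan c (fiber H (x t)) a) = k := by
    intro a
    set r : ℝ → ℕ := fun t => Module.finrank ℂ (classSpan c (fiber H (x t)) a)
    have hr : Measurable r := (measurable_finrank_classSpan hm c a).comp hx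
    have hrK : ∀ t, r t ≤ K := fun t => finrank_classSpan_le _ _ _
    refine exists_ae_eq_const_of_energyOn_ne_top hr ?_ hp ?_
    · refine IntegrableOn.of_bound (C := K) measure_Icc_lt_top
        (measurable_from_top.comp hr).aestronglyMeasurable (Eventually.of_forall fun t => ?_)
      rw [Real.norm_natCast]
      exact Nat.cast_le.2 (hrK t)
    · refine ne_top_of_le_ne_top (ENNReal.mul_ne_top ENNReal.ofReal_ne_top hE)
        (energyOn_le (C := ENNReal.ofReal (K ^ 2 / δ ^ 2))
        (P := fun t => IsRegularPoint H γ j (x t) ∧ δ ^ 2 ≤ gramianEigenvalue H j (x t))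
        measurableSet_Icc ENNReal.ofReal_ne_top ?_ ?_)
      · filter_upwards [hreg, hle] with t h1 h2 ht using ⟨h1, h2 ht⟩
      · intro t t' ht ht'
        exact enorm_sub_natCast_sq_le (hrK t) (hrK t') hδ fun hne =>
          ht.1.ofReal_le_fiberDistSq ht'.1 ht.2 ht'.2 hne
  choose k hk using hconst
  -- Only countably many colors occur, so one null set serves all of them.
  have hc : (Set.range c).Countable := Set.countable_range c
  have hall : ∀ᵐ t, ∀ a ∈ Set.range c, t ∈ I →
      Module.finrank ℂ (classSpan c (fiber H (x t)) a) = k a :=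
    (ae_ball_iff hc).2 fun a _ => hk a
  have hall' : ∀ᵐ t : ℝ, ∀ a ∈ Set.range c, t + 1 ∈ I →
      Module.finrank ℂ (classSpan c (fiber H (x (t + 1))) a) = k a :=
    (measurePreserving_add_right volume (1 : ℝ)).quasiMeasurePreserving.ae hall
  obtain ⟨t, ht, ⟨⟨h1, h2, B, hB⟩, h3⟩, h4, h5⟩ : ∃ t ∈ Set.Icc (-(1 / 2) : ℝ) 0,
      (IsRegularPoint H γ j (x t) ∧ (t ∈ I → δ ^ 2 ≤ gramianEigenvalue H j (x t))) ∧
      (∀ a ∈ Set.range c, t ∈ I →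
        Module.finrank ℂ (classSpan c (fiber H (x t)) a) = k a) ∧
      ∀ a ∈ Set.range c, t + 1 ∈ I →
        Module.finrank ℂ (classSpan c (fiber H (x (t + 1))) a) = k a := by
    have hpos : volume (Set.Icc (-(1 / 2) : ℝ) 0) ≠ 0 := by
      rw [Real.volume_Icc]; norm_num
    have : ∃ᵐ t ∂(volume : Measure ℝ), t ∈ Set.Icc (-(1 / 2) : ℝ) 0 :=
      frequently_ae_mem_iff.2 hpos
    obtain ⟨t, h1, h2⟩ := (this.and_eventually ((hreg.and hle).and (hall.and hall'))).exists
    exact ⟨t, h1, h2⟩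
  have htI : t ∈ I := ⟨ht.1, ht.2.trans zero_le_one⟩
  have htI' : t + 1 ∈ I := ⟨by linarith [ht.1], by linarith [ht.2]⟩
  have hl : c n₀ ≠ 0 := latticeChar_ne_zero γ n₀
  have hrank : Module.finrank ℂ (Submodule.span ℂ (Set.range (fiber H (x t)))) = j + 1 := by
    refine le_antisymm h2 (not_lt.1 fun hlt => ?_)
    have h6 := h3 htI
    rw [gramianEigenvalue_eq_zero_of_finrank_lt h1 j hlt] at h6
    exact absurd h6 (not_le.2 (by positivity))
  rw [← hrank]
  refine pow_finrank_eq_one_of_finrank_classSpan_eq hB (latticeChar_ne_zero γ) hl fun a => ?_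
  by_cases ha : a ∈ Set.range c
  · rw [h4 a ha htI, ← h5 a ha htI', hper, fiber_add_latticePoint,
      classSpan_shift hl fun n => latticeChar_add γ n n₀]
  · have ha' : a * c n₀ ∉ Set.range c := by
      rintro ⟨n, hn⟩
      refine ha ⟨n - n₀, mul_right_cancel₀ hl ?_⟩
      rw [← hn, ← latticeChar_add, sub_add_cancel]
    rw [finrank_classSpan_eq_zero _ ha, finrank_classSpan_eq_zero _ ha']

/-- The energy of √ζ is at most that of the fibers, so √ζ is Hölder on a set A of full measure in
[-2, 2]. If it were bounded below on A ∩ [-1/2, 1], then l^(j+1) = 1, contrary to `hl`; so it comes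
arbitrarily close to zero there. -/
theorem exists_sq_le_mul_abs_sub_rpow (hm : ∀ k, Measurable (H k)) {x : ℝ → Rd d}
    (hx : Measurable x) {n₀ : Fin d → ℤ} (hper : ∀ t, x (t + 1) = x t + latticePoint n₀)
    {γ : Rd d} {j : Fin K} (hreg : ∀ᵐ t, IsRegularPoint H γ j (x t))
    (hl : latticeChar γ n₀ ^ ((j : ℕ) + 1) ≠ 1) {f : ℝ → ℝ} (hf : Measurable f)
    (hfζ : ∀ᵐ t, f t = √(gramianEigenvalue H j (x t))) {p : ℝ} (hp : 2 < p) {S : ℝ≥0∞}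
    (hS : S = ∫⁻ t in Set.Icc (-2 : ℝ) 2, ∫⁻ t' in Set.Icc (-2 : ℝ) 2,
      fiberDistSq H (x t) (x t') / ‖t - t'‖ₑ ^ p) (hS' : S ≠ ⊤)
    (hint : ∫⁻ t in Set.Icc (-2 : ℝ) 2, fiberNormSq H (x t) ≠ ⊤) :
    ∃ A : Set ℝ, (∀ᵐ t, t ∈ Set.Icc (-2 : ℝ) 2 → t ∈ A) ∧
      (∀ s ∈ A, ∀ t ∈ A, (f s - f t) ^ 2 ≤ holderConst p * S.toReal * |s - t| ^ (p - 2)) ∧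
      ∃ t₀ ∈ Set.Icc (-(1 / 2) : ℝ) 1,
        ∀ t ∈ A, f t ^ 2 ≤ holderConst p * S.toReal * |t - t₀| ^ (p - 2) := by
  have hEle : energyOn (Set.Icc (-2 : ℝ) 2) p f ≤ S := by
    have := energyOn_le (C := 1) (p := p) (f := f) (I := Set.Icc (-2 : ℝ) 2)
      (D := fun t t' => fiberDistSq H (x t) (x t'))
      (P := fun t => IsRegularPoint H γ j (x t) ∧ f t = √(gramianEigenvalue H j (x t)))
      measurableSet_Icc ENNReal.one_ne_top ?_ ?_
    · rwa [one_mul, ← hS] at this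
    · filter_upwards [hreg, hfζ] with t h1 h2 _ using ⟨h1, h2⟩
    · intro t t' ht ht'
      rw [one_mul, ht.2, ht'.2, ← ofReal_norm, ← ENNReal.ofReal_pow (norm_nonneg _),
        Real.norm_eq_abs, sq_abs]
      exact ofReal_sq_sqrt_gramianEigenvalue_sub_le ht.1.1 ht'.1.1 j
  have hE : energyOn (Set.Icc (-2 : ℝ) 2) p f ≠ ⊤ := ne_top_of_le_ne_top hS' hEle
  have hfI : IntegrableOn f (Set.Icc (-2 : ℝ) 2) := by
    refine MemLp.integrable (q := 2) (by norm_num) ⟨hf.aestronglyMeasurable, ?_⟩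
    rw [eLpNorm_lt_top_iff_lintegral_rpow_enorm_lt_top (by norm_num) (by norm_num)]
    refine lt_of_le_of_lt (lintegral_mono_ae (ae_restrict_of_ae ?_)) hint.lt_top
    filter_upwards [hreg, hfζ] with t h1 h2
    have h3 := gramianEigenvalue_nonneg h1.1 j
    rw [ENNReal.toReal_ofNat, ENNReal.rpow_two, h2, ← ofReal_norm,
      ← ENNReal.ofReal_pow (norm_nonneg _), Real.norm_eq_abs, sq_abs, Real.sq_sqrt h3]
    exact ofReal_gramianEigenvalue_le_fiberNormSq h1.1 j
  obtain ⟨A, hA, hAI, hb⟩ := ae_sq_sub_le_of_energyOn_ne_top hf hfI hp hE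
  have hb' : ∀ s ∈ A, ∀ t ∈ A,
      (f s - f t) ^ 2 ≤ holderConst p * S.toReal * |s - t| ^ (p - 2) := by
    intro s hs t ht
    refine (hb s hs t ht).trans ?_
    have := ENNReal.toReal_mono hS' hEle
    gcongr
    exact holderConst_nonneg p
  refine ⟨A, hA, hb', exists_forall_sq_le_of_frequently_lt (sub_pos.2 hp) hb' ?_⟩
  by_contra! hcon
  obtain ⟨n, hn⟩ := hcon
  have hδ : (0 : ℝ) < 1 / (n + 1) := by positivity
  refine hl (latticeChar_pow_eq_one_of_le hm hx hper hreg hδ ?_ hp ?_)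
  · filter_upwards [hA, hreg, hfζ] with t h1 h2 h3 ht
    have h4 := hn t (h1 ⟨by linarith [ht.1], by linarith [ht.2]⟩) ht
    rw [h3, abs_of_nonneg (Real.sqrt_nonneg _)] at h4
    rw [← Real.sq_sqrt (gramianEigenvalue_nonneg h2.1 j)]
    gcongr
  · have hsub : Set.Icc (-(1 / 2) : ℝ) 1 ⊆ Set.Icc (-2 : ℝ) 2 :=
      Set.Icc_subset_Icc (by norm_num) (by norm_num)
    rw [hS] at hS'
    refine ne_top_of_le_ne_top hS' ?_
    exact (lintegral_mono_set hsub).trans (lintegral_mono fun _ => lintegral_mono_set hsub)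

end

/-! ### Averages over shrinking cubes -/

noncomputable section

open scoped InnerProductSpace

/-- Lebesgue differentiation of b cut off to Z, where it is integrable; small balls around interior
points do not see the cutoff. -/
theorem ae_tendsto_lintegral_closedBall_div {m : ℕ} {b : (Fin m → ℝ) → ℝ≥0∞} (hb : Measurable b)
    {Z : Set (Fin m → ℝ)} (hZ : MeasurableSet Z) (hbZ : ∫⁻ z in Z, b z ≠ ⊤) :
    ∀ᵐ z, z ∈ interior Z → Tendsto (fun τ => (∫⁻ z' in Metric.closedBall z τ, b z') /
      volume (Metric.closedBall z τ)) (𝓝[>] 0) (𝓝 (b z)) := by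
  have h1 : ∫⁻ z, Z.indicator b z ≠ ⊤ := by rwa [lintegral_indicator hZ]
  filter_upwards [(Besicovitch.vitaliFamily (volume : Measure (Fin m → ℝ))).ae_tendsto_lintegral_div
    (hb.indicator hZ).aemeasurable h1] with z hz hzZ
  have h2 := hz.comp (Besicovitch.tendsto_filterAt volume z)
  rw [Set.indicator_of_mem (interior_subset hzZ)] at h2
  refine h2.congr' ?_
  obtain ⟨ε, hε, hsub⟩ := Metric.isOpen_iff.1 isOpen_interior z hzZ
  filter_upwards [Ioo_mem_nhdsGT hε] with τ hτ
  simp only [Function.comp_apply]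
  congr 1
  refine setLIntegral_congr_fun Metric.isClosed_closedBall.measurableSet fun z' hz' => ?_
  exact Set.indicator_of_mem (interior_subset (hsub (Metric.closedBall_subset_ball hτ.2 hz'))) b

theorem le_average_add {u : ℝ → ℝ≥0∞} {A B : Set ℝ} (hB : MeasurableSet B) (hB0 : volume B ≠ 0)
    (hB' : volume B ≠ ⊤) (hA : ∀ᵐ t, t ∈ B → t ∈ A) {c : ℝ≥0∞} {s : ℝ}
    (h : ∀ t ∈ A, t ∈ B → u s ≤ 2 * u t + c) :
    u s ≤ 2 * (volume B)⁻¹ * (∫⁻ t in B, u t) + c := by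
  have h1 : volume B * u s ≤ 2 * (∫⁻ t in B, u t) + volume B * c := by
    calc volume B * u s = ∫⁻ _ in B, u s := by rw [setLIntegral_const, mul_comm]
      _ ≤ ∫⁻ t in B, (2 * u t + c) := by
        refine setLIntegral_mono_ae' hB ?_
        filter_upwards [hA] with t ht htB using h t (ht htB) htB
      _ = _ := by
        rw [lintegral_add_right _ measurable_const, lintegral_const_mul' _ _ (by simp),
          setLIntegral_const, mul_comm c]
  calc u s = (volume B)⁻¹ * (volume B * u s) := by
        rw [← mul_assoc, ENNReal.inv_mul_cancel hB0 hB', one_mul]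
    _ ≤ (volume B)⁻¹ * (2 * (∫⁻ t in B, u t) + volume B * c) := by gcongr
    _ = _ := by
        rw [mul_add, ← mul_assoc _ _ c, ENNReal.inv_mul_cancel hB0 hB', one_mul]
        ring

/-- Averages over shrinking cubes of a function, which is Hölder continuous and vanishes somewhere
on almost every line, with constants depending integrably on the line. -/
theorem ae_exists_tendsto_average_zero {m : ℕ} {u : ℝ → (Fin m → ℝ) → ℝ≥0∞}
    (hu : Measurable fun p : ℝ × (Fin m → ℝ) => u p.1 p.2) {S : (Fin m → ℝ) → ℝ≥0∞}
    (hS : Measurable S) {Z : Set (Fin m → ℝ)} (hZ : MeasurableSet Z) (hSZ : ∫⁻ z in Z, S z ≠ ⊤)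
    (huZ : ∫⁻ z in Z, ∫⁻ t in Set.Icc (-2 : ℝ) 2, u t z ≠ ⊤) {q : ℝ} (hq : 0 < q)
    (h : ∀ᵐ z, z ∈ Z → ∃ A : Set ℝ, (∀ᵐ t, t ∈ Set.Icc (-2 : ℝ) 2 → t ∈ A) ∧
      (∀ s ∈ A, ∀ t ∈ A, u s z ≤ 2 * u t z + S z * ENNReal.ofReal (|s - t| ^ q)) ∧
      ∃ t₀ ∈ Set.Icc (-(1 / 2) : ℝ) 1, ∀ t ∈ A, u t z ≤ S z * ENNReal.ofReal (|t - t₀| ^ q)) :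
    ∀ᵐ z, z ∈ interior Z → ∃ t₀ ∈ Set.Icc (-(1 / 2) : ℝ) 1,
      Tendsto (fun τ => (∫⁻ z' in Metric.closedBall z τ, ∫⁻ t in Metric.closedBall t₀ τ, u t z') /
        (volume (Metric.closedBall t₀ τ) * volume (Metric.closedBall z τ))) (𝓝[>] 0) (𝓝 0) := by
  set I := Set.Icc (-2 : ℝ) 2 with hI
  set κ : ℕ → ℝ := fun k => 1 / 2 * (1 / (k + 1)) with hκ
  have hκ0 : ∀ k, 0 < κ k := fun k => by positivity
  have hκ2 : ∀ k, κ k ≤ 1 / 2 := fun k => by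
    have : (1 : ℝ) / (k + 1) ≤ 1 := by
      rw [div_le_one (by positivity)]; linarith [Nat.cast_nonneg (α := ℝ) k]
    simp only [hκ]; linarith
  -- The zero t₀ depends on z without control, so intervals are taken from a countable family with
  -- rational centers. Almost every z is then a differentiation point of all the corresponding
  -- majorants at once.
  set B : ℕ → ℚ → Set ℝ := fun k c => Metric.closedBall (c : ℝ) (κ k) with hB
  have hBm : ∀ k c, MeasurableSet (B k c) := fun k c => Metric.isClosed_closedBall.measurableSet
  have hBv : ∀ k c, volume (B k c) = ENNReal.ofReal (2 * κ k) := fun k c => Real.volume_closedBall _ _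
  have hB0 : ∀ k c, volume (B k c) ≠ 0 := fun k c => by
    rw [hBv, ne_eq, ENNReal.ofReal_eq_zero, not_le]; linarith [hκ0 k]
  have hB' : ∀ k c, volume (B k c) ≠ ⊤ := fun k c => by rw [hBv]; exact ENNReal.ofReal_ne_top
  -- Majorant of u(·, z) on B k c: the Hölder bound averaged over the interval, whose diameter is 2
  -- κ k. Unlike the zero, it depends measurably and integrably on z.
  set b : ℕ → ℚ → (Fin m → ℝ) → ℝ≥0∞ := fun k c z =>
    2 * (volume (B k c))⁻¹ * (∫⁻ t in B k c, I.indicator (fun t => u t z) t) +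
      S z * ENNReal.ofReal ((2 * κ k) ^ q) with hb
  have hind : ∀ k c, B k c ⊆ I → ∀ z,
      ∫⁻ t in B k c, I.indicator (fun t => u t z) t = ∫⁻ t in B k c, u t z := fun k c hsub z =>
    setLIntegral_congr_fun (hBm k c) fun t ht => Set.indicator_of_mem (hsub ht) _
  have hum : Measurable fun p : (Fin m → ℝ) × ℝ => I.indicator (fun t => u t p.1) p.2 := by
    have : Measurable fun p : (Fin m → ℝ) × ℝ => (Prod.snd ⁻¹' I).indicator
        (fun p : (Fin m → ℝ) × ℝ => u p.2 p.1) p :=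
      Measurable.indicator (hu.comp measurable_swap) (measurable_snd measurableSet_Icc)
    exact this
  have hbm : ∀ k c, Measurable (b k c) := fun k c =>
    ((hum.lintegral_prod_right' (ν := volume.restrict (B k c))).const_mul _).add
      (hS.mul_const _)
  have hbZ : ∀ k c, ∫⁻ z in Z, b k c z ≠ ⊤ := by
    intro k c
    simp only [hb]
    have hfin : 2 * (volume (B k c))⁻¹ ≠ ⊤ :=
      ENNReal.mul_ne_top (by simp) (ENNReal.inv_ne_top.2 (hB0 k c))
    rw [lintegral_add_right _ (hS.mul_const _), lintegral_const_mul' _ _ hfin,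
      lintegral_mul_const' _ _ ENNReal.ofReal_ne_top]
    refine ENNReal.add_ne_top.2 ⟨ENNReal.mul_ne_top hfin (ne_top_of_le_ne_top huZ ?_),
      ENNReal.mul_ne_top hSZ ENNReal.ofReal_ne_top⟩
    refine lintegral_mono fun z => (setLIntegral_le_lintegral _ _).trans (le_of_eq ?_)
    exact lintegral_indicator measurableSet_Icc _
  have hleb : ∀ᵐ z, ∀ k c, z ∈ interior Z → Tendsto (fun τ =>
      (∫⁻ z' in Metric.closedBall z τ, b k c z') / volume (Metric.closedBall z τ))
      (𝓝[>] 0) (𝓝 (b k c z)) :=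
    ae_all_iff.2 fun k => ae_all_iff.2 fun c =>
      ae_tendsto_lintegral_closedBall_div (hbm k c) hZ (hbZ k c)
  have hSfin : ∀ᵐ z, z ∈ Z → S z < ⊤ := (ae_restrict_iff' hZ).1 (ae_lt_top hS hSZ)
  have hpt : ∀ᵐ z, z ∈ Z → ∀ k c, B k c ⊆ I → ∀ᵐ t, t ∈ B k c → u t z ≤ b k c z := by
    filter_upwards [h] with z hz hzZ k c hsub
    obtain ⟨A, hA, hA1, -⟩ := hz hzZ
    have hAB : ∀ᵐ t, t ∈ B k c → t ∈ A := by
      filter_upwards [hA] with t ht htB using ht (hsub htB)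
    filter_upwards [hAB] with s hs hsB
    simp only [hb]
    rw [hind k c hsub]
    refine le_average_add (u := fun t => u t z) (hBm k c) (hB0 k c) (hB' k c) hAB
      fun t ht htB => (hA1 s (hs hsB) t ht).trans ?_
    gcongr
    have := dist_triangle_right s t (c : ℝ)
    rw [← Real.dist_eq]
    linarith [Metric.mem_closedBall.1 hsB, Metric.mem_closedBall.1 htB]
  filter_upwards [hleb, hSfin, h] with z hz1 hz2 hz3 hzZ
  have hzZ' := interior_subset hzZ
  obtain ⟨A, hA, -, t₀, ht₀, hA2⟩ := hz3 hzZ'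
  refine ⟨t₀, ht₀, ENNReal.tendsto_nhds_zero.2 fun ε hε => ?_⟩
  -- If t₀ ∈ B k c ⊆ I, the average term of b k c z contributes twice S z (2 κ k)^q and the
  -- oscillation term once, hence 3.
  have hlim : Tendsto (fun k => 3 * (S z * ENNReal.ofReal ((2 * κ k) ^ q))) atTop (𝓝 0) := by
    have h1 : Tendsto (fun k => (2 * κ k) ^ q) atTop (𝓝 0) := by
      have h2 : Tendsto (fun k : ℕ => 2 * κ k) atTop (𝓝 0) := by
        simpa [hκ] using tendsto_one_div_add_atTop_nhds_zero_nat (𝕜 := ℝ)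
      simpa [Real.zero_rpow hq.ne'] using h2.rpow_const (Or.inr hq.le)
    have h3 := ENNReal.tendsto_ofReal h1
    rw [ENNReal.ofReal_zero] at h3
    have h4 := ENNReal.Tendsto.const_mul (a := 3) (ENNReal.Tendsto.const_mul (a := S z) h3
      (Or.inr (hz2 hzZ').ne)) (Or.inr (by simp))
    simpa using h4
  obtain ⟨k, hk⟩ := (hlim.eventually (gt_mem_nhds hε)).exists
  obtain ⟨c, hc1, hc2⟩ := exists_rat_btwn (show t₀ < t₀ + κ k / 2 by linarith [hκ0 k])
  have hsub : B k c ⊆ I := by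
    intro t ht
    rw [show B k c = Set.Icc ((c : ℝ) - κ k) (c + κ k) from Real.closedBall_eq_Icc] at ht
    have := hκ2 k
    exact ⟨by linarith [ht.1, ht₀.1], by linarith [ht.2, ht₀.2]⟩
  have hbz : b k c z < ε := by
    refine lt_of_le_of_lt ?_ hk
    have h1 : ∫⁻ t in B k c, u t z ≤ volume (B k c) * (S z * ENNReal.ofReal ((2 * κ k) ^ q)) := by
      calc ∫⁻ t in B k c, u t z ≤ ∫⁻ _ in B k c, S z * ENNReal.ofReal ((2 * κ k) ^ q) := by
            refine setLIntegral_mono_ae' (hBm k c) ?_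
            filter_upwards [hA] with t ht htB
            refine (hA2 t (ht (hsub htB))).trans ?_
            rw [show B k c = Set.Icc ((c : ℝ) - κ k) (c + κ k) from Real.closedBall_eq_Icc] at htB
            gcongr
            rw [abs_le]
            exact ⟨by linarith [htB.1, hκ0 k], by linarith [htB.2, hκ0 k]⟩
        _ = _ := by rw [setLIntegral_const, mul_comm]
    simp only [hb]
    rw [hind k c hsub]
    calc _ ≤ 2 * (volume (B k c))⁻¹ * (volume (B k c) * (S z * ENNReal.ofReal ((2 * κ k) ^ q))) +
          S z * ENNReal.ofReal ((2 * κ k) ^ q) := by gcongr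
      _ = _ := by
        rw [mul_assoc 2, ← mul_assoc (volume (B k c))⁻¹, ENNReal.inv_mul_cancel (hB0 k c) (hB' k c)]
        ring
  obtain ⟨r, hr, hrZ⟩ := Metric.isOpen_iff.1 isOpen_interior z hzZ
  have hev : ∀ᶠ τ in 𝓝[>] (0 : ℝ), (∫⁻ z' in Metric.closedBall z τ, b k c z') /
      volume (Metric.closedBall z τ) < ε := (hz1 k c hzZ).eventually (gt_mem_nhds hbz)
  filter_upwards [hev, Ioo_mem_nhdsGT hr, Ioo_mem_nhdsGT (half_pos (hκ0 k))] with τ h1 h2 h3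
  refine le_trans ?_ h1.le
  have hV : volume (Metric.closedBall t₀ τ) = ENNReal.ofReal (2 * τ) := Real.volume_closedBall _ _
  have hV0 : volume (Metric.closedBall t₀ τ) ≠ 0 := by
    rw [hV, ne_eq, ENNReal.ofReal_eq_zero, not_le]; linarith [h3.1]
  have hV' : volume (Metric.closedBall t₀ τ) ≠ ⊤ := by rw [hV]; exact ENNReal.ofReal_ne_top
  have hτB : Metric.closedBall t₀ τ ⊆ B k c := by
    refine Metric.closedBall_subset_closedBall' ?_
    rw [Real.dist_eq, abs_of_neg (by linarith)]
    linarith [h3.2]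
  -- On nearby lines only the majorant is used; their zeros may be elsewhere.
  have hint : ∫⁻ z' in Metric.closedBall z τ, ∫⁻ t in Metric.closedBall t₀ τ, u t z' ≤
      volume (Metric.closedBall t₀ τ) * ∫⁻ z' in Metric.closedBall z τ, b k c z' := by
    rw [← lintegral_const_mul' _ _ hV']
    refine setLIntegral_mono_ae' Metric.isClosed_closedBall.measurableSet ?_
    filter_upwards [hpt] with z' hz' hz'B
    have h4 := hz' (interior_subset (hrZ (Metric.closedBall_subset_ball h2.2 hz'B))) k c hsub
    calc ∫⁻ t in Metric.closedBall t₀ τ, u t z' ≤ ∫⁻ _ in Metric.closedBall t₀ τ, b k c z' := by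
          refine setLIntegral_mono_ae' Metric.isClosed_closedBall.measurableSet ?_
          filter_upwards [h4] with t ht htB using ht (hτB htB)
      _ = _ := by rw [setLIntegral_const, mul_comm]
  refine (ENNReal.div_le_div_right hint _).trans (le_of_eq ?_)
  exact ENNReal.mul_div_mul_left _ _ hV0 hV'

end

noncomputable section

open scoped InnerProductSpace

/-! ### Periodicity -/

theorem Matrix.IsHermitian.eigenvalues₀_congr {n : Type*} [Fintype n] [DecidableEq n]
    {A B : Matrix n n ℂ} (hA : A.IsHermitian) (hB : B.IsHermitian) (h : A = B) :
    hA.eigenvalues₀ = hB.eigenvalues₀ := by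
  subst h; rfl

theorem gramian_add_latticePoint {d K : ℕ} (H : Fin K → Rd d → ℂ) (x : Rd d) (n : Fin d → ℤ) :
    gramian H (x + latticePoint n) = gramian H x := by
  have := (Equiv.addLeft n).tsum_eq fun k : Fin d → ℤ =>
    Matrix.vecMulVec (fun l => H l (x + latticePoint k)) (star fun l => H l (x + latticePoint k))
  rw [gramian, gramian, ← this]
  refine tsum_congr fun k => ?_
  rw [Equiv.coe_addLeft, latticePoint_add, add_assoc]

theorem gramianEigenvalue_add_latticePoint {d K : ℕ} (H : Fin K → Rd d → ℂ) (j : Fin K) (x : Rd d)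
    (n : Fin d → ℤ) : gramianEigenvalue H j (x + latticePoint n) = gramianEigenvalue H j x :=
  congrFun ((gramian_isHermitian H _).eigenvalues₀_congr (gramian_isHermitian H _)
    (gramian_add_latticePoint H x n)) _

theorem setLIntegral_cube_add {d : ℕ} {w : Rd d → ℝ≥0∞} {a : Rd d} (hw : ∀ y, w (y + a) = w y)
    (x : Rd d) (τ : ℝ) : ∫⁻ y in cube (x + a) τ, w y = ∫⁻ y in cube x τ, w y := by
  rw [← lintegral_indicator (measurableSet_cube _ _), ← lintegral_indicator (measurableSet_cube _ _),
    ← lintegral_add_right_eq_self _ a]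
  refine lintegral_congr fun y => ?_
  have : y + a ∈ cube (x + a) τ ↔ y ∈ cube x τ := by simp [cube]
  by_cases hy : y ∈ cube x τ
  · rw [Set.indicator_of_mem hy, Set.indicator_of_mem (this.2 hy), hw]
  · rw [Set.indicator_of_notMem hy, Set.indicator_of_notMem (mt this.1 hy)]

theorem volume_cube_add {d : ℕ} (x a : Rd d) (τ : ℝ) :
    volume (cube (x + a) τ) = volume (cube x τ) := by
  simpa using setLIntegral_cube_add (w := fun _ => 1) (fun _ => rfl) x τ

/-! ### The projection of the zero set along a coordinate axis -/

variable {m : ℕ}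

theorem volume_cube_linePoint (i : Fin (m + 1)) (t : ℝ) (z : Fin m → ℝ) {τ : ℝ} (hτ : 0 ≤ τ) :
    volume (cube (linePoint i t z) τ) =
      volume (Metric.closedBall t τ) * volume (Metric.closedBall z τ) := by
  have := lintegral_linePoint i (measurable_const (a := (1 : ℝ≥0∞))) (t := t) (z := z) hτ
  simpa only [setLIntegral_const, one_mul] using this

theorem latticePoint_single {d : ℕ} (i : Fin d) (n : ℤ) :
    (latticePoint (Pi.single i n) : Rd d) = (n : ℝ) • EuclideanSpace.single i 1 := by
  ext k
  by_cases hk : k = i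
  · subst hk; simp [latticePoint]
  · simp [latticePoint, hk]

theorem linePoint_mem_zeroSet {w : Rd (m + 1) → ℝ} {i : Fin (m + 1)} {t : ℝ} {z : Fin m → ℝ}
    (ht : t ∈ Set.Ico (-(1 / 2) : ℝ) (1 / 2)) (hz : z ∈ Metric.ball (0 : Fin m → ℝ) (1 / 2))
    (h : Tendsto (fun τ : ℝ => (∫⁻ y in cube (linePoint i t z) τ, ‖w y‖ₑ) /
      volume (cube (linePoint i t z) τ)) (𝓝[>] 0) (𝓝 0)) : linePoint i t z ∈ zeroSet w := by
  refine ⟨?_, h.limsup_eq⟩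
  refine (Fin.forall_iff_succAbove i).2 ⟨?_, fun k => ?_⟩
  · simpa only [linePoint, Fin.insertNth_apply_same] using ht
  · simp only [linePoint, Fin.insertNth_apply_succAbove]
    have h1 := (dist_pi_lt_iff (by norm_num)).1 (Metric.mem_ball.1 hz) k
    rw [Pi.zero_apply, Real.dist_eq, sub_zero, abs_lt] at h1
    exact ⟨h1.1.le, h1.2⟩

theorem exists_linePoint_mem_zeroSet {w : Rd (m + 1) → ℝ}
    (hw : ∀ x n, w (x + latticePoint n) = w x) {i : Fin (m + 1)} {t : ℝ} {z : Fin m → ℝ}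
    (ht : t ∈ Set.Icc (-(1 / 2) : ℝ) 1) (hz : z ∈ Metric.ball (0 : Fin m → ℝ) (1 / 2))
    (h : Tendsto (fun τ : ℝ => (∫⁻ y in cube (linePoint i t z) τ, ‖w y‖ₑ) /
      volume (cube (linePoint i t z) τ)) (𝓝[>] 0) (𝓝 0)) :
    ∃ t', linePoint i t' z ∈ zeroSet w := by
  rcases lt_or_ge t (1 / 2) with h1 | h1
  · exact ⟨t, linePoint_mem_zeroSet ⟨ht.1, h1⟩ hz h⟩
  -- A zero with t ≥ 1/2 lies outside the fundamental domain and is moved back by one period.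
  · refine ⟨t + ((-1 : ℤ) : ℝ), linePoint_mem_zeroSet ⟨?_, ?_⟩ hz ?_⟩
    · push_cast; linarith
    · push_cast; linarith [ht.2]
    · refine h.congr fun τ => ?_
      rw [linePoint_add, ← latticePoint_single, volume_cube_add,
        setLIntegral_cube_add fun y => by rw [hw]]

/-- Forgetting the i-th coordinate is 1-Lipschitz into ℝ^m with the sup norm, where the
m-dimensional Hausdorff measure is Lebesgue measure. -/
theorem hausdorffMeasure_pos_of_ae_exists_linePoint_mem {E : Set (Rd (m + 1))} {i : Fin (m + 1)}
    {Q : Set (Fin m → ℝ)} (hQ : 0 < volume Q) (h : ∀ᵐ z, z ∈ Q → ∃ t, linePoint i t z ∈ E) :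
    0 < Measure.hausdorffMeasure (((m + 1 : ℕ) : ℝ) - 1) E := by
  let proj : Rd (m + 1) → Fin m → ℝ := fun x k => x (i.succAbove k)
  have hproj : LipschitzWith 1 proj := by
    refine LipschitzWith.of_dist_le_mul fun x y => ?_
    rw [NNReal.coe_one, one_mul, dist_pi_le_iff dist_nonneg]
    intro k
    rw [dist_eq_norm, dist_eq_norm]
    exact PiLp.norm_apply_le (x - y) (i.succAbove k)
  have h1 : volume Q ≤ volume (proj '' E) := by
    refine measure_mono_ae ?_
    filter_upwards [h] with z hz hzQ
    obtain ⟨t, ht⟩ := hz hzQ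
    refine ⟨_, ht, ?_⟩
    funext k
    simp [proj, linePoint]
  have h2 := hproj.hausdorffMeasure_image_le (d := (m : ℝ)) (Nat.cast_nonneg m) E
  have h3 : (Measure.hausdorffMeasure (m : ℝ) : Measure (Fin m → ℝ)) = volume := by
    have := hausdorffMeasure_pi_real (ι := Fin m)
    rwa [Fintype.card_fin] at this
  rw [h3, ENNReal.coe_one, ENNReal.one_rpow, one_mul] at h2
  rw [Nat.cast_add, Nat.cast_one, add_sub_cancel_right]
  exact hQ.trans_le (h1.trans h2)

/-! ### Positivity of the Hausdorff measure -/

theorem latticeChar_single_pow_eq_one_iff {d : ℕ} (γ : Rd d) (i : Fin d) (J : ℕ) :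
    latticeChar γ (Pi.single i 1) ^ J = 1 ↔ ∃ n : ℤ, (J : ℝ) * γ i = n := by
  have h1 : ⟪γ, (latticePoint (Pi.single i 1) : Rd d)⟫_ℝ = γ i := by
    rw [latticePoint_single]
    simp [EuclideanSpace.inner_single_right]
  rw [latticeChar, h1, ← Circle.coe_pow, ← AddChar.map_nsmul_eq_pow, Real.fourierChar_apply,
    Complex.exp_eq_one_iff]
  have h2 : (2 * Real.pi * Complex.I : ℂ) ≠ 0 := Complex.two_pi_I_ne_zero
  constructor
  · rintro ⟨n, hn⟩
    refine ⟨-n, ?_⟩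
    have h3 : ((J • (-γ i) : ℝ) : ℂ) = n := by
      refine mul_right_cancel₀ h2 ?_
      rw [← hn]; push_cast; ring
    have h4 : J • (-γ i) = (n : ℝ) := by exact_mod_cast h3
    rw [nsmul_eq_mul] at h4
    push_cast
    linarith
  · rintro ⟨n, hn⟩
    refine ⟨-n, ?_⟩
    have h4 : J • (-γ i) = (-n : ℝ) := by rw [nsmul_eq_mul]; linarith
    rw [h4]
    push_cast
    ring

theorem exists_coord_of_notMem_integerLattice {d : ℕ} {γ : Rd d} {J : ℕ}
    (h : J • γ ∉ integerLattice d) : ∃ i, ¬ ∃ n : ℤ, (J : ℝ) * γ i = n := by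
  by_contra! hcon
  choose n hn using hcon
  refine h ⟨n, ?_⟩
  ext i
  simp [latticePoint, ← hn]

theorem minGenerators_mem {d K : ℕ} (F : Fin K → L2 d) :
    minGenerators (shiftInvariantSpace (Set.range F)) ≤ K ∧ ∃ G : Finset (L2 d),
      G.card = minGenerators (shiftInvariantSpace (Set.range F)) ∧
      shiftInvariantSpace (G : Set (L2 d)) = shiftInvariantSpace (Set.range F) := by
  classical
  have h : (Finset.univ.image F).card ∈ {n : ℕ | ∃ G : Finset (L2 d), G.card = n ∧
      shiftInvariantSpace (G : Set (L2 d)) = shiftInvariantSpace (Set.range F)} :=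
    ⟨_, rfl, by rw [Finset.coe_image, Finset.coe_univ, Set.image_univ]⟩
  refine ⟨(Nat.sInf_le h).trans (Finset.card_image_le.trans (by simp)), ?_⟩
  exact Nat.sInf_mem ⟨_, h⟩

theorem ae_isRegularPoint {d K : ℕ} (F : Fin K → L2 d) {γ : Rd d}
    (hγ : ∀ h ∈ shiftInvariantSpace (Set.range F), translateL2 γ h ∈
      shiftInvariantSpace (Set.range F)) {j : Fin K}
    (hj : (j : ℕ) + 1 = minGenerators (shiftInvariantSpace (Set.range F)))
    (hfin : ∀ᵐ x, fiberNormSq (fourierFamily F) x ≠ ⊤) :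
    ∀ᵐ x, IsRegularPoint (fourierFamily F) γ j x := by
  obtain ⟨-, G, hG, hG'⟩ := minGenerators_mem F
  filter_upwards [hfin, ae_finrank_span_fiber_le F G hG', ae_exists_linearMap_fiber_eq F hγ]
    with x h1 h2 h3
  exact ⟨h1, by rwa [hj, ← hG], h3⟩

theorem ofReal_sq_le_of_sub_sq_le {a b c e r : ℝ} {S : ℝ≥0∞} (hS : S ≠ ⊤) (hc : 0 ≤ c)
    (hr : 0 ≤ r) (he : e = S.toReal) (h : (a - b) ^ 2 ≤ c * e * r) :
    ENNReal.ofReal (a ^ 2) ≤ 2 * ENNReal.ofReal (b ^ 2) +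
      ENNReal.ofReal (2 * c) * S * ENNReal.ofReal r := by
  -- From a² ≤ 2b² + 2(a-b)²; the difference of the two sides is (a-2b)².
  have h1 : a ^ 2 ≤ 2 * b ^ 2 + 2 * c * e * r := by nlinarith [sq_nonneg (a - 2 * b)]
  have he0 : 0 ≤ e := he ▸ ENNReal.toReal_nonneg
  refine (ENNReal.ofReal_le_ofReal h1).trans (le_of_eq ?_)
  rw [ENNReal.ofReal_add (by positivity) (by positivity), ENNReal.ofReal_mul (by norm_num),
    ENNReal.ofReal_ofNat, ENNReal.ofReal_mul (by positivity), ENNReal.ofReal_mul (by positivity),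
    he, ENNReal.ofReal_toReal hS]

/-- Positivity of the Hausdorff measure of the zero set, for general families of functions. -/
theorem hausdorffMeasure_zeroSet_pos {K : ℕ} {H : Fin K → Rd (m + 1) → ℂ}
    (hm : ∀ k, Measurable (H k)) (hH : ∀ k, ∫⁻ x, ‖H k x‖ₑ ^ 2 ≠ ⊤) {i : Fin (m + 1)} {s : ℝ}
    (hs : 1 / 2 < s) (hHs : ∀ k, ∃ C : ℝ≥0∞, C ≠ ⊤ ∧ ∀ t : ℝ,
      shiftDistSq (H k) (t • EuclideanSpace.single i 1) ≤ C * ‖t‖ₑ ^ (2 * s))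
    {γ : Rd (m + 1)} {j : Fin K} (hreg : ∀ᵐ x, IsRegularPoint H γ j x)
    (hl : latticeChar γ (Pi.single i 1) ^ ((j : ℕ) + 1) ≠ 1) :
    0 < Measure.hausdorffMeasure (((m + 1 : ℕ) : ℝ) - 1) (zeroSet (gramianEigenvalue H j)) := by
  have hfin := ae_fiberNormSq_ne_top hm hH
  have haem : AEMeasurable fun x => √(gramianEigenvalue H j x) :=
    (aemeasurable_gramianEigenvalue hm hfin j).sqrt
  obtain ⟨g, hg, hgζ⟩ := haem
  -- The midpoint of the interval (2, 1+2s), nonempty because s > 1/2: p > 2 gives Hölder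
  -- continuity, p < 1+2s gives finite energy.
  set p : ℝ := (2 + (1 + 2 * s)) / 2 with hp
  have hp2 : 2 < p := by rw [hp]; linarith
  have hps : p < 1 + 2 * s := by rw [hp]; linarith
  set U : Rd (m + 1) → ℝ≥0∞ := fun x => ENNReal.ofReal (g x ^ 2) with hU
  have hUm : Measurable U := (hg.pow_const 2).ennreal_ofReal
  have hUζ : ∀ᵐ x, ‖gramianEigenvalue H j x‖ₑ = U x := by
    filter_upwards [hfin, hgζ] with x h1 h2
    have h3 := gramianEigenvalue_nonneg h1 j
    simp only [hU]
    rw [← h2, Real.sq_sqrt h3, Real.enorm_of_nonneg h3]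
  have hUN : ∀ᵐ x, U x ≤ fiberNormSq H x := by
    filter_upwards [hfin, hUζ] with x h1 h2
    rw [← h2, Real.enorm_of_nonneg (gramianEigenvalue_nonneg h1 j)]
    exact ofReal_gramianEigenvalue_le_fiberNormSq h1 j
  set Z := Metric.closedBall (0 : Fin m → ℝ) 2
  have hZ : MeasurableSet Z := Metric.isClosed_closedBall.measurableSet
  have hNm := measurable_fiberNormSq hm
  have hDm := measurable_fiberDistSq hm
  have hcube : ∀ f : Rd (m + 1) → ℝ≥0∞, Measurable f →
      ∫⁻ x in cube (0 : Rd (m + 1)) (2 : ℕ), f x =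
        ∫⁻ z in Z, ∫⁻ t in Set.Icc (-2 : ℝ) 2, f (linePoint i t z) := by
    intro f hf
    have h1 := lintegral_linePoint i hf (τ := 2) (t := 0) (z := 0) (by norm_num)
    rw [linePoint_zero, Real.closedBall_eq_Icc] at h1
    rw [Nat.cast_ofNat, h1]
    norm_num
    rfl
  have hNfin := lintegral_box_fiberNormSq_ne_top hm hH 2
  have hSfin := lintegral_lineEnergy_ne_top (D := fiberDistSq H) hDm
    (exists_lintegral_box_fiberDistSq_le hm hHs 2) hps
  have hSm := measurable_lineEnergy (D := fiberDistSq H) hDm i p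
  have hUfin : ∫⁻ x in cube (0 : Rd (m + 1)) (2 : ℕ), U x ≠ ⊤ :=
    ne_top_of_le_ne_top hNfin (lintegral_mono_ae (ae_restrict_of_ae hUN))
  rw [hcube _ hUm] at hUfin
  rw [hcube _ hNm] at hNfin
  have hNlm : Measurable fun z => ∫⁻ t in Set.Icc (-2 : ℝ) 2, fiberNormSq H (linePoint i t z) :=
    (hNm.comp (measurable_linePoint i)).lintegral_prod_left'
  have key := ae_exists_tendsto_average_zero (u := fun t z => U (linePoint i t z))
    (S := fun z => ENNReal.ofReal (2 * holderConst p) * lineEnergy (fiberDistSq H) i p z)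
    (q := p - 2) (hUm.comp (measurable_linePoint i)) (hSm.const_mul _) hZ
    (by rw [lintegral_const_mul' _ _ ENNReal.ofReal_ne_top]
        exact ENNReal.mul_ne_top ENNReal.ofReal_ne_top hSfin) hUfin (sub_pos.2 hp2) ?_
  · refine hausdorffMeasure_pos_of_ae_exists_linePoint_mem (i := i)
      (Metric.measure_ball_pos volume (0 : Fin m → ℝ) (show (0 : ℝ) < 1 / 2 by norm_num)) ?_
    filter_upwards [key] with z hz hzQ
    have hzZ : z ∈ interior Z :=
      Metric.ball_subset_interior_closedBall (Metric.ball_subset_ball (by norm_num) hzQ)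
    obtain ⟨t₀, ht₀, hlim⟩ := hz hzZ
    refine exists_linePoint_mem_zeroSet (gramianEigenvalue_add_latticePoint H j) ht₀ hzQ ?_
    refine hlim.congr' ?_
    filter_upwards [self_mem_nhdsWithin] with τ hτ
    rw [lintegral_congr_ae (ae_restrict_of_ae hUζ), volume_cube_linePoint i _ _ (le_of_lt hτ),
      lintegral_linePoint i hUm (le_of_lt hτ)]
  · filter_upwards [(ae_restrict_iff' hZ).1 (ae_lt_top hSm hSfin),
      (ae_restrict_iff' hZ).1 (ae_lt_top hNlm hNfin), ae_linePoint i hreg, ae_linePoint i hgζ]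
      with z h1 h2 h3 h4 hzZ
    have hx : Measurable fun t => linePoint i t z :=
      (measurable_linePoint i).comp (measurable_id.prodMk measurable_const)
    have hper : ∀ t, linePoint i (t + 1) z = linePoint i t z + latticePoint (Pi.single i 1) := by
      intro t
      rw [linePoint_add, latticePoint_single, Int.cast_one]
    have hS := (h1 hzZ).ne
    obtain ⟨A, hA, hA1, t₀, ht₀, hA2⟩ := exists_sq_le_mul_abs_sub_rpow hm hx hper h3 hl
      (hg.comp hx) (h4.mono fun t ht => ht.symm) hp2
      (S := lineEnergy (fiberDistSq H) i p z) rfl hS (h2 hzZ).ne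
    refine ⟨A, hA, fun s hs t ht => ?_, t₀, ht₀, fun t ht => ?_⟩
    · exact ofReal_sq_le_of_sub_sq_le hS (holderConst_nonneg p) (by positivity) rfl (hA1 s hs t ht)
    · have := ofReal_sq_le_of_sub_sq_le (b := 0) hS (holderConst_nonneg p)
        (Real.rpow_nonneg (abs_nonneg (t - t₀)) (p - 2)) rfl (by rw [sub_zero]; exact hA2 t ht)
      simpa using this

end

/-! ### The zero set under extra invariance -/

theorem mainTheorem12 {d K : ℕ} (s : ℝ) (hs : 1 / 2 < s) (hs' : s ≤ 1) (F : Fin K → L2 d)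
    (hinv : HasNontrivialExtraInvariance (shiftInvariantSpace (Set.range F)))
    (hF : ∀ k, MemSlobodeckij s ((𝓕 (F k) : L2 d) : Rd d → ℂ)) :
    ∃ j : Fin K, (j : ℕ) + 1 = minGenerators (shiftInvariantSpace (Set.range F)) ∧
      0 < Measure.hausdorffMeasure ((d : ℝ) - 1)
        (zeroSet (gramianEigenvalue (fun k => ((𝓕 (F k) : L2 d) : Rd d → ℂ)) j)) := by
  obtain ⟨γ, -, hγV, hγJ⟩ := hinv
  obtain ⟨i, hi⟩ := exists_coord_of_notMem_integerLattice hγJ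
  -- The existence of a coordinate i already forces d ≥ 1.
  obtain ⟨m, rfl⟩ : ∃ m, d = m + 1 := Nat.exists_eq_succ_of_ne_zero i.pos.ne'
  -- J = 0 would make Jγ_i = 0 an integer; thus J ≥ 1, and the 0-based index J - 1 stands for ζ_J.
  have hJ : minGenerators (shiftInvariantSpace (Set.range F)) ≠ 0 := fun h0 =>
    hi ⟨0, by rw [h0]; simp⟩
  have hJK := (minGenerators_mem F).1
  let j : Fin K := ⟨minGenerators (shiftInvariantSpace (Set.range F)) - 1, by omega⟩
  have hj : (j : ℕ) + 1 = minGenerators (shiftInvariantSpace (Set.range F)) :=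
    Nat.sub_add_cancel (Nat.one_le_iff_ne_zero.2 hJ)
  refine ⟨j, hj, ?_⟩
  have hm : ∀ k, Measurable (fourierFamily F k) := fun k =>
    (Lp.stronglyMeasurable (𝓕 (F k) : L2 (m + 1))).measurable
  have hH : ∀ k, ∫⁻ x, ‖fourierFamily F k x‖ₑ ^ 2 ≠ ⊤ := fun k => by
    rw [← eLpNorm_two_sq]
    exact ENNReal.pow_ne_top (Lp.eLpNorm_ne_top (𝓕 (F k) : L2 (m + 1)))
  refine hausdorffMeasure_zeroSet_pos (H := fourierFamily F) (i := i) (γ := γ) hm hH hs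
    (fun k => (hF k).exists_shiftDistSq_le hs hs' (hm k) i)
    (ae_isRegularPoint F hγV hj (ae_fiberNormSq_ne_top hm hH)) ?_
  rw [hj, ne_eq, latticeChar_single_pow_eq_one_iff]
  exact hi
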